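/- Identify $\mathbb{R}^2$ with the Euclidean plane and $\mathbb{C}^2$ with the space of spinors $z=(z_1,z_2)$. Let $$\alpha_1=\begin{pmatrix}0&1\\1&0\end{pmatrix},\qquad \alpha_2=\begin{pmatrix}0&-i\\i&0\end{pmatrix},\qquad \mathcal{D}=-i(\alpha_1\partial_{x_1}+\alpha_2\partial_{x_2}),$$ let $\beta_1,\beta_2\ge 0$, let $h(z)=|z|^2H(z/|z|)$ for $z\in\mathbb{C}^2\setminus\{0\}$ and $h(0)=0$, where $$H(z)=\begin{pmatrix}\beta_1|z_1|^2+2\beta_2|z_2|^2&0\\0&\beta_1|z_2|^2+2\beta_2|z_1|^2\end{pmatrix}\quad\text{for }|z|=1,$$ and for $0\ne x\in\mathbb{R}^2$ let $$\mathcal{U}(x)=\begin{pmatrix}0&-i\,\frac{x_1-ix_2}{|x|}\\ i\,\frac{x_1+ix_2}{|x|}&0\end{pmatrix}.$$ Let $\psi\in L^4(\mathbb{R}^2,\mathbb{C}^2)$ be a weak solution of $\mathcal{D}\psi=h(\psi)\psi$ on $\mathbb{R}^2$, that is, $$\int_{\mathbb{R}^2}\langle\mathcal{D}\phi,\psi\rangle\,dx=\int_{\mathbb{R}^2}\langle\phi,h(\psi)\psi\rangle\,dx\qquad\text{for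 all }\phi\in C_c^\infty(\mathbb{R}^2,\mathbb{C}^2).$$ Then, after modification on a null set, $\psi\in C^\infty(\mathbb{R}^2,\mathbb{C}^2)$, and $\psi$ has a complete asymptotic expansion at infinity: there are coefficients $\zeta_\alpha\in\mathbb{C}^2$, $\alpha\in\mathbb{N}_0^2$, such that for every $M\in\mathbb{N}_0$ there is a $C_M<\infty$ with $$\left|\psi(x)-|x|^{-1}\,\mathcal{U}(x)\sum_{|\alpha|\le M}\frac{x^\alpha}{|x|^{2|\alpha|}}\,\zeta_\alpha\right|\le C_M|x|^{-2-M}\qquad\text{for all }|x|\ge 1,$$ where $x^\alpha=x_1^{a}x_2^{b}$ and $|\alpha|=a+b$ for a multi-index $\alpha=(a,b)$. -/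

import Mathlib

open MeasureTheory
open scoped ContDiff

noncomputable section

namespace CriticalDirac

/-- The Euclidean plane `ℝ²`. -/
abbrev Plane : Type := EuclideanSpace ℝ (Fin 2)

/-- The space `ℂ²` of spinors, with its Hermitian norm. -/
abbrev Spinor : Type := EuclideanSpace ℂ (Fin 2)

/-- A `2 × 2` complex matrix applied to a spinor. -/
def act (A : Matrix (Fin 2) (Fin 2) ℂ) (z : Spinor) : Spinor :=
  WithLp.toLp 2 (A.mulVec z.ofLp)

/-- The matrices `α₁, α₂` (indexed by `0, 1`). -/
def alpha : Fin 2 → Matrix (Fin 2) (Fin 2) ℂ :=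
  ![!![0, 1; 1, 0], !![0, -Complex.I; Complex.I, 0]]

/-- The Dirac operator `𝒟 φ = -i ∑ⱼ αⱼ ∂ⱼ φ`; it is only applied to smooth `φ`. -/
def dirac (φ : Plane → Spinor) (x : Plane) : Spinor :=
  (-Complex.I) • ∑ j : Fin 2, act (alpha j) (fderiv ℝ φ x (EuclideanSpace.single j 1))

/-- `ψ` is a weak solution of `𝒟 ψ = h(ψ) ψ` on `ℝ²`. -/
def IsWeakSolution (h : Spinor → Matrix (Fin 2) (Fin 2) ℂ) (ψ : Plane → Spinor) : Prop :=
  ∀ φ : Plane → Spinor, ContDiff ℝ ∞ φ → HasCompactSupport φ →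
    ∫ x, inner ℂ (dirac φ x) (ψ x) = ∫ x, inner ℂ (φ x) (act (h (ψ x)) (ψ x))

/-- The matrix `H(z)`, `|z| = 1`, with diagonal entries `β₁|z₁|² + 2β₂|z₂|²` and
`β₁|z₂|² + 2β₂|z₁|²`. -/
def angular (β₁ β₂ : ℝ) (z : Spinor) : Matrix (Fin 2) (Fin 2) ℂ :=
  !![((β₁ * ‖z 0‖ ^ 2 + 2 * β₂ * ‖z 1‖ ^ 2 : ℝ) : ℂ), 0;
     0, ((β₁ * ‖z 1‖ ^ 2 + 2 * β₂ * ‖z 0‖ ^ 2 : ℝ) : ℂ)]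

/-- The nonlinearity `h(z) = |z|² H(z/|z|)`, with `h(0) = 0`. -/
def nonlinearity (β₁ β₂ : ℝ) (z : Spinor) : Matrix (Fin 2) (Fin 2) ℂ :=
  ‖z‖ ^ 2 • angular β₁ β₂ (‖z‖⁻¹ • z)

/-- The unitary matrix `𝒰(x)`, for `x ≠ 0`. -/
def unitaryMatrix (x : Plane) : Matrix (Fin 2) (Fin 2) ℂ :=
  !![0, -Complex.I * (((x 0 : ℂ) - Complex.I * (x 1 : ℂ)) / (‖x‖ : ℂ));
     Complex.I * (((x 0 : ℂ) + Complex.I * (x 1 : ℂ)) / (‖x‖ : ℂ)), 0]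

/-- The partial sum `∑_{|α| ≤ M} (x^α / |x|^{2|α|}) ζ_α` over multi-indices `α ∈ ℕ₀²`. -/
def expansionSum (ζ : ℕ × ℕ → Spinor) (M : ℕ) (x : Plane) : Spinor :=
  ∑ k ∈ Finset.range (M + 1), ∑ α ∈ Finset.HasAntidiagonal.antidiagonal k,
    (x 0 ^ α.1 * x 1 ^ α.2 / ‖x‖ ^ (2 * (α.1 + α.2))) • ζ α

end CriticalDirac

end

open scoped ENNReal FourierTransform

/-! In the unknowns `v₁ = ψ₁`, `v₂ = ψ̄₂` the Dirac equation becomes a pair of scalar equations `(∂₁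
+ i∂₂) v = -F` with `F` cubic in `v₁, v₂` and their conjugates (`IsWeakSystem`). Three facts about
this system give the theorem.

Boundedness. A global `L⁴` solution of `(∂₁ + i∂₂) v = -F` is a multiple of the Cauchy integral of
`F` (`WeakDbar.ae_enorm_le`), so `u = |v₁| + |v₂|` satisfies `u ≤ C I(u³)` with `I` the Riesz
potential of kernel `1/|x - y|`. This inequality is scale invariant for `L⁴`, so Hölder estimates
alone gain nothing. Smallness comes from absolute continuity of `∫ u⁴`: the part of `u³` on a high
level set acts on `L²` norms over balls with a small constant, and the remaining part is bounded.
Iterating improves the growth of these norms from `r^(1/2)` to `r^(9/10)`; one further application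
of the potential makes `u` bounded (`exists_ae_le_of_le_rieszPotential_cube`).

Smoothness. For a cutoff `η`, the Fourier transform of `η v`, multiplied by `2π|ξ|`, has the modulus
of the transform of `η F - (dbar η) v`. Boundedness puts this right hand side in `L²`, so localized
solutions have one derivative in `L²`. Bounded functions with that property form an algebra, so a
second derivative is gained, and in the plane this makes the transform integrable. From there the
weighted spaces `∫ (1 + |ξ|)^k |f̂| < ∞`, algebras under multiplication, gain one power of `|ξ|` per
round.

Behaviour at infinity. The Kelvin transform `v ↦ -i z⁻¹ conj v(1/z̄)` preserves the `L⁴` norm and,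
after exchanging the two components, maps the system to itself away from the origin. A point is
removable for `L⁴` solutions (`weakDbar_of_punctured`), so the transformed pair is again a global
weak solution, hence smooth at the origin. Its Taylor expansion there, pulled back by inversion and
multiplied by `|x|⁻¹ 𝒰(x)`, is the expansion of `ψ`; its terms of degree `k` produce the terms with
`|α| = k`. -/

namespace CriticalDirac

/-! ### Riesz potentials of measures with prescribed growth on balls -/

/-- The Riesz-type kernel `|z|^{-b}`; its value at the origin is `0` when `b ≠ 0`. -/
noncomputable def rieszKernel (b : ℝ) (z : Plane) : ℝ≥0∞ := ENNReal.ofReal (‖z‖ ^ (-b))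

lemma measurable_rieszKernel (b : ℝ) : Measurable (rieszKernel b) := by
  unfold rieszKernel; fun_prop

lemma rieszKernel_sub_comm (b : ℝ) (x y : Plane) :
    rieszKernel b (x - y) = rieszKernel b (y - x) := by
  simp only [rieszKernel, norm_sub_rev]

lemma rieszKernel_mul {s t : ℝ} (hs : 0 < s) (ht : 0 < t) (z : Plane) :
    rieszKernel s z * rieszKernel t z = rieszKernel (s + t) z := by
  unfold rieszKernel
  rw [← ENNReal.ofReal_mul (by positivity)]
  rcases eq_or_ne z 0 with rfl | hz
  · rw [norm_zero, Real.zero_rpow (by linarith), Real.zero_rpow (by linarith),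
      Real.zero_rpow (by linarith)]
    simp
  · rw [← Real.rpow_add (norm_pos_iff.2 hz)]
    congr 2; ring

lemma rieszKernel_rpow (s : ℝ) {p : ℝ} (hp : 0 ≤ p) (z : Plane) :
    rieszKernel s z ^ p = rieszKernel (s * p) z := by
  unfold rieszKernel
  rw [ENNReal.ofReal_rpow_of_nonneg (by positivity) hp, ← Real.rpow_mul (norm_nonneg _)]
  congr 2; ring

/-- Decompose into dyadic annuli: at outer radius `R / 2 ^ n` the kernel is at most `(R / 2 ^ (n +
1)) ^ (-b)` and the mass at most `c ^ n * φ R`. The resulting geometric series is summed in `[0,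
∞]`, so its ratio `2 ^ b * c` need not be small. -/
lemma lintegral_rieszKernel_ball_le {μ : Measure Plane} {φ : ℝ → ℝ≥0∞} {c : ℝ≥0∞} {b : ℝ}
    (hb : 0 < b) {x : Plane} (hμ : ∀ r > 0, μ (Metric.ball x r) ≤ φ r)
    (hφ : ∀ r > 0, φ (r / 2) ≤ c * φ r) {R : ℝ} (hR : 0 < R) :
    ∫⁻ y in Metric.ball x R, rieszKernel b (x - y) ∂μ ≤
      ENNReal.ofReal (2 ^ b) * (1 - ENNReal.ofReal (2 ^ b) * c)⁻¹ *
        (ENNReal.ofReal (R ^ (-b)) * φ R) := by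
  have hpt : ∀ y ∈ Metric.ball x R, rieszKernel b (x - y) ≤
      ∑' n : ℕ, (Metric.ball x (R / 2 ^ n)).indicator
        (fun _ => ENNReal.ofReal ((R / 2 ^ (n + 1)) ^ (-b))) y := by
    intro y hy
    rcases eq_or_ne (x - y) 0 with h0 | h0
    · simp [rieszKernel, h0, Real.zero_rpow (neg_ne_zero.2 hb.ne')]
    have hpos := norm_pos_iff.2 h0
    rw [Metric.mem_ball, dist_comm, dist_eq_norm] at hy
    obtain ⟨n, hn1, hn2⟩ := exists_nat_pow_near (x := R / ‖x - y‖) (y := (2 : ℝ))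
      (by rw [one_le_div hpos]; exact hy.le) (by norm_num)
    have hle : R / 2 ^ (n + 1) ≤ ‖x - y‖ := by
      rw [div_lt_iff₀ hpos] at hn2
      rw [div_le_iff₀ (by positivity)]; linarith
    have hge : ‖x - y‖ ≤ R / 2 ^ n := by
      rw [le_div_iff₀ hpos] at hn1
      rw [le_div_iff₀ (by positivity)]; linarith
    -- A point on the sphere of radius `R / 2 ^ n` is missed by the open ball of that radius. The
    -- preceding term contains it and has exactly the right kernel value; for `n = 0` the point
    -- would lie outside the ball of radius `R`.
    rcases eq_or_lt_of_le hge with hge | hge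
    · rcases n with _ | n
      · simp at hge; linarith
      refine le_trans ?_ (ENNReal.le_tsum n)
      rw [Set.indicator_of_mem]
      · unfold rieszKernel; rw [hge]
      · rw [Metric.mem_ball, dist_comm, dist_eq_norm, hge]
        apply div_lt_div_of_pos_left hR (by positivity)
        exact pow_lt_pow_right₀ (by norm_num) (by omega)
    · refine le_trans ?_ (ENNReal.le_tsum n)
      rw [Set.indicator_of_mem (by rwa [Metric.mem_ball, dist_comm, dist_eq_norm])]
      exact ENNReal.ofReal_le_ofReal
        (Real.rpow_le_rpow_of_nonpos (by positivity) hle (by linarith))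
  have hφn : ∀ n : ℕ, φ (R / 2 ^ n) ≤ c ^ n * φ R := by
    intro n
    induction n with
    | zero => simp
    | succ n ih =>
      have h := hφ (R / 2 ^ n) (by positivity)
      rw [div_div, ← pow_succ] at h
      calc _ ≤ _ := h
        _ ≤ c * (c ^ n * φ R) := by gcongr
        _ = _ := by ring
  calc ∫⁻ y in Metric.ball x R, rieszKernel b (x - y) ∂μ
      ≤ ∫⁻ y in Metric.ball x R, ∑' n : ℕ, (Metric.ball x (R / 2 ^ n)).indicator
        (fun _ => ENNReal.ofReal ((R / 2 ^ (n + 1)) ^ (-b))) y ∂μ :=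
        setLIntegral_mono' measurableSet_ball hpt
    _ ≤ ∫⁻ y, ∑' n : ℕ, (Metric.ball x (R / 2 ^ n)).indicator
        (fun _ => ENNReal.ofReal ((R / 2 ^ (n + 1)) ^ (-b))) y ∂μ := setLIntegral_le_lintegral _ _
    _ = ∑' n : ℕ, ENNReal.ofReal ((R / 2 ^ (n + 1)) ^ (-b)) * μ (Metric.ball x (R / 2 ^ n)) := by
        rw [lintegral_tsum fun n => (measurable_const.indicator measurableSet_ball).aemeasurable]
        simp only [lintegral_indicator_const measurableSet_ball]
    _ ≤ ∑' n : ℕ, (ENNReal.ofReal (2 ^ b) * c) ^ n *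
          (ENNReal.ofReal (2 ^ b) * (ENNReal.ofReal (R ^ (-b)) * φ R)) := by
        refine ENNReal.tsum_le_tsum fun n => ?_
        have h1 : (R / 2 ^ (n + 1)) ^ (-b) = (2 ^ b) ^ n * (2 ^ b * R ^ (-b)) := by
          rw [Real.div_rpow hR.le (by positivity), Real.rpow_neg (by positivity : (0:ℝ) ≤ 2 ^ (n+1)),
            div_inv_eq_mul, ← Real.rpow_natCast, ← Real.rpow_mul (by norm_num), mul_comm _ b,
            Real.rpow_mul (by norm_num), Real.rpow_natCast]
          ring
        rw [h1, ENNReal.ofReal_mul (by positivity), ENNReal.ofReal_pow (by positivity),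
          ENNReal.ofReal_mul (by positivity), mul_pow]
        calc _ ≤ (ENNReal.ofReal (2 ^ b) ^ n *
              (ENNReal.ofReal (2 ^ b) * ENNReal.ofReal (R ^ (-b)))) * (c ^ n * φ R) := by
              gcongr
              exact (hμ _ (by positivity)).trans (hφn n)
          _ = _ := by ring
    _ = _ := by
        rw [ENNReal.tsum_mul_right, ENNReal.tsum_geometric]; ring

/-- Dyadic annuli going outwards, with series ratio `2 ^ (-b) * c`. The leading `c` appears because
the mass is measured at the outer radius `2 ^ (n + 1) * R` and the kernel at the inner one. -/
lemma lintegral_rieszKernel_compl_ball_le {μ : Measure Plane} {φ : ℝ → ℝ≥0∞} {c : ℝ≥0∞} {b : ℝ}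
    (hb : 0 < b) {x : Plane} (hμ : ∀ r > 0, μ (Metric.ball x r) ≤ φ r)
    (hφ : ∀ r > 0, φ (2 * r) ≤ c * φ r) {R : ℝ} (hR : 0 < R) :
    ∫⁻ y in (Metric.ball x R)ᶜ, rieszKernel b (x - y) ∂μ ≤
      c * (1 - ENNReal.ofReal (2 ^ (-b)) * c)⁻¹ * (ENNReal.ofReal (R ^ (-b)) * φ R) := by
  have hpt : ∀ y ∈ (Metric.ball x R)ᶜ, rieszKernel b (x - y) ≤
      ∑' n : ℕ, (Metric.ball x (2 ^ (n + 1) * R)).indicator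
        (fun _ => ENNReal.ofReal ((2 ^ n * R) ^ (-b))) y := by
    intro y hy
    rw [Set.mem_compl_iff, Metric.mem_ball, dist_comm, dist_eq_norm, not_lt] at hy
    obtain ⟨n, hn1, hn2⟩ := exists_nat_pow_near (x := ‖x - y‖ / R) (y := (2 : ℝ))
      (by rwa [one_le_div hR]) (by norm_num)
    rw [le_div_iff₀ hR] at hn1
    rw [div_lt_iff₀ hR] at hn2
    refine le_trans ?_ (ENNReal.le_tsum n)
    rw [Set.indicator_of_mem (by rwa [Metric.mem_ball, dist_comm, dist_eq_norm])]
    exact ENNReal.ofReal_le_ofReal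
        (Real.rpow_le_rpow_of_nonpos (by positivity) hn1 (by linarith))
  have hφn : ∀ n : ℕ, φ (2 ^ n * R) ≤ c ^ n * φ R := by
    intro n
    induction n with
    | zero => simp
    | succ n ih =>
      have h := hφ (2 ^ n * R) (by positivity)
      rw [← mul_assoc, ← pow_succ'] at h
      calc _ ≤ _ := h
        _ ≤ c * (c ^ n * φ R) := by gcongr
        _ = _ := by ring
  calc ∫⁻ y in (Metric.ball x R)ᶜ, rieszKernel b (x - y) ∂μ
      ≤ ∫⁻ y in (Metric.ball x R)ᶜ, ∑' n : ℕ, (Metric.ball x (2 ^ (n + 1) * R)).indicator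
        (fun _ => ENNReal.ofReal ((2 ^ n * R) ^ (-b))) y ∂μ :=
        setLIntegral_mono' measurableSet_ball.compl hpt
    _ ≤ ∫⁻ y, ∑' n : ℕ, (Metric.ball x (2 ^ (n + 1) * R)).indicator
        (fun _ => ENNReal.ofReal ((2 ^ n * R) ^ (-b))) y ∂μ := setLIntegral_le_lintegral _ _
    _ = ∑' n : ℕ, ENNReal.ofReal ((2 ^ n * R) ^ (-b)) * μ (Metric.ball x (2 ^ (n + 1) * R)) := by
        rw [lintegral_tsum fun n => (measurable_const.indicator measurableSet_ball).aemeasurable]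
        simp only [lintegral_indicator_const measurableSet_ball]
    _ ≤ ∑' n : ℕ, (ENNReal.ofReal (2 ^ (-b)) * c) ^ n *
          (c * (ENNReal.ofReal (R ^ (-b)) * φ R)) := by
        refine ENNReal.tsum_le_tsum fun n => ?_
        have h1 : (2 ^ n * R) ^ (-b) = (2 ^ (-b)) ^ n * R ^ (-b) := by
          rw [Real.mul_rpow (by positivity) hR.le, ← Real.rpow_natCast, ← Real.rpow_mul
            (by norm_num), mul_comm _ (-b), Real.rpow_mul (by norm_num), Real.rpow_natCast]
        rw [h1, ENNReal.ofReal_mul (by positivity), ENNReal.ofReal_pow (by positivity), mul_pow]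
        calc _ ≤ (ENNReal.ofReal (2 ^ (-b)) ^ n * ENNReal.ofReal (R ^ (-b))) *
                (c ^ (n + 1) * φ R) := by
              gcongr
              exact (hμ _ (by positivity)).trans (hφn (n + 1))
          _ = _ := by ring
    _ = _ := by
        rw [ENNReal.tsum_mul_right, ENNReal.tsum_geometric]; ring

lemma volume_ball_plane (x : Plane) (r : ℝ) :
    volume (Metric.ball x r) = ENNReal.ofReal r ^ 2 * ENNReal.ofReal Real.pi := by
  rw [EuclideanSpace.volume_ball_fin_two]

lemma exists_lintegral_rieszKernel_ball_volume_le {b : ℝ} (hb : 0 < b) (hb2 : b < 2) :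
    ∃ C : ℝ≥0∞, C ≠ ⊤ ∧ ∀ (x : Plane) (R : ℝ), 0 < R →
      ∫⁻ y in Metric.ball x R, rieszKernel b (x - y) ≤ C * ENNReal.ofReal (R ^ (2 - b)) := by
  have h4 : ENNReal.ofReal (2 ^ b) * ENNReal.ofReal (1 / 4) < 1 := by
    rw [← ENNReal.ofReal_mul (by positivity), ENNReal.ofReal_lt_one]
    have : (2 : ℝ) ^ b < 2 ^ (2 : ℝ) := Real.rpow_lt_rpow_of_exponent_lt (by norm_num) hb2
    norm_num at this ⊢; linarith
  refine ⟨ENNReal.ofReal (2 ^ b) * (1 - ENNReal.ofReal (2 ^ b) * ENNReal.ofReal (1 / 4))⁻¹ *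
    ENNReal.ofReal Real.pi, ?_, fun x R hR => ?_⟩
  · refine ENNReal.mul_ne_top (ENNReal.mul_ne_top ENNReal.ofReal_ne_top ?_) ENNReal.ofReal_ne_top
    exact ENNReal.inv_ne_top.2 (tsub_pos_of_lt h4).ne'
  · refine (lintegral_rieszKernel_ball_le (φ := fun r => volume (Metric.ball x r)) hb
      (fun r _ => le_rfl) (c := ENNReal.ofReal (1 / 4)) (fun r hr => ?_) hR).trans_eq ?_
    · simp only [volume_ball_plane]
      have hr' : (0 : ℝ) ≤ r / 2 := by linarith [hr.lt]
      rw [← ENNReal.ofReal_pow hr', ← ENNReal.ofReal_pow hr.lt.le,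
        ← mul_assoc, ← ENNReal.ofReal_mul (by positivity : (0 : ℝ) ≤ 1 / 4)]
      apply le_of_eq; congr 2; ring
    · rw [volume_ball_plane, ← ENNReal.ofReal_pow hR.le]
      rw [show R ^ (2 - b) = R ^ (-b) * R ^ 2 by
        rw [← Real.rpow_natCast, ← Real.rpow_add hR]; congr 1; push_cast; ring,
        ENNReal.ofReal_mul (by positivity)]
      ring

/-- A measure on the plane whose balls have growth `φ` has a Riesz potential in the Morrey space
given by the shift of the growth. -/
lemma exists_lintegral_rieszPotential_rpow_le {p q s : ℝ} (hpq : p.HolderConjugate q)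
    (hs0 : 0 < s) (hs1 : s < 1) (hsp : s * p < 2) {c c' : ℝ≥0∞}
    (hc : ENNReal.ofReal (2 ^ ((1 - s) * q)) * c < 1)
    (hc' : ENNReal.ofReal (2 ^ (-1 : ℝ)) * c' < 1) :
    ∃ C : ℝ≥0∞, C ≠ ⊤ ∧ ∀ (μ : Measure Plane) [SFinite μ] (φ : ℝ → ℝ≥0∞),
      (∀ x, ∀ r > 0, μ (Metric.ball x r) ≤ φ r) → (∀ r > 0, φ (r / 2) ≤ c * φ r) →
      (∀ r > 0, φ (2 * r) ≤ c' * φ r) → ∀ (x₀ : Plane) (ρ : ℝ), 0 < ρ →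
      ∫⁻ x in Metric.ball x₀ ρ, (∫⁻ y, rieszKernel 1 (x - y) ∂μ) ^ p ≤
        C * (φ ρ ^ p * ENNReal.ofReal (ρ ^ (2 - p))) := by
  have hp0 := hpq.pos
  have hq0 := hpq.symm.pos
  have hp1 : 1 < p := hpq.lt
  have hpq' : q * (p - 1) = p := by have := hpq.sub_one_mul_conj; linarith
  have hc'top : c' ≠ ⊤ := by
    rintro rfl
    rw [ENNReal.mul_top (by positivity)] at hc'
    simp at hc'
  obtain ⟨Cv, hCv, hv⟩ := exists_lintegral_rieszKernel_ball_volume_le (b := s * p)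
    (by positivity) hsp
  set D : ℝ≥0∞ := ENNReal.ofReal (2 ^ ((1 - s) * q)) *
    (1 - ENNReal.ofReal (2 ^ ((1 - s) * q)) * c)⁻¹ with hD
  set E : ℝ≥0∞ := c' * (1 - ENNReal.ofReal (2 ^ (-1 : ℝ)) * c')⁻¹ with hE
  have hDtop : D ≠ ⊤ := ENNReal.mul_ne_top ENNReal.ofReal_ne_top
    (ENNReal.inv_ne_top.2 (tsub_pos_of_lt hc).ne')
  have hEtop : E ≠ ⊤ := ENNReal.mul_ne_top hc'top
    (ENNReal.inv_ne_top.2 (tsub_pos_of_lt hc').ne')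
  refine ⟨2 ^ (p - 1) * (c' * Cv * D ^ (p - 1) + E ^ p * ENNReal.ofReal Real.pi), ?_, ?_⟩
  · refine ENNReal.mul_ne_top (ENNReal.rpow_ne_top_of_nonneg (by linarith) (by simp))
      (ENNReal.add_ne_top.2 ⟨?_, ?_⟩)
    · exact ENNReal.mul_ne_top (ENNReal.mul_ne_top hc'top hCv)
        (ENNReal.rpow_ne_top_of_nonneg (by linarith) hDtop)
    · exact ENNReal.mul_ne_top (ENNReal.rpow_ne_top_of_nonneg (by linarith) hEtop)
        ENNReal.ofReal_ne_top
  intro μ _ φ hμ hφ hφ' x₀ ρ hρ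
  have mk : ∀ b, Measurable fun z : Plane × Plane => rieszKernel b (z.1 - z.2) := fun b =>
    (measurable_rieszKernel b).comp (measurable_fst.sub measurable_snd)
  have mk1 : ∀ b x, Measurable fun y : Plane => rieszKernel b (x - y) := fun b x =>
    (measurable_rieszKernel b).comp (measurable_const.sub measurable_id)
  have hfar : ∀ x, ∫⁻ y in (Metric.ball x ρ)ᶜ, rieszKernel 1 (x - y) ∂μ ≤
      E * (ENNReal.ofReal (ρ ^ (-1 : ℝ)) * φ ρ) := fun x =>
    lintegral_rieszKernel_compl_ball_le one_pos (hμ x) hφ' hρ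
  -- Hölder for the factorization `|z|⁻¹ = |z|^(-s) |z|^(-(1-s))`. The second factor, to the power
  -- `q`, is bounded for each `x` by the growth of `μ`. The first, to the power `p`, is bounded only
  -- after integration in `x`, where `s * p < 2` gives local integrability.
  have hnear : ∀ x, (∫⁻ y in Metric.ball x ρ, rieszKernel 1 (x - y) ∂μ) ^ p ≤
      (∫⁻ y in Metric.ball x ρ, rieszKernel (s * p) (x - y) ∂μ) *
        (D * (ENNReal.ofReal (ρ ^ (-((1 - s) * q))) * φ ρ)) ^ (p - 1) := by
    intro x
    have h := ENNReal.lintegral_mul_le_Lp_mul_Lq (μ.restrict (Metric.ball x ρ)) hpq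
      (f := fun y => rieszKernel s (x - y)) (g := fun y => rieszKernel (1 - s) (x - y))
      (mk1 _ _).aemeasurable (mk1 _ _).aemeasurable
    simp only [Pi.mul_apply, rieszKernel_mul hs0 (sub_pos.2 hs1), rieszKernel_rpow _ hp0.le,
      rieszKernel_rpow _ hq0.le, add_sub_cancel] at h
    have h2 := lintegral_rieszKernel_ball_le (b := (1 - s) * q)
      (mul_pos (sub_pos.2 hs1) hq0) (hμ x) hφ hρ
    calc _ ≤ _ := ENNReal.rpow_le_rpow h hp0.le
      _ = (∫⁻ y in Metric.ball x ρ, rieszKernel (s * p) (x - y) ∂μ) *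
          (∫⁻ y in Metric.ball x ρ, rieszKernel ((1 - s) * q) (x - y) ∂μ) ^ (p - 1) := by
        rw [ENNReal.mul_rpow_of_nonneg _ _ hp0.le, ← ENNReal.rpow_mul, ← ENNReal.rpow_mul,
          one_div_mul_cancel hp0.ne', ENNReal.rpow_one]
        congr 2
        field_simp; linarith
      _ ≤ _ := by gcongr
  -- Tonelli: if `x` lies in the ball about `x₀` and `|x - y| < ρ`, then `y` lies in the doubled
  -- ball. Integrating the kernel in `x` first leaves the mass of that ball.
  have hdouble : ∫⁻ x in Metric.ball x₀ ρ, ∫⁻ y in Metric.ball x ρ, rieszKernel (s * p) (x - y) ∂μ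
      ≤ (c' * φ ρ) * (Cv * ENNReal.ofReal (ρ ^ (2 - s * p))) := by
    have hS : MeasurableSet {z : Plane × Plane | dist z.1 z.2 < ρ} :=
      measurableSet_lt measurable_dist measurable_const
    set G : Plane × Plane → ℝ≥0∞ := {z : Plane × Plane | dist z.1 z.2 < ρ}.indicator
      (fun z => rieszKernel (s * p) (z.1 - z.2)) with hG
    have mG : Measurable G := (mk _).indicator hS
    calc _ ≤ ∫⁻ x in Metric.ball x₀ ρ, ∫⁻ y in Metric.ball x₀ (2 * ρ), G (x, y) ∂μ := by
          refine setLIntegral_mono' measurableSet_ball fun x hx => ?_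
          rw [← lintegral_indicator measurableSet_ball, ← lintegral_indicator measurableSet_ball]
          refine lintegral_mono fun y => ?_
          by_cases hy : y ∈ Metric.ball x ρ
          · rw [Set.indicator_of_mem hy, Set.indicator_of_mem]
            · rw [hG, Set.indicator_of_mem]
              rw [Set.mem_ofPred_eq, dist_comm]; exact hy
            · rw [Metric.mem_ball] at *
              linarith [dist_triangle y x x₀]
          · rw [Set.indicator_of_notMem hy]; simp
      _ = ∫⁻ y in Metric.ball x₀ (2 * ρ), (∫⁻ x in Metric.ball x₀ ρ, G (x, y)) ∂μ :=
          lintegral_lintegral_swap (f := fun x y => G (x, y)) mG.aemeasurable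
      _ ≤ ∫⁻ y in Metric.ball x₀ (2 * ρ), Cv * ENNReal.ofReal (ρ ^ (2 - s * p)) ∂μ := by
          refine lintegral_mono fun y => ?_
          refine le_trans ?_ (hv y ρ hρ)
          rw [← lintegral_indicator (s := Metric.ball y ρ) measurableSet_ball]
          refine (setLIntegral_le_lintegral _ _).trans (lintegral_mono fun x => ?_)
          by_cases hx : dist x y < ρ
          · rw [Set.indicator_of_mem (by exact hx), hG, Set.indicator_of_mem (by exact hx),
              rieszKernel_sub_comm]
          · rw [hG, Set.indicator_of_notMem (by exact hx)]; simp
      _ = Cv * ENNReal.ofReal (ρ ^ (2 - s * p)) * μ (Metric.ball x₀ (2 * ρ)) := by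
          rw [setLIntegral_const]
      _ ≤ _ := by
          rw [mul_comm]
          gcongr
          exact (hμ _ _ (by positivity)).trans (hφ' ρ hρ)
  have mnear : Measurable fun x => ∫⁻ y in Metric.ball x ρ, rieszKernel (s * p) (x - y) ∂μ := by
    have hS : MeasurableSet {z : Plane × Plane | dist z.2 z.1 < ρ} :=
      measurableSet_lt (measurable_snd.dist measurable_fst) measurable_const
    have := ((mk (s * p)).indicator hS).lintegral_prod_right' (ν := μ)
    convert this using 2 with x
    rw [← lintegral_indicator measurableSet_ball]
    rfl
  set M : ℝ≥0∞ := (D * (ENNReal.ofReal (ρ ^ (-((1 - s) * q))) * φ ρ)) ^ (p - 1) with hM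
  set N : ℝ≥0∞ := E * (ENNReal.ofReal (ρ ^ (-1 : ℝ)) * φ ρ) with hN
  calc ∫⁻ x in Metric.ball x₀ ρ, (∫⁻ y, rieszKernel 1 (x - y) ∂μ) ^ p
      ≤ ∫⁻ x in Metric.ball x₀ ρ, 2 ^ (p - 1) *
        ((∫⁻ y in Metric.ball x ρ, rieszKernel (s * p) (x - y) ∂μ) * M + N ^ p) := by
        refine lintegral_mono fun x => ?_
        rw [← lintegral_add_compl _ (measurableSet_ball (x := x) (ε := ρ))]
        refine (ENNReal.rpow_add_le_mul_rpow_add_rpow _ _ hp1.le).trans ?_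
        gcongr
        · exact hnear x
        · exact hfar x
    _ = 2 ^ (p - 1) * ((∫⁻ x in Metric.ball x₀ ρ, ∫⁻ y in Metric.ball x ρ,
          rieszKernel (s * p) (x - y) ∂μ) * M + N ^ p * volume (Metric.ball x₀ ρ)) := by
        rw [lintegral_const_mul _ ((mnear.mul_const _).add_const _),
          lintegral_add_left (mnear.mul_const _), lintegral_mul_const _ mnear, setLIntegral_const]
    _ ≤ 2 ^ (p - 1) * ((c' * φ ρ) * (Cv * ENNReal.ofReal (ρ ^ (2 - s * p))) * M +
          N ^ p * volume (Metric.ball x₀ ρ)) := by gcongr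
    _ = _ := by
        have e1 : ENNReal.ofReal (ρ ^ (2 - s * p)) * ENNReal.ofReal (ρ ^ (-((1 - s) * q))) ^ (p - 1)
            = ENNReal.ofReal (ρ ^ (2 - p)) := by
          rw [ENNReal.ofReal_rpow_of_pos (by positivity), ← ENNReal.ofReal_mul (by positivity),
            ← Real.rpow_mul hρ.le, ← Real.rpow_add hρ]
          congr 2
          linear_combination (-(1 - s)) * hpq'
        have e2 : φ ρ * φ ρ ^ (p - 1) = φ ρ ^ p := by
          nth_rw 1 [← ENNReal.rpow_one (φ ρ)]
          rw [← ENNReal.rpow_add_of_nonneg _ _ (by norm_num) (by linarith)]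
          congr 1; ring
        have e3 : ENNReal.ofReal (ρ ^ (-1 : ℝ)) ^ p * ENNReal.ofReal ρ ^ 2 =
            ENNReal.ofReal (ρ ^ (2 - p)) := by
          rw [ENNReal.ofReal_rpow_of_pos (by positivity), ← ENNReal.ofReal_pow hρ.le,
            ← ENNReal.ofReal_mul (by positivity),
            ← Real.rpow_mul hρ.le, ← Real.rpow_natCast, ← Real.rpow_add hρ]
          congr 2; push_cast; ring
        have mr : ∀ a b d : ℝ≥0∞, ∀ t : ℝ, 0 ≤ t → (a * (b * d)) ^ t = a ^ t * (b ^ t * d ^ t) :=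
          fun a b d t ht => by
            rw [ENNReal.mul_rpow_of_nonneg _ _ ht, ENNReal.mul_rpow_of_nonneg _ _ ht]
        rw [hM, hN, mr _ _ _ _ (by linarith : 0 ≤ p - 1), mr _ _ _ _ hp0.le, volume_ball_plane, mul_assoc (2 ^ (p - 1))]
        congr 1
        rw [add_mul]
        congr 1
        · rw [← e1, ← e2]; ring
        · rw [← e3]; ring

/-- The Riesz potential `∫ |x - y|⁻¹ w(y) dy` of a nonnegative function. -/
noncomputable def rieszPotential (w : Plane → ℝ≥0∞) (x : Plane) : ℝ≥0∞ :=
  ∫⁻ y, rieszKernel 1 (x - y) * w y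

lemma measurable_rieszPotential {w : Plane → ℝ≥0∞} (hw : Measurable w) :
    Measurable (rieszPotential w) := by
  have : Measurable fun z : Plane × Plane => rieszKernel 1 (z.1 - z.2) * w z.2 :=
    ((measurable_rieszKernel 1).comp (measurable_fst.sub measurable_snd)).mul
      (hw.comp measurable_snd)
  exact this.lintegral_prod_right'

lemma measurable_rieszKernel_sub (b : ℝ) (x : Plane) :
    Measurable fun y : Plane => rieszKernel b (x - y) :=
  (measurable_rieszKernel b).comp (measurable_const.sub measurable_id)

lemma lintegral_rieszKernel_withDensity {w : Plane → ℝ≥0∞} (hw : Measurable w) (x : Plane) :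
    ∫⁻ y, rieszKernel 1 (x - y) ∂(volume.withDensity w) = rieszPotential w x := by
  rw [lintegral_withDensity_eq_lintegral_mul _ hw (measurable_rieszKernel_sub 1 x)]
  simp [rieszPotential, mul_comm]

lemma rieszPotential_add {w₁ w₂ : Plane → ℝ≥0∞} (h₁ : Measurable w₁) (x : Plane) :
    rieszPotential (fun y => w₁ y + w₂ y) x = rieszPotential w₁ x + rieszPotential w₂ x := by
  simp only [rieszPotential, mul_add]
  exact lintegral_add_left ((measurable_rieszKernel_sub 1 x).mul h₁) _

lemma ofReal_half_rpow {r : ℝ} (hr : 0 < r) (a : ℝ) :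
    ENNReal.ofReal ((r / 2) ^ a) = ENNReal.ofReal (2 ^ (-a)) * ENNReal.ofReal (r ^ a) := by
  rw [← ENNReal.ofReal_mul (by positivity), Real.div_rpow hr.le (by norm_num),
    Real.rpow_neg (by norm_num)]
  congr 1; ring

lemma ofReal_two_mul_rpow {r : ℝ} (hr : 0 < r) (a : ℝ) :
    ENNReal.ofReal ((2 * r) ^ a) = ENNReal.ofReal (2 ^ a) * ENNReal.ofReal (r ^ a) := by
  rw [← ENNReal.ofReal_mul (by positivity), Real.mul_rpow (by norm_num) hr.le]

lemma ofReal_two_rpow_mul_lt_one {a b : ℝ} (h : a + b < 0) :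
    ENNReal.ofReal (2 ^ a) * ENNReal.ofReal (2 ^ b) < 1 := by
  rw [← ENNReal.ofReal_mul (by positivity), ENNReal.ofReal_lt_one, ← Real.rpow_add (by norm_num)]
  exact Real.rpow_lt_one_of_one_lt_of_neg (by norm_num) h

lemma lintegral_mul_le_sqrt_mul_sqrt {α : Type*} [MeasurableSpace α] (μ : Measure α)
    {f g : α → ℝ≥0∞} (hf : Measurable f) (hg : Measurable g) :
    ∫⁻ a, f a * g a ∂μ ≤
      (∫⁻ a, f a ^ 2 ∂μ) ^ (1 / 2 : ℝ) * (∫⁻ a, g a ^ 2 ∂μ) ^ (1 / 2 : ℝ) := by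
  have h := ENNReal.lintegral_mul_le_Lp_mul_Lq μ Real.HolderConjugate.two_two
    hf.aemeasurable hg.aemeasurable
  simpa using h

/-- Split at radius `1`: growth faster than `r` compensates the singularity of the kernel at small
scales, and growth slower than `r` makes the tail summable. -/
lemma exists_rieszPotential_le {w : Plane → ℝ≥0∞} (hw : Measurable w) {A B : ℝ≥0∞} {a b : ℝ}
    (ha : 1 < a) (hb : b < 1) (hA : A ≠ ⊤) (hB : B ≠ ⊤)
    (h1 : ∀ x, ∀ r > 0, ∫⁻ y in Metric.ball x r, w y ≤ A * ENNReal.ofReal (r ^ a))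
    (h2 : ∀ x, ∀ r > 0, ∫⁻ y in Metric.ball x r, w y ≤ B * ENNReal.ofReal (r ^ b)) :
    ∃ K : ℝ≥0∞, K ≠ ⊤ ∧ ∀ x, rieszPotential w x ≤ K := by
  have ca : ENNReal.ofReal (2 ^ (1 : ℝ)) * ENNReal.ofReal (2 ^ (-a)) < 1 :=
    ofReal_two_rpow_mul_lt_one (by linarith)
  have cb : ENNReal.ofReal (2 ^ (-1 : ℝ)) * ENNReal.ofReal (2 ^ b) < 1 :=
    ofReal_two_rpow_mul_lt_one (by linarith)
  refine ⟨ENNReal.ofReal (2 ^ (1 : ℝ)) *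
      (1 - ENNReal.ofReal (2 ^ (1 : ℝ)) * ENNReal.ofReal (2 ^ (-a)))⁻¹ * A +
      ENNReal.ofReal (2 ^ b) *
      (1 - ENNReal.ofReal (2 ^ (-1 : ℝ)) * ENNReal.ofReal (2 ^ b))⁻¹ * B, ?_, fun x => ?_⟩
  · refine ENNReal.add_ne_top.2 ⟨?_, ?_⟩
    · exact ENNReal.mul_ne_top (ENNReal.mul_ne_top ENNReal.ofReal_ne_top
        (ENNReal.inv_ne_top.2 (tsub_pos_of_lt ca).ne')) hA
    · exact ENNReal.mul_ne_top (ENNReal.mul_ne_top ENNReal.ofReal_ne_top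
        (ENNReal.inv_ne_top.2 (tsub_pos_of_lt cb).ne')) hB
  rw [← lintegral_rieszKernel_withDensity hw, ← lintegral_add_compl _
    (measurableSet_ball (x := x) (ε := 1))]
  refine add_le_add ?_ ?_
  · refine (lintegral_rieszKernel_ball_le (φ := fun r => A * ENNReal.ofReal (r ^ a)) one_pos
      (fun r hr => ?_) (c := ENNReal.ofReal (2 ^ (-a))) (fun r hr => ?_) one_pos).trans_eq ?_
    · rw [withDensity_apply _ measurableSet_ball]; exact h1 x r hr
    · simp only [ofReal_half_rpow hr]; exact le_of_eq (by ring)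
    · simp
  · refine (lintegral_rieszKernel_compl_ball_le (φ := fun r => B * ENNReal.ofReal (r ^ b)) one_pos
      (fun r hr => ?_) (c := ENNReal.ofReal (2 ^ b)) (fun r hr => ?_) one_pos).trans_eq ?_
    · rw [withDensity_apply _ measurableSet_ball]; exact h2 x r hr
    · simp only [ofReal_two_mul_rpow hr]; exact le_of_eq (by ring)
    · simp

/-- For `p = 2` the factor `ρ ^ (2 - p)` disappears, so `L²` norms over balls inherit the growth
profile of `w` unchanged. With `s = 7/8` one has `(1 - s) * q = 1/4 < 1/2` and `s * p = 7/4 < 2`.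
The halving constant comes from the smaller exponent of the profile, the doubling constant from the
larger. -/
lemma exists_lintegral_rieszPotential_sq_le :
    ∃ C : ℝ≥0∞, C ≠ ⊤ ∧ ∀ (w : Plane → ℝ≥0∞), Measurable w → ∀ A B : ℝ≥0∞,
      (∀ x, ∀ r > 0, ∫⁻ y in Metric.ball x r, w y ≤
        A * ENNReal.ofReal (r ^ (9 / 10 : ℝ)) + B * ENNReal.ofReal (r ^ (1 / 2 : ℝ))) →
      ∀ (x : Plane) (r : ℝ), 0 < r →
        (∫⁻ y in Metric.ball x r, rieszPotential w y ^ 2) ^ (1 / 2 : ℝ) ≤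
        C * (A * ENNReal.ofReal (r ^ (9 / 10 : ℝ)) + B * ENNReal.ofReal (r ^ (1 / 2 : ℝ))) := by
  obtain ⟨C, hC, h⟩ := exists_lintegral_rieszPotential_rpow_le
    (p := 2) (q := 2) (s := 7 / 8) Real.HolderConjugate.two_two (by norm_num) (by norm_num)
    (by norm_num) (c := ENNReal.ofReal (2 ^ (-(1 / 2) : ℝ)))
    (c' := ENNReal.ofReal (2 ^ (9 / 10 : ℝ)))
    (ofReal_two_rpow_mul_lt_one (by norm_num)) (ofReal_two_rpow_mul_lt_one (by norm_num))
  refine ⟨C ^ (1 / 2 : ℝ), ENNReal.rpow_ne_top_of_nonneg (by norm_num) hC,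
    fun w hw A B hAB x r hr => ?_⟩
  have m1 : ENNReal.ofReal (2 ^ (-(9 / 10) : ℝ)) ≤ ENNReal.ofReal (2 ^ (-(1 / 2) : ℝ)) :=
    ENNReal.ofReal_le_ofReal (Real.rpow_le_rpow_of_exponent_le (by norm_num) (by norm_num))
  have m2 : ENNReal.ofReal (2 ^ (1 / 2 : ℝ)) ≤ ENNReal.ofReal (2 ^ (9 / 10 : ℝ)) :=
    ENNReal.ofReal_le_ofReal (Real.rpow_le_rpow_of_exponent_le (by norm_num) (by norm_num))
  have := h (volume.withDensity w)
    (fun r => A * ENNReal.ofReal (r ^ (9 / 10 : ℝ)) + B * ENNReal.ofReal (r ^ (1 / 2 : ℝ)))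
    (fun x r hr => by rw [withDensity_apply _ measurableSet_ball]; exact hAB x r hr)
    (fun r hr => by
      simp only [ofReal_half_rpow hr]
      calc A * (ENNReal.ofReal (2 ^ (-(9 / 10) : ℝ)) * ENNReal.ofReal (r ^ (9 / 10 : ℝ))) +
          B * (ENNReal.ofReal (2 ^ (-(1 / 2) : ℝ)) * ENNReal.ofReal (r ^ (1 / 2 : ℝ)))
          ≤ A * (ENNReal.ofReal (2 ^ (-(1 / 2) : ℝ)) * ENNReal.ofReal (r ^ (9 / 10 : ℝ))) +
          B * (ENNReal.ofReal (2 ^ (-(1 / 2) : ℝ)) * ENNReal.ofReal (r ^ (1 / 2 : ℝ))) := by gcongr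
        _ = _ := by ring)
    (fun r hr => by
      simp only [ofReal_two_mul_rpow hr]
      calc A * (ENNReal.ofReal (2 ^ (9 / 10 : ℝ)) * ENNReal.ofReal (r ^ (9 / 10 : ℝ))) +
          B * (ENNReal.ofReal (2 ^ (1 / 2 : ℝ)) * ENNReal.ofReal (r ^ (1 / 2 : ℝ)))
          ≤ A * (ENNReal.ofReal (2 ^ (9 / 10 : ℝ)) * ENNReal.ofReal (r ^ (9 / 10 : ℝ))) +
          B * (ENNReal.ofReal (2 ^ (9 / 10 : ℝ)) * ENNReal.ofReal (r ^ (1 / 2 : ℝ))) := by gcongr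
        _ = _ := by ring) x r hr
  simp only [lintegral_rieszKernel_withDensity hw, ENNReal.rpow_two, sub_self, Real.rpow_zero,
    ENNReal.ofReal_one, mul_one] at this
  refine (ENNReal.rpow_le_rpow this (by norm_num : (0:ℝ) ≤ 1 / 2)).trans_eq ?_
  rw [ENNReal.mul_rpow_of_nonneg _ _ (by norm_num), ← ENNReal.rpow_natCast, ← ENNReal.rpow_mul]
  norm_num

/-- With `p = 3` the exponent becomes `3 * (9/10) + (2 - 3) = 17/10`. It exceeds `1`, the threshold
for a bounded potential at small scales. -/
lemma exists_lintegral_rieszPotential_cube_le :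
    ∃ C : ℝ≥0∞, C ≠ ⊤ ∧ ∀ (w : Plane → ℝ≥0∞), Measurable w → ∀ A : ℝ≥0∞,
      (∀ x, ∀ r > 0, ∫⁻ y in Metric.ball x r, w y ≤ A * ENNReal.ofReal (r ^ (9 / 10 : ℝ))) →
      ∀ (x : Plane) (r : ℝ), 0 < r → ∫⁻ y in Metric.ball x r, rieszPotential w y ^ 3 ≤
        C * A ^ 3 * ENNReal.ofReal (r ^ (17 / 10 : ℝ)) := by
  obtain ⟨C, hC, h⟩ := exists_lintegral_rieszPotential_rpow_le
    (p := 3) (q := 3 / 2) (s := 1 / 2) (by rw [Real.holderConjugate_iff]; norm_num) (by norm_num)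
    (by norm_num)
    (by norm_num) (c := ENNReal.ofReal (2 ^ (-(9 / 10) : ℝ)))
    (c' := ENNReal.ofReal (2 ^ (9 / 10 : ℝ)))
    (ofReal_two_rpow_mul_lt_one (by norm_num)) (ofReal_two_rpow_mul_lt_one (by norm_num))
  refine ⟨C, hC, fun w hw A hA x r hr => ?_⟩
  have := h (volume.withDensity w) (fun r => A * ENNReal.ofReal (r ^ (9 / 10 : ℝ)))
    (fun x r hr => by rw [withDensity_apply _ measurableSet_ball]; exact hA x r hr)
    (fun r hr => by simp only [ofReal_half_rpow hr]; exact le_of_eq (by ring))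
    (fun r hr => by simp only [ofReal_two_mul_rpow hr]; exact le_of_eq (by ring)) x r hr
  simp only [lintegral_rieszKernel_withDensity hw] at this
  have e3 : ∀ z : ℝ≥0∞, z ^ (3 : ℝ) = z ^ 3 := fun z => by
    rw [← ENNReal.rpow_natCast]; norm_num
  simp only [e3] at this
  refine this.trans_eq ?_
  rw [mul_pow, ← ENNReal.ofReal_pow (by positivity), mul_assoc, mul_assoc C,
    ← ENNReal.ofReal_mul (by positivity), ← Real.rpow_natCast, ← Real.rpow_mul hr.le,
    ← Real.rpow_add hr]
  norm_num

/-! ### Boundedness of critical subsolutions `u ≤ C I(u³)` -/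

/-- Cauchy–Schwarz for `u³ = u² · u`. The `L⁴` mass of `S` stands in front, and this is the source
of smallness in the iteration. -/
lemma setLIntegral_cube_le {u : Plane → ℝ≥0∞} (hu : Measurable u) {S : Set Plane}
    (hS : MeasurableSet S) (T : Set Plane) :
    ∫⁻ y in T, S.indicator (fun y => u y ^ 3) y ≤
      (∫⁻ y in S, u y ^ 4) ^ (1 / 2 : ℝ) * (∫⁻ y in T, u y ^ 2) ^ (1 / 2 : ℝ) := by
  rw [lintegral_indicator hS, Measure.restrict_restrict hS]
  calc ∫⁻ y in S ∩ T, u y ^ 3 = ∫⁻ y in S ∩ T, u y ^ 2 * u y := by simp only [pow_succ]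
    _ ≤ _ := lintegral_mul_le_sqrt_mul_sqrt _ (hu.pow_const 2) hu
    _ ≤ _ := by
      simp only [← pow_mul]
      gcongr
      · exact Set.inter_subset_left
      · exact Set.inter_subset_right

/-- A function in `L⁴` of the plane with small `L⁴` tail above every high level set. -/
lemma exists_setLIntegral_pow_four_lt {u : Plane → ℝ≥0∞} (hu : Measurable u)
    (h4 : ∫⁻ x, u x ^ 4 ≠ ⊤) {ε : ℝ≥0∞} (hε : ε ≠ 0) :
    ∃ n : ℕ, ∫⁻ x in {x | (n : ℝ≥0∞) ≤ u x ^ 4}, u x ^ 4 < ε := by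
  obtain ⟨δ, hδ, h⟩ := exists_pos_setLIntegral_lt_of_measure_lt h4 hε
  obtain ⟨n, hn0, hn⟩ := ENNReal.exists_nat_pos_mul_gt hδ.ne' h4
  refine ⟨n, h _ ?_⟩
  refine (meas_ge_le_lintegral_div (hu.pow_const 4).aemeasurable (by simpa using hn0.ne')
    (by simp)).trans_lt ?_
  rw [ENNReal.div_lt_iff (Or.inl (by simpa using hn0.ne')) (Or.inl (by simp)), mul_comm]
  exact hn

/-- `L⁴` functions dominated by the critical potential of their cube are bounded. -/
theorem exists_ae_le_of_le_rieszPotential_cube {u : Plane → ℝ≥0∞} (hu : Measurable u)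
    (h4 : ∫⁻ x, u x ^ 4 ≠ ⊤) {C : ℝ≥0∞} (hC : C ≠ ⊤)
    (hle : ∀ᵐ x, u x ≤ C * rieszPotential (fun y => u y ^ 3) x) :
    ∃ K : ℝ≥0∞, K ≠ ⊤ ∧ ∀ᵐ x, u x ≤ K := by
  have hu3 : Measurable fun y => u y ^ 3 := hu.pow_const 3
  obtain ⟨C₂, hC₂, hsq⟩ := exists_lintegral_rieszPotential_sq_le
  obtain ⟨C₃, hC₃, hcube⟩ := exists_lintegral_rieszPotential_cube_le
  set m : Plane → ℝ → ℝ≥0∞ := fun x r => (∫⁻ y in Metric.ball x r, u y ^ 2) ^ (1 / 2 : ℝ) with hm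
  set N₄ : ℝ≥0∞ := (∫⁻ x, u x ^ 4) ^ (1 / 2 : ℝ) with hN₄
  have hN₄top : N₄ ≠ ⊤ := ENNReal.rpow_ne_top_of_nonneg (by norm_num) h4
  have sqrt_sq : ∀ z : ℝ≥0∞, (z ^ 2) ^ (1 / 2 : ℝ) = z := fun z => by
    rw [← ENNReal.rpow_natCast, ← ENNReal.rpow_mul]; norm_num
  have sqrt_vol : ∀ (x : Plane) (r : ℝ), volume (Metric.ball x r) ^ (1 / 2 : ℝ) =
      ENNReal.ofReal r * ENNReal.ofReal Real.pi ^ (1 / 2 : ℝ) := fun x r => by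
    rw [volume_ball_plane, ENNReal.mul_rpow_of_nonneg _ _ (by norm_num), sqrt_sq]
  -- the a priori growth furnished by the `L⁴` bound
  set N₀ : ℝ≥0∞ := (N₄ * ENNReal.ofReal Real.pi ^ (1 / 2 : ℝ)) ^ (1 / 2 : ℝ) with hN₀
  have hN₀top : N₀ ≠ ⊤ := ENNReal.rpow_ne_top_of_nonneg (by norm_num)
    (ENNReal.mul_ne_top hN₄top (ENNReal.rpow_ne_top_of_nonneg (by norm_num) ENNReal.ofReal_ne_top))
  have hbase : ∀ x, ∀ r > 0, m x r ≤ N₀ * ENNReal.ofReal (r ^ (1 / 2 : ℝ)) := by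
    intro x r hr
    have h : ∫⁻ y in Metric.ball x r, u y ^ 2 ≤
        N₄ * (ENNReal.ofReal r * ENNReal.ofReal Real.pi ^ (1 / 2 : ℝ)) := by
      calc ∫⁻ y in Metric.ball x r, u y ^ 2 = ∫⁻ y in Metric.ball x r, u y ^ 2 * 1 := by simp
        _ ≤ _ := lintegral_mul_le_sqrt_mul_sqrt _ (hu.pow_const 2) measurable_const
        _ ≤ _ := by
          simp only [← pow_mul, one_pow, setLIntegral_const, one_mul, sqrt_vol]
          gcongr
          exact ENNReal.rpow_le_rpow (setLIntegral_le_lintegral _ _) (by norm_num)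
    refine (ENNReal.rpow_le_rpow h (by norm_num)).trans_eq ?_
    rw [hN₀, ← ENNReal.ofReal_rpow_of_pos hr, ← ENNReal.mul_rpow_of_nonneg _ _ (by norm_num)]
    congr 1; ring
  have hcubegrowth : ∀ (S : Set Plane), MeasurableSet S → ∀ x, ∀ r > 0,
      ∫⁻ y in Metric.ball x r, S.indicator (fun y => u y ^ 3) y ≤
        (N₄ * N₀) * ENNReal.ofReal (r ^ (1 / 2 : ℝ)) := by
    intro S hS x r hr
    refine (setLIntegral_cube_le hu hS _).trans ?_
    rw [mul_assoc]
    gcongr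
    · exact ENNReal.rpow_le_rpow (setLIntegral_le_lintegral _ _) (by norm_num)
    · exact hbase x r hr
  -- splitting off the large values
  obtain ⟨ε, hε0, hε⟩ : ∃ ε : ℝ≥0∞, ε ≠ 0 ∧ C * (C₂ * ε) ≤ 1 / 2 := by
    refine ⟨(2 * (C * C₂) + 1)⁻¹, ENNReal.inv_ne_zero.2 (by finiteness), ?_⟩
    rw [← mul_assoc, ← div_eq_mul_inv]
    refine ENNReal.div_le_of_le_mul ?_
    rw [mul_add, ← mul_assoc, one_div, ENNReal.inv_mul_cancel (by simp) (by simp), one_mul]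
    exact le_self_add
  -- The level is chosen for `ε ^ 2` because Cauchy–Schwarz takes the square root of the `L⁴` mass.
  obtain ⟨n, hn⟩ := exists_setLIntegral_pow_four_lt hu h4 (ε := ε ^ 2) (by positivity)
  set S : Set Plane := {x | (n : ℝ≥0∞) ≤ u x ^ 4} with hS
  have hSm : MeasurableSet S := measurableSet_le measurable_const (hu.pow_const 4)
  set w₁ : Plane → ℝ≥0∞ := S.indicator fun y => u y ^ 3 with hw₁
  set w₂ : Plane → ℝ≥0∞ := Sᶜ.indicator fun y => u y ^ 3 with hw₂
  have mw₁ : Measurable w₁ := hu3.indicator hSm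
  have mw₂ : Measurable w₂ := hu3.indicator hSm.compl
  have hsplit : ∀ᵐ x, u x ≤ C * rieszPotential w₂ x + C * rieszPotential w₁ x := by
    filter_upwards [hle] with x hx
    rw [← mul_add, ← rieszPotential_add mw₂]
    convert hx using 4 with y
    exact Set.indicator_compl_add_self_apply _ _ _
  have hw₂le : ∀ y, w₂ y ≤ n + 1 := by
    intro y
    by_cases hy : y ∈ S
    · rw [hw₂, Set.indicator_of_notMem (by simpa using hy)]; simp
    · rw [hw₂, Set.indicator_of_mem (by simpa using hy)]
      have hy' : u y ^ 4 < n := not_le.1 hy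
      rcases le_total (u y) 1 with h1 | h1
      · exact (pow_le_one₀ (by simp) h1).trans (by simp)
      · exact ((pow_le_pow_right₀ h1 (by norm_num)).trans hy'.le).trans (by simp)
  obtain ⟨Kg, hKg, hgle⟩ := exists_rieszPotential_le mw₂ (A := (n + 1) * ENNReal.ofReal Real.pi)
    (B := N₄ * N₀) (a := 2) (b := 1 / 2) (by norm_num) (by norm_num) (by finiteness)
    (by finiteness) (fun x r hr => by
      calc _ ≤ ∫⁻ y in Metric.ball x r, (n + 1 : ℝ≥0∞) := lintegral_mono fun y => hw₂le y
        _ = _ := by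
          rw [setLIntegral_const, volume_ball_plane, ← ENNReal.ofReal_pow (le_of_lt hr)]
          norm_num
          ring)
    (hcubegrowth _ hSm.compl)
  set G : ℝ≥0∞ := Kg * ENNReal.ofReal Real.pi ^ (1 / 2 : ℝ) + C₂ * (N₄ * N₀) with hG
  have hGtop : G ≠ ⊤ := by
    have : ENNReal.ofReal Real.pi ^ (1 / 2 : ℝ) ≠ ⊤ :=
      ENNReal.rpow_ne_top_of_nonneg (by norm_num) ENNReal.ofReal_ne_top
    finiteness
  -- For `r ≤ 1` boundedness of the potential gives order `r ≤ r^(9/10)`; for `r ≥ 1` the a priori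
  -- growth gives order `r^(1/2) ≤ r^(9/10)`.
  have hg : ∀ x, ∀ r > 0, (∫⁻ y in Metric.ball x r, rieszPotential w₂ y ^ 2) ^ (1 / 2 : ℝ) ≤
      G * ENNReal.ofReal (r ^ (9 / 10 : ℝ)) := by
    intro x r hr
    rcases le_total r 1 with h1 | h1
    · calc _ ≤ (∫⁻ y in Metric.ball x r, Kg ^ 2) ^ (1 / 2 : ℝ) := by
            gcongr with y; exact hgle y
        _ = Kg * ENNReal.ofReal Real.pi ^ (1 / 2 : ℝ) * ENNReal.ofReal r := by
            rw [setLIntegral_const, ENNReal.mul_rpow_of_nonneg _ _ (by norm_num), sqrt_sq,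
              sqrt_vol]
            ring
        _ ≤ _ := by
            gcongr
            · exact le_self_add
            · nth_rw 1 [← Real.rpow_one r]
              exact Real.rpow_le_rpow_of_exponent_ge hr h1 (by norm_num)
    · have := hsq w₂ mw₂ 0 (N₄ * N₀) (fun x r hr => by
        simpa using hcubegrowth _ hSm.compl x r hr) x r hr
      refine this.trans ?_
      rw [zero_mul, zero_add, ← mul_assoc]
      refine mul_le_mul' le_add_self (ENNReal.ofReal_le_ofReal ?_)
      exact Real.rpow_le_rpow_of_exponent_le h1 (by norm_num)
  -- iteration
  have hiter : ∀ k : ℕ, ∀ x, ∀ r > 0, m x r ≤ 2 * (C * G) * ENNReal.ofReal (r ^ (9 / 10 : ℝ)) +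
      (1 / 2) ^ k * N₀ * ENNReal.ofReal (r ^ (1 / 2 : ℝ)) := by
    intro k
    induction k with
    | zero =>
      intro x r hr
      refine (hbase x r hr).trans ?_
      simp
    | succ k ih =>
      intro x r hr
      set φ := 2 * (C * G) * ENNReal.ofReal (r ^ (9 / 10 : ℝ)) +
        (1 / 2) ^ k * N₀ * ENNReal.ofReal (r ^ (1 / 2 : ℝ)) with hφ
      have hg1 : ∀ x, ∀ r > 0, ∫⁻ y in Metric.ball x r, w₁ y ≤
          ε * (2 * (C * G)) * ENNReal.ofReal (r ^ (9 / 10 : ℝ)) +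
          ε * ((1 / 2) ^ k * N₀) * ENNReal.ofReal (r ^ (1 / 2 : ℝ)) := by
        intro x r hr
        calc _ ≤ _ := setLIntegral_cube_le hu hSm _
          _ ≤ ε * (2 * (C * G) * ENNReal.ofReal (r ^ (9 / 10 : ℝ)) +
              (1 / 2) ^ k * N₀ * ENNReal.ofReal (r ^ (1 / 2 : ℝ))) := by
            gcongr
            · rw [← sqrt_sq ε]
              exact ENNReal.rpow_le_rpow hn.le (by norm_num)
            · exact ih x r hr
          _ = _ := by ring
      have hh := hsq w₁ mw₁ _ _ hg1 x r hr
      have mI₁ := measurable_rieszPotential mw₁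
      have mI₂ := measurable_rieszPotential mw₂
      have pull : ∀ I : Plane → ℝ≥0∞, Measurable I →
          (∫⁻ y in Metric.ball x r, (C * I y) ^ 2) ^ (1 / 2 : ℝ) =
          C * (∫⁻ y in Metric.ball x r, I y ^ 2) ^ (1 / 2 : ℝ) := by
        intro I hI
        simp only [mul_pow]
        rw [lintegral_const_mul _ (hI.pow_const 2),
          ENNReal.mul_rpow_of_nonneg _ _ (by norm_num), sqrt_sq]
      calc m x r ≤ (∫⁻ y in Metric.ball x r,
            (C * rieszPotential w₂ y + C * rieszPotential w₁ y) ^ 2) ^ (1 / 2 : ℝ) := by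
            refine ENNReal.rpow_le_rpow (lintegral_mono_ae ?_) (by norm_num)
            filter_upwards [ae_restrict_of_ae hsplit] with y hy
            gcongr
        _ ≤ (∫⁻ y in Metric.ball x r, (C * rieszPotential w₂ y) ^ 2) ^ (1 / 2 : ℝ) +
            (∫⁻ y in Metric.ball x r, (C * rieszPotential w₁ y) ^ 2) ^ (1 / 2 : ℝ) := by
            have := ENNReal.lintegral_Lp_add_le (μ := volume.restrict (Metric.ball x r)) (p := 2)
              (mI₂.const_mul C).aemeasurable (mI₁.const_mul C).aemeasurable (by norm_num)
            simpa using this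
        _ ≤ C * (G * ENNReal.ofReal (r ^ (9 / 10 : ℝ))) + C * (C₂ *
            (ε * (2 * (C * G)) * ENNReal.ofReal (r ^ (9 / 10 : ℝ)) +
            ε * ((1 / 2) ^ k * N₀) * ENNReal.ofReal (r ^ (1 / 2 : ℝ)))) := by
            rw [pull _ mI₁, pull _ mI₂]
            gcongr
            exact hg x r hr
        _ = C * G * ENNReal.ofReal (r ^ (9 / 10 : ℝ)) + C * (C₂ * ε) * φ := by rw [hφ]; ring
        _ ≤ C * G * ENNReal.ofReal (r ^ (9 / 10 : ℝ)) + 1 / 2 * φ := by gcongr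
        _ = (1 + 1 / 2 * 2) * (C * G) * ENNReal.ofReal (r ^ (9 / 10 : ℝ)) +
            (1 / 2) ^ (k + 1) * N₀ * ENNReal.ofReal (r ^ (1 / 2 : ℝ)) := by rw [hφ]; ring
        _ = _ := by
            rw [one_div, ENNReal.inv_mul_cancel (by simp) (by simp), one_add_one_eq_two]
  -- The worse term is halved in each round and vanishes in the limit. The a priori bound of order
  -- `r^(1/2)` only serves to start the iteration.
  have hmor : ∀ x, ∀ r > 0, m x r ≤ 2 * (C * G) * ENNReal.ofReal (r ^ (9 / 10 : ℝ)) := by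
    intro x r hr
    have hlim : Filter.Tendsto (fun k : ℕ => 2 * (C * G) * ENNReal.ofReal (r ^ (9 / 10 : ℝ)) +
        (1 / 2) ^ k * (N₀ * ENNReal.ofReal (r ^ (1 / 2 : ℝ)))) Filter.atTop
        (nhds (2 * (C * G) * ENNReal.ofReal (r ^ (9 / 10 : ℝ)) +
          0 * (N₀ * ENNReal.ofReal (r ^ (1 / 2 : ℝ))))) := by
      refine tendsto_const_nhds.add (ENNReal.Tendsto.mul_const ?_ (Or.inr (by finiteness)))
      exact ENNReal.tendsto_pow_atTop_nhds_zero_of_lt_one (by simp)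
    rw [zero_mul, add_zero] at hlim
    refine ge_of_tendsto' hlim fun k => ?_
    rw [← mul_assoc ((1 / 2) ^ k)]
    exact hiter k x r hr
  have hA : ∀ x, ∀ r > 0, ∫⁻ y in Metric.ball x r, u y ^ 3 ≤
      (N₄ * (2 * (C * G))) * ENNReal.ofReal (r ^ (9 / 10 : ℝ)) := by
    intro x r hr
    have := setLIntegral_cube_le hu MeasurableSet.univ (Metric.ball x r)
    simp only [Set.indicator_univ, Measure.restrict_univ] at this
    refine this.trans ?_
    rw [mul_assoc]
    gcongr
    exact hmor x r hr
  -- Growth `9/10` controls the potential at infinity but not at small scales. Inserting `u ≤ C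
  -- I(u³)` into `∫ u³` once more raises the exponent to `17/10`, which settles the small scales.
  obtain ⟨K, hK, hbd⟩ := exists_rieszPotential_le hu3 (a := 17 / 10) (b := 9 / 10)
    (A := C ^ 3 * (C₃ * (N₄ * (2 * (C * G))) ^ 3)) (B := N₄ * (2 * (C * G)))
    (by norm_num) (by norm_num) (by finiteness) (by finiteness) (fun x r hr => by
      calc ∫⁻ y in Metric.ball x r, u y ^ 3
          ≤ ∫⁻ y in Metric.ball x r, C ^ 3 * rieszPotential (fun y => u y ^ 3) y ^ 3 := by
            refine lintegral_mono_ae ?_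
            filter_upwards [ae_restrict_of_ae hle] with y hy
            rw [← mul_pow]
            gcongr
        _ ≤ _ := by
            rw [lintegral_const_mul _ ((measurable_rieszPotential hu3).pow_const 3), mul_assoc]
            gcongr
            exact hcube _ hu3 _ hA x r hr) hA
  refine ⟨C * K, ENNReal.mul_ne_top hC hK, ?_⟩
  filter_upwards [hle] with x hx
  exact hx.trans (by gcongr; exact hbd x)

/-! ### The operator `∂₁ + i∂₂` and the Cauchy transform -/

/-- The Cauchy–Pompeiu formula at the origin, for compactly supported functions. -/
theorem integral_fderiv_mul_inv_eq {f : ℂ → ℂ} (hf : ContDiff ℝ 1 f) (hc : HasCompactSupport f) :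
    ∫ z, (fderiv ℝ f z 1 + Complex.I * fderiv ℝ f z Complex.I) * z⁻¹ = -(2 * Real.pi) * f 0 := by
  have hD : Continuous (fderiv ℝ f) := hf.continuous_fderiv (by norm_num)
  obtain ⟨R, hR0, hR⟩ : ∃ R : ℝ, 0 < R ∧ ∀ z : ℂ, R ≤ ‖z‖ → f z = 0 ∧ fderiv ℝ f z = 0 := by
    obtain ⟨R, hR⟩ := (hc.isCompact.isBounded).subset_ball (0 : ℂ)
    refine ⟨max R 1, by positivity, fun z hz => ?_⟩
    have hz' : z ∉ tsupport f := fun h => by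
      have := hR h
      rw [mem_ball_zero_iff] at this
      linarith [le_max_left R 1]
    exact ⟨image_eq_zero_of_notMem_tsupport hz', by
      have := fun h => hz' (support_fderiv_subset ℝ h)
      simpa using this⟩
  set w : ℝ → ℂ := fun θ => Real.cos θ + Real.sin θ * Complex.I with hw
  have hwn : ∀ θ, ‖w θ‖ = 1 := fun θ => by
    rw [hw]; simp only [Complex.ofReal_cos, Complex.ofReal_sin]; exact Complex.norm_cos_add_sin_mul_I θ
  have hwc : Continuous w := by fun_prop
  -- `A` is the radial derivative and `B` the angular derivative divided by `r`, so `(∂₁ + i∂₂) f =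
  -- e^{iθ} (A + iB)`. The factor `z⁻¹` together with the polar Jacobian cancels `e^{iθ}`; then `A`
  -- integrates to `-f 0` on each ray and `B` to zero on each circle.
  set A : ℝ × ℝ → ℂ := fun p => fderiv ℝ f (p.1 * w p.2) (w p.2) with hA
  set B : ℝ × ℝ → ℂ := fun p => fderiv ℝ f (p.1 * w p.2) (Complex.I * w p.2) with hB
  have hcA : Continuous A := by
    refine (hD.comp (by fun_prop : Continuous fun p : ℝ × ℝ => (p.1 : ℂ) * w p.2)).clm_apply ?_
    fun_prop
  have hcB : Continuous B := by
    refine (hD.comp (by fun_prop : Continuous fun p : ℝ × ℝ => (p.1 : ℂ) * w p.2)).clm_apply ?_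
    fun_prop
  have hvan : ∀ p ∈ (Set.Ioi (0 : ℝ) ×ˢ Set.Ioo (-Real.pi) Real.pi) \
      (Set.Icc 0 R ×ˢ Set.Icc (-Real.pi) Real.pi), fderiv ℝ f (p.1 * w p.2) = 0 := by
    rintro ⟨r, θ⟩ ⟨⟨hr, hθ⟩, hn⟩
    refine (hR _ ?_).2
    simp only [norm_mul, hwn, mul_one, Complex.norm_real, Real.norm_eq_abs]
    by_contra hlt
    rw [abs_of_pos hr, not_le] at hlt
    exact hn ⟨⟨le_of_lt hr, hlt.le⟩, ⟨hθ.1.le, hθ.2.le⟩⟩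
  have hint : ∀ G : ℝ × ℝ → ℂ, Continuous G →
      (∀ p ∈ (Set.Ioi (0 : ℝ) ×ˢ Set.Ioo (-Real.pi) Real.pi) \
      (Set.Icc 0 R ×ˢ Set.Icc (-Real.pi) Real.pi), G p = 0) →
      IntegrableOn G (Set.Ioi (0 : ℝ) ×ˢ Set.Ioo (-Real.pi) Real.pi) := by
    intro G hG hG0
    refine IntegrableOn.of_forall_sdiff_eq_zero
      (hG.continuousOn.integrableOn_compact (isCompact_Icc.prod isCompact_Icc))
      (measurableSet_Ioi.prod measurableSet_Ioo) hG0
  have hiA := hint A hcA (fun p hp => by simp [hA, hvan p hp])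
  have hiB := hint B hcB (fun p hp => by simp [hB, hvan p hp])
  have hsw : IntegrableOn (fun p : ℝ × ℝ => A p.swap)
      (Set.Ioo (-Real.pi) Real.pi ×ˢ Set.Ioi (0 : ℝ)) := by
    refine IntegrableOn.of_forall_sdiff_eq_zero
      ((hcA.comp continuous_swap).continuousOn.integrableOn_compact
        ((isCompact_Icc (a := -Real.pi) (b := Real.pi)).prod (isCompact_Icc (a := 0) (b := R))))
      (measurableSet_Ioo.prod measurableSet_Ioi) ?_
    rintro p ⟨hp, hn⟩
    have := hvan p.swap ⟨⟨hp.2, hp.1⟩, fun h => hn ⟨h.2, h.1⟩⟩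
    simp only [hA, this, zero_apply]
  have hIA : ∫ p in Set.Ioi (0 : ℝ) ×ˢ Set.Ioo (-Real.pi) Real.pi, A p =
      -(2 * Real.pi) * f 0 := by
    have h1 : ∫ p in Set.Ioi (0 : ℝ) ×ˢ Set.Ioo (-Real.pi) Real.pi, A p =
        ∫ p in Set.Ioo (-Real.pi) Real.pi ×ˢ Set.Ioi (0 : ℝ), A p.swap :=
      (setIntegral_prod_swap _ _ _).symm
    rw [h1, Measure.volume_eq_prod, setIntegral_prod _ hsw]
    have h2 : ∀ θ : ℝ, ∫ r in Set.Ioi (0 : ℝ), A (r, θ) = 0 - f ((0 : ℝ) * w θ) := by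
      intro θ
      have hd : ∀ r : ℝ, HasDerivAt (fun r : ℝ => f (r * w θ)) (A (r, θ)) r := by
        intro r
        have h3 : HasDerivAt (fun r : ℝ => (r : ℂ) * w θ) (1 * w θ) r :=
          (Complex.ofRealCLM.hasDerivAt (x := r)).mul_const (w θ)
        rw [one_mul] at h3
        exact ((hf.differentiable (by norm_num)) _).hasFDerivAt.comp_hasDerivAt r h3
      have hz : ∀ r ∈ Set.Ici R, f ((r : ℂ) * w θ) = 0 := fun r hr => by
        refine (hR _ ?_).1
        simp only [norm_mul, hwn, mul_one, Complex.norm_real, Real.norm_eq_abs]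
        exact (Set.mem_Ici.1 hr).trans (le_abs_self r)
      refine integral_Ioi_of_hasDerivAt_of_tendsto (hd 0).continuousAt.continuousWithinAt
        (fun r _ => hd r) ?_ ?_
      · refine IntegrableOn.of_forall_sdiff_eq_zero (s := Set.Icc 0 R)
          ((hcA.comp (by fun_prop : Continuous fun r : ℝ => (r, θ))).continuousOn.integrableOn_compact
            isCompact_Icc) measurableSet_Ioi ?_
        rintro r ⟨hr, hn⟩
        have : R ≤ ‖(r : ℂ) * w θ‖ := by
          simp only [norm_mul, hwn, mul_one, Complex.norm_real, Real.norm_eq_abs]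
          rw [abs_of_pos hr]
          by_contra hlt
          exact hn ⟨le_of_lt hr, (not_le.1 hlt).le⟩
        simp [hA, (hR _ this).2]
      · refine tendsto_const_nhds.congr' ?_
        filter_upwards [Filter.eventually_ge_atTop R] with r hr
        exact (hz r hr).symm
    simp only [Prod.swap_prod_mk, h2]
    simp [Real.pi_pos.le]
    left
    ring
  have hIB : ∫ p in Set.Ioi (0 : ℝ) ×ˢ Set.Ioo (-Real.pi) Real.pi, B p = 0 := by
    rw [Measure.volume_eq_prod, setIntegral_prod _ hiB]
    refine integral_eq_zero_of_ae ?_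
    filter_upwards [ae_restrict_mem measurableSet_Ioi] with r hr
    have hr0 : (r : ℂ) ≠ 0 := by exact_mod_cast (ne_of_gt hr)
    have hd : ∀ θ : ℝ, HasDerivAt (fun θ : ℝ => f (r * w θ)) (r * B (r, θ)) θ := by
      intro θ
      have h3 : HasDerivAt w (Complex.I * w θ) θ := by
        have h4 := (Real.hasDerivAt_cos θ).ofReal_comp.add
          ((Real.hasDerivAt_sin θ).ofReal_comp.mul_const Complex.I)
        refine h4.congr_deriv ?_
        simp only [hw]; push_cast
        linear_combination (-Complex.sin θ) * Complex.I_mul_I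
      have h5 := ((hf.differentiable (by norm_num)) _).hasFDerivAt.comp_hasDerivAt θ
        (h3.const_mul (r : ℂ))
      refine h5.congr_deriv ?_
      simp only [hB]
      rw [← Complex.real_smul (x := r) (z := Complex.I * w θ), map_smul, Complex.real_smul]
    have hcr : Continuous fun θ => B (r, θ) := hcB.comp (by fun_prop)
    have h6 := intervalIntegral.integral_eq_sub_of_hasDerivAt (a := -Real.pi) (b := Real.pi)
      (fun θ _ => hd θ) ((continuous_const.mul hcr).intervalIntegrable _ _)
    rw [intervalIntegral.integral_const_mul] at h6
    have h7 : w Real.pi = w (-Real.pi) := by simp [hw]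
    rw [h7, sub_self, mul_eq_zero, or_iff_right hr0, intervalIntegral.integral_of_le
      (by linarith [Real.pi_pos]), integral_Ioc_eq_integral_Ioo] at h6
    exact h6
  rw [← Complex.integral_comp_polarCoord_symm, polarCoord_target]
  calc _ = ∫ p in Set.Ioi (0 : ℝ) ×ˢ Set.Ioo (-Real.pi) Real.pi, (A p + Complex.I * B p) := by
        refine setIntegral_congr_fun (measurableSet_Ioi.prod measurableSet_Ioo) ?_
        rintro ⟨r, θ⟩ ⟨hr, hθ⟩
        have hr0 : (r : ℂ) ≠ 0 := by exact_mod_cast (ne_of_gt hr)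
        have hw0 : w θ ≠ 0 := by rw [← norm_ne_zero_iff, hwn]; norm_num
        simp only [Complex.polarCoord_symm_apply, hA, hB]
        change r • ((fderiv ℝ f (r * w θ) 1 + Complex.I * fderiv ℝ f (r * w θ) Complex.I) *
          (r * w θ)⁻¹) = _
        set L := fderiv ℝ f (r * w θ)
        have e1 : L (w θ) = Real.cos θ * L 1 + Real.sin θ * L Complex.I := by
          have : w θ = Real.cos θ • (1 : ℂ) + Real.sin θ • Complex.I := by simp [hw]
          rw [this, map_add, map_smul, map_smul, Complex.real_smul, Complex.real_smul]
        have e2 : L (Complex.I * w θ) = -Real.sin θ * L 1 + Real.cos θ * L Complex.I := by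
          have : Complex.I * w θ = (-Real.sin θ) • (1 : ℂ) + Real.cos θ • Complex.I := by
            simp only [hw, Complex.real_smul]; push_cast
            linear_combination (Complex.sin θ) * Complex.I_mul_I
          rw [this, map_add, map_smul, map_smul, Complex.real_smul, Complex.real_smul]
          push_cast; ring
        have e3 : w θ * (Real.cos θ - Complex.I * Real.sin θ) = 1 := by
          simp only [hw]; push_cast
          linear_combination (-Complex.sin θ ^ 2) * Complex.I_mul_I + Complex.cos_sq_add_sin_sq θ
        have e4 : (w θ)⁻¹ = Real.cos θ - Complex.I * Real.sin θ := inv_eq_of_mul_eq_one_right e3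
        rw [e1, e2, Complex.real_smul, mul_inv, e4]
        field_simp
        linear_combination (-Real.sin θ * L Complex.I) * Complex.I_mul_I
    _ = _ := by
        rw [integral_add hiA (hiB.const_mul _), integral_const_mul, hIA, hIB, mul_zero, add_zero]

/-- The identification of the plane with `ℂ`. -/
noncomputable def toC : Plane ≃ₗᵢ[ℝ] ℂ := Complex.orthonormalBasisOneI.repr.symm

lemma toC_apply (x : Plane) : toC x = x 0 + x 1 * Complex.I :=
  Complex.orthonormalBasisOneI_repr_symm_apply x

lemma toC_single_zero : toC (EuclideanSpace.single 0 1) = 1 := by simp [toC_apply]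

lemma toC_single_one : toC (EuclideanSpace.single 1 1) = Complex.I := by simp [toC_apply]

/-- The operator `∂₁ + i ∂₂`, i.e. twice the Cauchy–Riemann operator. -/
noncomputable def dbar (g : Plane → ℂ) (x : Plane) : ℂ :=
  fderiv ℝ g x (EuclideanSpace.single 0 1) +
    Complex.I * fderiv ℝ g x (EuclideanSpace.single 1 1)

lemma dbar_mul {f g : Plane → ℂ} {x : Plane} (hf : DifferentiableAt ℝ f x)
    (hg : DifferentiableAt ℝ g x) :
    dbar (fun y => f y * g y) x = dbar f x * g x + f x * dbar g x := by
  simp only [dbar, fderiv_fun_mul hf hg, add_apply, smul_apply, smul_eq_mul]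
  ring

lemma norm_dbar_le (g : Plane → ℂ) (x : Plane) : ‖dbar g x‖ ≤ 2 * ‖fderiv ℝ g x‖ := by
  have h : ∀ i, ‖fderiv ℝ g x (EuclideanSpace.single i 1)‖ ≤ ‖fderiv ℝ g x‖ := fun i => by
    simpa using (fderiv ℝ g x).le_opNorm (EuclideanSpace.single i 1)
  calc ‖dbar g x‖ ≤ _ := norm_add_le _ _
    _ ≤ ‖fderiv ℝ g x‖ + ‖fderiv ℝ g x‖ := by
      rw [norm_mul, Complex.norm_I, one_mul]; exact add_le_add (h 0) (h 1)
    _ = _ := by ring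

lemma contDiff_dbar {g : Plane → ℂ} (hg : ContDiff ℝ ∞ g) : ContDiff ℝ ∞ (dbar g) := by
  have h : ContDiff ℝ ∞ (fderiv ℝ g) := hg.fderiv_right (by simp)
  exact (h.clm_apply contDiff_const).add (contDiff_const.mul (h.clm_apply contDiff_const))

lemma continuous_dbar {g : Plane → ℂ} (hg : ContDiff ℝ 1 g) : Continuous (dbar g) := by
  have h : Continuous (fderiv ℝ g) := hg.continuous_fderiv (by norm_num)
  unfold dbar
  fun_prop

lemma dbar_eq_zero_of_notMem_tsupport {g : Plane → ℂ} {x : Plane} (hx : x ∉ tsupport g) :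
    dbar g x = 0 := by
  have : fderiv ℝ g x = 0 := by
    have := fun h => hx (support_fderiv_subset ℝ h)
    simpa using this
  simp [dbar, this]

lemma hasCompactSupport_dbar {g : Plane → ℂ} (hg : HasCompactSupport g) :
    HasCompactSupport (dbar g) :=
  HasCompactSupport.intro hg.isCompact fun _ hx => dbar_eq_zero_of_notMem_tsupport hx

/-- `∂̄`-equation `∂̄v = -F` in the sense of distributions, up to normalisation. -/
def WeakDbar (v F : Plane → ℂ) : Prop :=
  ∀ g : Plane → ℂ, ContDiff ℝ ∞ g → HasCompactSupport g →
    ∫ x, dbar g x * v x = ∫ x, g x * F x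

lemma integral_dbar_mul_inv_toC {φ : Plane → ℂ} (hφ : ContDiff ℝ 1 φ) (hc : HasCompactSupport φ) :
    ∫ x, dbar φ x * (toC x)⁻¹ = -(2 * Real.pi) * φ 0 := by
  set f : ℂ → ℂ := φ ∘ toC.symm with hf
  have h := integral_fderiv_mul_inv_eq (f := f) (hφ.comp toC.symm.contDiff)
    (hc.comp_homeomorph toC.symm.toHomeomorph)
  rw [← toC.measurePreserving.integral_comp toC.toHomeomorph.measurableEmbedding] at h
  have h0 : f 0 = φ 0 := by simp [hf]
  rw [h0] at h
  rw [← h]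
  refine integral_congr_ae (Filter.Eventually.of_forall fun x => ?_)
  have hd : ∀ y, fderiv ℝ f (toC x) (toC y) = fderiv ℝ φ x y := by
    intro y
    have h1 : HasFDerivAt f ((fderiv ℝ φ (toC.symm (toC x))).comp
        (toC.symm.toContinuousLinearEquiv : ℂ →L[ℝ] Plane)) (toC x) :=
      ((hφ.differentiable (by norm_num)) _).hasFDerivAt.comp _
        toC.symm.toContinuousLinearEquiv.hasFDerivAt
    rw [h1.fderiv]
    simp
  simp only [dbar, ← hd, toC_single_zero, toC_single_one]

lemma enorm_inv_toC (x : Plane) : ‖(toC x)⁻¹‖ₑ = rieszKernel 1 x := by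
  rw [rieszKernel, Real.rpow_neg_one, ← ofReal_norm, norm_inv, LinearIsometryEquiv.norm_map]

lemma measurable_inv_toC : Measurable fun x : Plane => (toC x)⁻¹ :=
  toC.continuous.measurable.inv

lemma locallyIntegrable_of_ball {f : Plane → ℂ} (hf : AEStronglyMeasurable f)
    (h : ∀ r > 0, ∫⁻ x in Metric.ball (0 : Plane) r, ‖f x‖ₑ ≠ ⊤) : LocallyIntegrable f := by
  intro x
  refine ⟨Metric.ball 0 (‖x‖ + 1), Metric.isOpen_ball.mem_nhds (by simp), hf.restrict, ?_⟩
  exact (h _ (by positivity)).lt_top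

lemma locallyIntegrable_inv_toC : LocallyIntegrable fun x : Plane => (toC x)⁻¹ := by
  refine locallyIntegrable_of_ball measurable_inv_toC.aestronglyMeasurable fun r hr => ?_
  obtain ⟨C, hC, h⟩ := exists_lintegral_rieszKernel_ball_volume_le one_pos (by norm_num)
  have := h 0 r hr
  simp only [enorm_inv_toC]
  simp only [rieszKernel_sub_comm 1 0, sub_zero] at this
  exact ne_top_of_le_ne_top (by finiteness) this

/-- The solution `(2π)⁻¹ φ * (1/ζ)` operator, without the factor `(2π)⁻¹`. -/
noncomputable def cauchyTransform (φ : Plane → ℂ) : Plane → ℂ :=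
  convolution (fun x : Plane => (toC x)⁻¹) φ (ContinuousLinearMap.mul ℝ ℂ) volume

lemma cauchyTransform_apply (φ : Plane → ℂ) (y : Plane) :
    cauchyTransform φ y = ∫ x, (toC (y - x))⁻¹ * φ x := by
  unfold cauchyTransform convolution
  rw [← integral_sub_left_eq_self _ volume y]
  simp

lemma enorm_cauchyTransform_le (φ : Plane → ℂ) (y : Plane) :
    ‖cauchyTransform φ y‖ₑ ≤ rieszPotential (fun x => ‖φ x‖ₑ) y := by
  rw [cauchyTransform_apply]
  refine (enorm_integral_le_lintegral_enorm _).trans_eq ?_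
  simp only [enorm_mul, enorm_inv_toC, rieszPotential]

lemma contDiff_cauchyTransform {φ : Plane → ℂ} (hφ : ContDiff ℝ ∞ φ) (hc : HasCompactSupport φ) :
    ContDiff ℝ ∞ (cauchyTransform φ) :=
  hc.contDiff_convolution_right _ locallyIntegrable_inv_toC hφ

/-- Derivatives of the convolution fall on `φ`, and the Cauchy–Pompeiu formula applies to `t ↦ φ (x
- t)`. The reflection changes the sign of the derivative and turns `-2π` into `2π`. -/
lemma dbar_cauchyTransform {φ : Plane → ℂ} (hφ : ContDiff ℝ ∞ φ) (hc : HasCompactSupport φ)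
    (x : Plane) : dbar (cauchyTransform φ) x = 2 * Real.pi * φ x := by
  have hφ1 : ContDiff ℝ 1 φ := hφ.of_le (by simp)
  have hd := (hc.hasFDerivAt_convolution_right (ContinuousLinearMap.mul ℝ ℂ)
    locallyIntegrable_inv_toC hφ1 x).fderiv
  have hap : ∀ e, fderiv ℝ (cauchyTransform φ) x e =
      ∫ t, (toC t)⁻¹ * fderiv ℝ φ (x - t) e := by
    intro e
    unfold cauchyTransform
    rw [hd, convolution_precompR_apply _ locallyIntegrable_inv_toC (hc.fderiv ℝ)
      (hφ1.continuous_fderiv (by norm_num))]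
    rfl
  have hint : ∀ e, Integrable fun t => (toC t)⁻¹ * fderiv ℝ φ (x - t) e := by
    intro e
    have hcc : HasCompactSupport fun y => fderiv ℝ φ y e :=
      (hc.fderiv ℝ).comp_left (g := fun L : Plane →L[ℝ] ℂ => L e) (by simp)
    exact hcc.convolutionExists_right (ContinuousLinearMap.mul ℝ ℂ) locallyIntegrable_inv_toC
      ((hφ1.continuous_fderiv (by norm_num)).clm_apply continuous_const) x
  set φ' : Plane → ℂ := fun t => φ (x - t) with hφ'
  have hφ'1 : ContDiff ℝ 1 φ' := hφ1.comp (contDiff_const.sub contDiff_id)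
  have hφ'c : HasCompactSupport φ' :=
    hc.comp_homeomorph (Homeomorph.subLeft x)
  have hcp := integral_dbar_mul_inv_toC hφ'1 hφ'c
  have hd' : ∀ t, dbar φ' t = -(fderiv ℝ φ (x - t) (EuclideanSpace.single 0 1) +
      Complex.I * fderiv ℝ φ (x - t) (EuclideanSpace.single 1 1)) := by
    intro t
    have h1 : HasFDerivAt φ' ((fderiv ℝ φ (x - t)).comp
        (-(ContinuousLinearMap.id ℝ Plane))) t :=
      ((hφ1.differentiable (by norm_num)) (x - t)).hasFDerivAt.comp t
        ((hasFDerivAt_id t).const_sub x)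
    simp only [dbar, h1.fderiv]
    simp
    ring
  have h0 : φ' 0 = φ x := by simp [hφ']
  rw [h0] at hcp
  rw [dbar, hap, hap, ← integral_const_mul, ← integral_add (hint _) ((hint _).const_mul _)]
  have : 2 * (Real.pi : ℂ) * φ x = -(-(2 * Real.pi) * φ x) := by ring
  rw [this, ← hcp, ← integral_neg]
  congr 1
  ext t
  rw [hd']; ring

/-! ### Rescaled cutoffs and the Cauchy representation of global solutions -/

/-- A fixed smooth bump equal to `1` on the unit ball and supported in the ball of radius `2`. -/
noncomputable def unitBump : ContDiffBump (0 : Plane) := ⟨1, 2, one_pos, one_lt_two⟩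

/-- The rescaled cutoff `χ(x / R)`. -/
noncomputable def cutoff (R : ℝ) (x : Plane) : ℂ := (unitBump (R⁻¹ • x) : ℝ)

lemma contDiff_cutoff (R : ℝ) : ContDiff ℝ ∞ (cutoff R) :=
  Complex.ofRealCLM.contDiff.comp (unitBump.contDiff.comp (contDiff_const_smul _))

lemma norm_cutoff_le_one (R : ℝ) (x : Plane) : ‖cutoff R x‖ ≤ 1 := by
  rw [cutoff, Complex.norm_real, Real.norm_of_nonneg unitBump.nonneg]
  exact unitBump.le_one

lemma cutoff_eq_one {R : ℝ} (hR : 0 < R) {x : Plane} (hx : ‖x‖ ≤ R) : cutoff R x = 1 := by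
  rw [cutoff, unitBump.one_of_mem_closedBall, Complex.ofReal_one]
  rw [mem_closedBall_zero_iff, norm_smul, norm_inv, Real.norm_of_nonneg hR.le,
    inv_mul_le_iff₀ hR]
  simpa [unitBump] using hx

lemma cutoff_eq_zero {R : ℝ} (hR : 0 < R) {x : Plane} (hx : 2 * R ≤ ‖x‖) : cutoff R x = 0 := by
  rw [cutoff, unitBump.zero_of_le_dist, Complex.ofReal_zero]
  rw [dist_zero_right, norm_smul, norm_inv, Real.norm_of_nonneg hR.le, inv_mul_eq_div,
    le_div_iff₀ hR]
  simpa [unitBump] using hx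

lemma hasCompactSupport_cutoff {R : ℝ} (hR : 0 < R) : HasCompactSupport (cutoff R) :=
  HasCompactSupport.intro (isCompact_closedBall 0 (2 * R)) fun x hx => cutoff_eq_zero hR (by
    rw [mem_closedBall_zero_iff, not_le] at hx; exact hx.le)

lemma dbar_cutoff_eq_zero_of_lt {R : ℝ} (hR : 0 < R) {x : Plane} (hx : ‖x‖ < R) :
    dbar (cutoff R) x = 0 := by
  have h : cutoff R =ᶠ[nhds x] fun _ => 1 := by
    filter_upwards [(isOpen_lt continuous_norm continuous_const).mem_nhds hx] with y hy
    exact cutoff_eq_one hR (le_of_lt hy)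
  simp [dbar, h.fderiv_eq]

lemma dbar_cutoff_eq_zero_of_gt {R : ℝ} (hR : 0 < R) {x : Plane} (hx : 2 * R < ‖x‖) :
    dbar (cutoff R) x = 0 := by
  have h : cutoff R =ᶠ[nhds x] fun _ => 0 := by
    filter_upwards [(isOpen_lt continuous_const continuous_norm).mem_nhds hx] with y hy
    exact cutoff_eq_zero hR (le_of_lt hy)
  simp [dbar, h.fderiv_eq]

lemma exists_norm_dbar_cutoff_le : ∃ K : ℝ, 0 < K ∧ ∀ R > 0, ∀ x, ‖dbar (cutoff R) x‖ ≤ K / R := by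
  have hcs : HasCompactSupport (fderiv ℝ (cutoff 1)) := (hasCompactSupport_cutoff one_pos).fderiv ℝ
  obtain ⟨K, hK⟩ := hcs.exists_bound_of_continuous
    ((contDiff_cutoff 1).continuous_fderiv (by simp))
  refine ⟨2 * (|K| + 1), by positivity, fun R hR x => ?_⟩
  have hd : fderiv ℝ (cutoff R) x = R⁻¹ • fderiv ℝ (cutoff 1) (R⁻¹ • x) := by
    have h1 : cutoff R = fun x => cutoff 1 (R⁻¹ • x) := by ext y; simp [cutoff]
    rw [h1, fderiv_comp_smul]
  refine (norm_dbar_le _ _).trans ?_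
  rw [hd, norm_smul, norm_inv, Real.norm_of_nonneg hR.le, div_eq_mul_inv]
  have := (hK (R⁻¹ • x)).trans (le_abs_self K)
  calc _ ≤ 2 * (R⁻¹ * (|K| + 1)) := by gcongr; linarith
    _ = _ := by ring

/-- The derivative of the cutoff is of size `1/R` on a set of area of order `R²`, so Hölder with
exponents `4` and `4/3` gives `R⁻¹ R^(3/2)`. The bound serves at both ends: for `R → ∞` against a
decay `1/R`, and for `R → 0` to remove a point singularity. -/
lemma exists_lintegral_dbar_cutoff_mul_le {w : Plane → ℝ≥0∞} (hw : Measurable w)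
    (h4 : ∫⁻ x, w x ^ 4 ≠ ⊤) : ∃ K : ℝ≥0∞, K ≠ ⊤ ∧ ∀ R > 0,
      ∫⁻ x, ‖dbar (cutoff R) x‖ₑ * w x ≤ K * ENNReal.ofReal (R ^ (1 / 2 : ℝ)) := by
  obtain ⟨K, hK0, hK⟩ := exists_norm_dbar_cutoff_le
  refine ⟨ENNReal.ofReal K * ((∫⁻ x, w x ^ 4) ^ (1 / 4 : ℝ) *
    ENNReal.ofReal ((9 * Real.pi) ^ (3 / 4 : ℝ))), ?_, fun R hR => ?_⟩
  · have : (∫⁻ x, w x ^ 4) ^ (1 / 4 : ℝ) ≠ ⊤ := ENNReal.rpow_ne_top_of_nonneg (by norm_num) h4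
    finiteness
  have h1 : ∫⁻ x in Metric.ball 0 (3 * R), w x ≤ (∫⁻ x, w x ^ 4) ^ (1 / 4 : ℝ) *
      ENNReal.ofReal ((9 * Real.pi) ^ (3 / 4 : ℝ) * R ^ (3 / 2 : ℝ)) := by
    have hpq : (4 : ℝ).HolderConjugate (4 / 3) := by rw [Real.holderConjugate_iff]; norm_num
    have := ENNReal.lintegral_mul_le_Lp_mul_Lq (volume.restrict (Metric.ball (0 : Plane) (3 * R)))
      hpq hw.aemeasurable (measurable_const (a := (1 : ℝ≥0∞))).aemeasurable
    simp only [Pi.mul_apply, mul_one, ENNReal.one_rpow, setLIntegral_one] at this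
    refine this.trans (mul_le_mul' ?_ ?_)
    · norm_num
      exact ENNReal.rpow_le_rpow (setLIntegral_le_lintegral _ _) (by norm_num)
    · rw [volume_ball_plane, ← ENNReal.ofReal_pow (by positivity), ← ENNReal.ofReal_mul
        (by positivity), ENNReal.ofReal_rpow_of_pos (by positivity)]
      refine le_of_eq ?_
      congr 1
      rw [show (3 * R) ^ 2 * Real.pi = (9 * Real.pi) * R ^ (2 : ℝ) by
        rw [Real.rpow_two]; ring, Real.mul_rpow (by positivity) (by positivity),
        ← Real.rpow_mul hR.le]
      norm_num
  calc ∫⁻ x, ‖dbar (cutoff R) x‖ₑ * w x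
      ≤ ∫⁻ x, (Metric.ball 0 (3 * R)).indicator (fun x => ENNReal.ofReal (K / R) * w x) x := by
        refine lintegral_mono fun x => ?_
        by_cases hx : x ∈ Metric.ball 0 (3 * R)
        · rw [Set.indicator_of_mem hx]
          gcongr
          rw [← ofReal_norm]
          exact ENNReal.ofReal_le_ofReal (hK R hR x)
        · rw [mem_ball_zero_iff, not_lt] at hx
          rw [dbar_cutoff_eq_zero_of_gt hR (by linarith)]
          simp
    _ = ENNReal.ofReal (K / R) * ∫⁻ x in Metric.ball 0 (3 * R), w x := by
        rw [lintegral_indicator measurableSet_ball, lintegral_const_mul _ hw]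
    _ ≤ _ := by
        refine (mul_le_mul_right h1 _).trans_eq ?_
        rw [div_eq_mul_inv, ENNReal.ofReal_mul hK0.le, ENNReal.ofReal_mul (by positivity)]
        have : ENNReal.ofReal R⁻¹ * ENNReal.ofReal (R ^ (3 / 2 : ℝ)) =
            ENNReal.ofReal (R ^ (1 / 2 : ℝ)) := by
          rw [← ENNReal.ofReal_mul (by positivity), ← Real.rpow_neg_one, ← Real.rpow_add hR]
          norm_num
        rw [← this]; ring

lemma lintegral_rieszPotential_mul {a b : Plane → ℝ≥0∞} (ha : Measurable a) (hb : Measurable b) :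
    ∫⁻ y, rieszPotential a y * b y = ∫⁻ x, a x * rieszPotential b x := by
  have mk : Measurable fun z : Plane × Plane => rieszKernel 1 (z.1 - z.2) * a z.2 * b z.1 :=
    (((measurable_rieszKernel 1).comp (measurable_fst.sub measurable_snd)).mul
      (ha.comp measurable_snd)).mul (hb.comp measurable_fst)
  calc ∫⁻ y, rieszPotential a y * b y
      = ∫⁻ y, ∫⁻ x, rieszKernel 1 (y - x) * a x * b y := by
        refine lintegral_congr fun y => ?_
        exact (lintegral_mul_const _ ((measurable_rieszKernel_sub 1 y).mul ha)).symm
    _ = ∫⁻ x, ∫⁻ y, rieszKernel 1 (y - x) * a x * b y :=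
        lintegral_lintegral_swap (f := fun y x => rieszKernel 1 (y - x) * a x * b y) mk.aemeasurable
    _ = _ := by
        refine lintegral_congr fun x => ?_
        refine Eq.trans (lintegral_congr fun y => ?_)
          (lintegral_const_mul (a x) ((measurable_rieszKernel_sub 1 x).mul hb))
        rw [rieszKernel_sub_comm]; ring

/-- A bounded function supported in a ball tested against a function with finite integrals over
balls. -/
lemma lintegral_enorm_mul_ne_top {φ : Plane → ℂ} (hφ : Continuous φ) (hc : HasCompactSupport φ)
    {P : Plane → ℝ≥0∞} (hP : ∀ r > 0, ∫⁻ x in Metric.ball 0 r, P x ≠ ⊤) :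
    ∫⁻ x, ‖φ x‖ₑ * P x ≠ ⊤ := by
  obtain ⟨K, hK⟩ := hc.exists_bound_of_continuous hφ
  obtain ⟨r, hr⟩ := (hc.isCompact.isBounded).subset_ball (0 : Plane)
  have hr' : tsupport φ ⊆ Metric.ball 0 (max r 1) :=
    hr.trans (Metric.ball_subset_ball (le_max_left _ _))
  have : ∫⁻ x, ‖φ x‖ₑ * P x ≤ ENNReal.ofReal K * ∫⁻ x in Metric.ball 0 (max r 1), P x := by
    rw [← lintegral_const_mul' _ _ ENNReal.ofReal_ne_top, ← lintegral_indicator measurableSet_ball]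
    refine lintegral_mono fun x => ?_
    by_cases hx : x ∈ Metric.ball 0 (max r 1)
    · rw [Set.indicator_of_mem hx]
      gcongr
      rw [← ofReal_norm]
      exact ENNReal.ofReal_le_ofReal (hK x)
    · rw [image_eq_zero_of_notMem_tsupport fun h => hx (hr' h)]
      simp
  exact ne_top_of_le_ne_top (ENNReal.mul_ne_top ENNReal.ofReal_ne_top (hP _ (by positivity))) this

lemma exists_norm_cauchyTransform_le {φ : Plane → ℂ} (hφ : Continuous φ)
    (hc : HasCompactSupport φ) :
    ∃ C R₀ : ℝ, 0 < R₀ ∧ 0 ≤ C ∧ ∀ R ≥ R₀, ∀ x, R ≤ ‖x‖ → ‖cauchyTransform φ x‖ ≤ C / R := by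
  obtain ⟨r, hr⟩ := (hc.isCompact.isBounded).subset_ball (0 : Plane)
  have hint : Integrable φ := hφ.integrable_of_hasCompactSupport hc
  refine ⟨2 * ∫ x, ‖φ x‖, max (2 * r) 1, by positivity, by positivity, fun R hR x hx => ?_⟩
  have hR0 : 0 < R := lt_of_lt_of_le (by positivity) hR
  have hR1 : 2 * r ≤ R := (le_max_left _ _).trans hR
  rw [cauchyTransform_apply]
  have hb : ∀ y, ‖(toC (x - y))⁻¹ * φ y‖ ≤ 2 / R * ‖φ y‖ := by
    intro y
    by_cases hy : y ∈ tsupport φ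
    · have hyr := hr hy
      rw [mem_ball_zero_iff] at hyr
      have h1 : R / 2 ≤ ‖x - y‖ := by linarith [norm_sub_norm_le x y]
      rw [norm_mul, norm_inv, LinearIsometryEquiv.norm_map]
      gcongr
      rw [inv_le_comm₀ (by linarith) (by positivity), inv_div]
      exact h1
    · rw [image_eq_zero_of_notMem_tsupport hy]; simp
  calc _ ≤ ∫ y, 2 / R * ‖φ y‖ := norm_integral_le_of_norm_le (hint.norm.const_mul _)
        (Filter.Eventually.of_forall hb)
    _ = _ := by rw [integral_const_mul]; ring

lemma integrable_of_lintegral_enorm_ne_top {α : Type*} [MeasurableSpace α] {μ : Measure α}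
    {f : α → ℂ} (hf : AEStronglyMeasurable f μ) (h : ∫⁻ x, ‖f x‖ₑ ∂μ ≠ ⊤) : Integrable f μ :=
  ⟨hf, h.lt_top⟩

lemma setLIntegral_ball_ne_top_of_pow_four {u : Plane → ℝ≥0∞}
    (h4 : ∫⁻ x, u x ^ 4 ≠ ⊤) (r : ℝ) : ∫⁻ x in Metric.ball 0 r, u x ≠ ⊤ := by
  have : ∀ x, u x ≤ 1 + u x ^ 4 := by
    intro x
    rcases le_total (u x) 1 with h | h
    · exact h.trans le_self_add
    · exact (le_self_pow₀ h (by norm_num)).trans le_add_self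
  refine ne_top_of_le_ne_top ?_ (lintegral_mono this)
  rw [lintegral_add_left measurable_const, setLIntegral_one]
  refine ENNReal.add_ne_top.2 ⟨measure_ball_lt_top.ne, ?_⟩
  exact ne_top_of_le_ne_top h4 (setLIntegral_le_lintegral _ _)

/-- A global `L⁴` solution of the distributional `∂̄`-equation is dominated by the Riesz potential
of the right-hand side. -/
theorem WeakDbar.ae_enorm_le {v F : Plane → ℂ} (h : WeakDbar v F) (hv : Measurable v)
    (hF : Measurable F) (hv4 : ∫⁻ x, ‖v x‖ₑ ^ 4 ≠ ⊤)
    (hP : ∀ r > 0, ∫⁻ x in Metric.ball 0 r, rieszPotential (fun y => ‖F y‖ₑ) x ≠ ⊤) :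
    ∀ᵐ x, ‖v x‖ₑ ≤ rieszPotential (fun y => ‖F y‖ₑ) x := by
  set P := rieszPotential (fun y => ‖F y‖ₑ) with hPdef
  have mP : Measurable P := measurable_rieszPotential hF.enorm
  have hvloc : ∀ r > 0, ∫⁻ x in Metric.ball (0 : Plane) r, ‖v x‖ₑ ≠ ⊤ := fun r _ =>
    setLIntegral_ball_ne_top_of_pow_four hv4 r
  set TF : Plane → ℂ := fun x => ∫ y, (toC (y - x))⁻¹ * F y with hTF
  have mker : Measurable fun z : Plane × Plane => (toC (z.2 - z.1))⁻¹ * F z.2 :=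
    (measurable_inv_toC.comp (measurable_snd.sub measurable_fst)).mul (hF.comp measurable_snd)
  have hTFle : ∀ x, ‖TF x‖ₑ ≤ P x := fun x => by
    refine (enorm_integral_le_lintegral_enorm _).trans_eq ?_
    simp only [enorm_mul, enorm_inv_toC, hPdef, rieszPotential]
    refine lintegral_congr fun y => ?_
    rw [rieszKernel_sub_comm]
  have mTF : AEStronglyMeasurable TF :=
    (mker.stronglyMeasurable.integral_prod_right').aestronglyMeasurable
  have hTFloc : LocallyIntegrable TF := locallyIntegrable_of_ball mTF fun r hr =>
    ne_top_of_le_ne_top (hP r hr) (lintegral_mono fun x => hTFle x)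
  have hvli : LocallyIntegrable fun x => 2 * Real.pi * v x :=
    (locallyIntegrable_of_ball hv.aestronglyMeasurable hvloc).smul (2 * (Real.pi : ℂ))
  -- Duality for `2π v = TF`: the equation is tested with `cutoff · Φ`, where `dbar Φ = 2π φ`. The
  -- commutator with the cutoff is of order `R⁻¹ R^(1/2)`, by the decay of `Φ` and the `L⁴` bound,
  -- so it vanishes as `R → ∞`. Fubini then moves the Cauchy kernel from `φ` to `F`.
  have key : ∀ g : Plane → ℝ, ContDiff ℝ ∞ g → HasCompactSupport g →
      ∫ x, g x • (2 * Real.pi * v x) = ∫ x, g x • TF x := by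
    intro g hg hgc
    set φ : Plane → ℂ := fun x => (g x : ℂ) with hφdef
    have hφ : ContDiff ℝ ∞ φ := Complex.ofRealCLM.contDiff.comp hg
    have hφc : HasCompactSupport φ := hgc.comp_left (g := fun r : ℝ => (r : ℂ)) (by simp)
    have mφ : Measurable φ := hφ.continuous.measurable
    set Φ := cauchyTransform φ with hΦ
    have hΦs : ContDiff ℝ ∞ Φ := contDiff_cauchyTransform hφ hφc
    have hΦF : Integrable fun y => Φ y * F y := by
      refine integrable_of_lintegral_enorm_ne_top
        (hΦs.continuous.measurable.mul hF).aestronglyMeasurable ?_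
      refine ne_top_of_le_ne_top (lintegral_enorm_mul_ne_top hφ.continuous hφc hP) ?_
      rw [hPdef, ← lintegral_rieszPotential_mul mφ.enorm hF.enorm]
      refine lintegral_mono fun y => ?_
      rw [enorm_mul]
      gcongr
      exact enorm_cauchyTransform_le φ y
    have hφv : Integrable fun x => 2 * Real.pi * φ x * v x := by
      refine integrable_of_lintegral_enorm_ne_top (by fun_prop) ?_
      simp only [mul_assoc, enorm_mul]
      rw [lintegral_const_mul' _ _ (by simp), lintegral_const_mul' _ _ (by simp)]
      refine ENNReal.mul_ne_top (by simp) (ENNReal.mul_ne_top (by simp) ?_)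
      exact lintegral_enorm_mul_ne_top hφ.continuous hφc hvloc
    have hlim1 : Filter.Tendsto (fun n : ℕ => ∫ x, cutoff (n + 1) x * (2 * Real.pi * φ x * v x))
        Filter.atTop (nhds (∫ x, 2 * Real.pi * φ x * v x)) := by
      refine tendsto_integral_of_dominated_convergence (fun x => ‖2 * Real.pi * φ x * v x‖)
        (fun n => (contDiff_cutoff _).continuous.aestronglyMeasurable.mul hφv.1) hφv.norm
        (fun n => Filter.Eventually.of_forall fun x => ?_)
        (Filter.Eventually.of_forall fun x => ?_)
      · rw [norm_mul]
        exact mul_le_of_le_one_left (norm_nonneg _) (norm_cutoff_le_one _ _)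
      · refine tendsto_const_nhds.congr' ?_
        filter_upwards [Filter.eventually_ge_atTop ⌈‖x‖⌉₊] with n hn
        rw [cutoff_eq_one (by positivity), one_mul]
        exact ((Nat.le_ceil _).trans (Nat.cast_le.2 hn)).trans (by linarith)
    have hlim2 : Filter.Tendsto (fun n : ℕ => ∫ x, cutoff (n + 1) x * (Φ x * F x))
        Filter.atTop (nhds (∫ x, Φ x * F x)) := by
      refine tendsto_integral_of_dominated_convergence (fun x => ‖Φ x * F x‖)
        (fun n => (contDiff_cutoff _).continuous.aestronglyMeasurable.mul hΦF.1) hΦF.norm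
        (fun n => Filter.Eventually.of_forall fun x => ?_)
        (Filter.Eventually.of_forall fun x => ?_)
      · rw [norm_mul]
        exact mul_le_of_le_one_left (norm_nonneg _) (norm_cutoff_le_one _ _)
      · refine tendsto_const_nhds.congr' ?_
        filter_upwards [Filter.eventually_ge_atTop ⌈‖x‖⌉₊] with n hn
        rw [cutoff_eq_one (by positivity), one_mul]
        exact ((Nat.le_ceil _).trans (Nat.cast_le.2 hn)).trans (by linarith)
    obtain ⟨K, hK, hKle⟩ := exists_lintegral_dbar_cutoff_mul_le hv.enorm hv4
    obtain ⟨C, R₀, hR₀, hC0, hCle⟩ := exists_norm_cauchyTransform_le hφ.continuous hφc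
    have hbd : ∀ n : ℕ, R₀ ≤ n + 1 → ∫⁻ x, ‖dbar (cutoff (n + 1)) x * Φ x * v x‖ₑ ≤
        K * ENNReal.ofReal (C * ((n : ℝ) + 1) ^ (-(1 / 2) : ℝ)) := by
      intro n hn
      have hn0 : (0 : ℝ) < n + 1 := by positivity
      calc ∫⁻ x, ‖dbar (cutoff (n + 1)) x * Φ x * v x‖ₑ
          ≤ ∫⁻ x, ENNReal.ofReal (C / (n + 1)) * (‖dbar (cutoff (n + 1)) x‖ₑ * ‖v x‖ₑ) := by
            refine lintegral_mono fun x => ?_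
            rw [enorm_mul, enorm_mul]
            by_cases hx : ‖x‖ < n + 1
            · rw [dbar_cutoff_eq_zero_of_lt hn0 hx]; simp
            · have : ‖Φ x‖ₑ ≤ ENNReal.ofReal (C / (n + 1)) := by
                rw [← ofReal_norm]
                exact ENNReal.ofReal_le_ofReal (hCle _ hn x (not_lt.1 hx))
              calc _ ≤ ‖dbar (cutoff (n + 1)) x‖ₑ * ENNReal.ofReal (C / (n + 1)) * ‖v x‖ₑ := by
                    gcongr
                _ = _ := by ring
        _ ≤ ENNReal.ofReal (C / (n + 1)) *
            (K * ENNReal.ofReal (((n : ℝ) + 1) ^ (1 / 2 : ℝ))) := by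
            rw [lintegral_const_mul' _ _ ENNReal.ofReal_ne_top]
            gcongr
            exact hKle _ hn0
        _ = _ := by
            rw [mul_left_comm, ← ENNReal.ofReal_mul (by positivity), div_mul_eq_mul_div,
              mul_div_assoc, div_eq_mul_inv, ← Real.rpow_neg_one, ← Real.rpow_add hn0]
            norm_num
    have hlim3 : Filter.Tendsto (fun n : ℕ => ∫ x, dbar (cutoff (n + 1)) x * Φ x * v x)
        Filter.atTop (nhds 0) := by
      rw [tendsto_zero_iff_enorm_tendsto_zero]
      have h0 : Filter.Tendsto
          (fun n : ℕ => K * ENNReal.ofReal (C * ((n : ℝ) + 1) ^ (-(1 / 2) : ℝ)))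
          Filter.atTop (nhds 0) := by
        have h1 : Filter.Tendsto (fun n : ℕ => C * ((n : ℝ) + 1) ^ (-(1 / 2) : ℝ)) Filter.atTop
            (nhds (C * 0)) :=
          ((tendsto_rpow_neg_atTop (by norm_num : (0 : ℝ) < 1 / 2)).comp
            (Filter.tendsto_atTop_add_const_right _ 1 tendsto_natCast_atTop_atTop)).const_mul C
        have h2 := ENNReal.Tendsto.const_mul (ENNReal.tendsto_ofReal h1) (Or.inr hK)
        simpa using h2
      refine tendsto_of_tendsto_of_tendsto_of_le_of_le' tendsto_const_nhds h0
        (Filter.Eventually.of_forall fun n => by simp) ?_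
      filter_upwards [Filter.eventually_ge_atTop ⌈R₀⌉₊] with n hn
      refine (enorm_integral_le_lintegral_enorm _).trans (hbd n ?_)
      exact ((Nat.le_ceil _).trans (Nat.cast_le.2 hn)).trans (by linarith)
    have hid : ∀ᶠ n : ℕ in Filter.atTop,
        (∫ x, cutoff (n + 1) x * (2 * Real.pi * φ x * v x)) +
        (∫ x, dbar (cutoff (n + 1)) x * Φ x * v x) = ∫ x, cutoff (n + 1) x * (Φ x * F x) := by
      filter_upwards [Filter.eventually_ge_atTop ⌈R₀⌉₊] with n hn
      have hn0 : (0 : ℝ) < n + 1 := by positivity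
      have hR₀n : R₀ ≤ n + 1 :=
        ((Nat.le_ceil _).trans (Nat.cast_le.2 hn)).trans (by linarith)
      have ht := h (fun x => cutoff (n + 1) x * Φ x) ((contDiff_cutoff _).mul hΦs)
        (hasCompactSupport_cutoff hn0).mul_right
      have hi1 : Integrable fun x => cutoff (n + 1) x * (2 * Real.pi * φ x * v x) :=
        hφv.bdd_mul (contDiff_cutoff _).continuous.aestronglyMeasurable
          (Filter.Eventually.of_forall (norm_cutoff_le_one _))
      have hi2 : Integrable fun x => dbar (cutoff (n + 1)) x * Φ x * v x := by
        refine integrable_of_lintegral_enorm_ne_top ?_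
          (ne_top_of_le_ne_top (by finiteness) (hbd n hR₀n))
        exact (((continuous_dbar ((contDiff_cutoff _).of_le (by simp))).mul
          hΦs.continuous).measurable.mul hv).aestronglyMeasurable
      rw [← integral_add hi1 hi2]
      convert ht using 1
      · refine integral_congr_ae (Filter.Eventually.of_forall fun x => ?_)
        simp only
        rw [dbar_mul ((contDiff_cutoff _).differentiable (by simp) x)
          (hΦs.differentiable (by simp) x), dbar_cauchyTransform hφ hφc]
        ring
      · simp only [mul_assoc]
    have hfin : ∫ x, 2 * Real.pi * φ x * v x = ∫ x, Φ x * F x := by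
      have h1 := (hlim1.add hlim3).congr' hid
      rw [add_zero] at h1
      exact tendsto_nhds_unique h1 hlim2
    have hfub : ∫ y, Φ y * F y = ∫ x, φ x * TF x := by
      have mk2 : Measurable fun z : Plane × Plane => (toC (z.1 - z.2))⁻¹ * φ z.2 * F z.1 :=
        ((measurable_inv_toC.comp (measurable_fst.sub measurable_snd)).mul
          (mφ.comp measurable_snd)).mul (hF.comp measurable_fst)
      have hint2 : Integrable (Function.uncurry fun y x => (toC (y - x))⁻¹ * φ x * F y)
          (volume.prod volume) := by
        refine integrable_of_lintegral_enorm_ne_top mk2.aestronglyMeasurable ?_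
        refine ne_of_eq_of_ne (lintegral_prod _ mk2.enorm.aemeasurable) ?_
        refine ne_top_of_le_ne_top (lintegral_enorm_mul_ne_top hφ.continuous hφc hP) (le_of_eq ?_)
        rw [hPdef, ← lintegral_rieszPotential_mul mφ.enorm hF.enorm]
        have e : ∀ y, ∫⁻ x, ‖(toC (y - x))⁻¹ * φ x * F y‖ₑ =
            rieszPotential (fun x => ‖φ x‖ₑ) y * ‖F y‖ₑ := fun y => by
          simp only [enorm_mul, enorm_inv_toC]
          exact lintegral_mul_const _ ((measurable_rieszKernel_sub 1 y).mul mφ.enorm)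
        exact lintegral_congr e
      calc ∫ y, Φ y * F y = ∫ y, ∫ x, (toC (y - x))⁻¹ * φ x * F y := by
            refine integral_congr_ae (Filter.Eventually.of_forall fun y => ?_)
            simp only [hΦ, cauchyTransform_apply, integral_mul_const]
        _ = ∫ x, ∫ y, (toC (y - x))⁻¹ * φ x * F y := integral_integral_swap hint2
        _ = _ := by
            refine integral_congr_ae (Filter.Eventually.of_forall fun x => ?_)
            simp only [hTF]
            rw [← integral_const_mul]
            refine integral_congr_ae (Filter.Eventually.of_forall fun y => ?_)
            simp only; ring
    rw [hfub] at hfin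
    simp only [Complex.real_smul]
    rw [← hfin]
    refine integral_congr_ae (Filter.Eventually.of_forall fun x => ?_)
    simp only [hφdef]; ring
  filter_upwards [ae_eq_of_integral_contDiff_smul_eq hvli hTFloc key] with x hx
  refine le_trans ?_ (hTFle x)
  rw [← hx, ← ofReal_norm, ← ofReal_norm]
  refine ENNReal.ofReal_le_ofReal ?_
  rw [norm_mul, norm_mul, Complex.norm_real, Real.norm_of_nonneg Real.pi_pos.le]
  have : (1 : ℝ) ≤ ‖(2 : ℂ)‖ * Real.pi := by
    rw [Complex.norm_ofNat]; linarith [Real.pi_gt_three]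
  exact le_mul_of_one_le_left (norm_nonneg _) this

/-! ### The Fourier transform on integrable functions -/

lemma integral_fourier_mul_eq_mul_fourier {f g : Plane → ℂ} (hf : Integrable f)
    (hg : Integrable g) : ∫ ξ, 𝓕 f ξ * g ξ = ∫ x, f x * 𝓕 g x := by
  have h := VectorFourier.integral_fourierIntegral_smul_eq_flip (L := innerₗ Plane)
    Real.continuous_fourierChar (by exact continuous_inner) hf hg
  rwa [flip_innerₗ] at h

lemma enorm_fourier_le (f : Plane → ℂ) (ξ : Plane) : ‖𝓕 f ξ‖ₑ ≤ ∫⁻ x, ‖f x‖ₑ := by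
  rw [Real.fourier_eq]
  refine (enorm_integral_le_lintegral_enorm _).trans_eq (lintegral_congr fun x => ?_)
  rw [← ofReal_norm, Circle.norm_smul, ofReal_norm]

lemma continuous_fourier {f : Plane → ℂ} (hf : Integrable f) : Continuous (𝓕 f) :=
  VectorFourier.fourierIntegral_continuous Real.continuous_fourierChar
    (by exact continuous_inner) hf

lemma locallyIntegrable_of_bound {f : Plane → ℂ} (hf : AEStronglyMeasurable f) {K : ℝ≥0∞}
    (hK : K ≠ ⊤) (h : ∀ x, ‖f x‖ₑ ≤ K) : LocallyIntegrable f := by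
  refine locallyIntegrable_of_ball hf fun r _ => ?_
  refine ne_top_of_le_ne_top ?_ (lintegral_mono h)
  rw [setLIntegral_const]
  exact ENNReal.mul_ne_top hK measure_ball_lt_top.ne

/-- The Fourier transform of a smooth compactly supported function, as a Schwartz function. -/
lemma exists_schwartz_eq_fourier {g : Plane → ℂ} (hg : ContDiff ℝ ∞ g) (hc : HasCompactSupport g) :
    ∃ s : SchwartzMap Plane ℂ, (∀ x, s x = g x) ∧ ∀ x, 𝓕 s x = 𝓕 g x := by
  refine ⟨hc.toSchwartzMap hg, fun x => rfl, fun x => ?_⟩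
  rw [SchwartzMap.fourier_coe]
  rfl

/-- Plancherel's formula for functions in `L¹ ∩ L²`. -/
theorem lintegral_enorm_fourier_sq {f : Plane → ℂ} (hf : Integrable f) (hf2 : MemLp f 2) :
    ∫⁻ ξ, ‖𝓕 f ξ‖ₑ ^ 2 = ∫⁻ x, ‖f x‖ₑ ^ 2 := by
  set F : Lp ℂ 2 (volume : Measure Plane) := hf2.toLp f with hF
  -- The `L²` transform is identified with the Fourier integral by pairing both with test functions,
  -- which moves the transform onto a Schwartz function. Plancherel for `Lp` then applies.
  have hcoe : ∀ᵐ ξ, (𝓕 F : Lp ℂ 2 (volume : Measure Plane)) ξ = 𝓕 f ξ := by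
    refine ae_eq_of_integral_contDiff_smul_eq ?_ ?_ fun g hg hgc => ?_
    · exact (Lp.memLp _).locallyIntegrable (by norm_num)
    · exact locallyIntegrable_of_bound (continuous_fourier hf).aestronglyMeasurable
        hf.2.ne (enorm_fourier_le f)
    · have hφ : ContDiff ℝ ∞ fun x => (g x : ℂ) := Complex.ofRealCLM.contDiff.comp hg
      have hφc : HasCompactSupport fun x => (g x : ℂ) :=
        hgc.comp_left (g := fun r : ℝ => (r : ℂ)) (by simp)
      obtain ⟨s, hs, hs'⟩ := exists_schwartz_eq_fourier hφ hφc
      have h1 := DFunLike.congr_fun (Lp.fourier_toTemperedDistribution_eq F) s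
      rw [TemperedDistribution.fourier_apply, Lp.toTemperedDistribution_apply,
        Lp.toTemperedDistribution_apply] at h1
      have h2 : ∫ x, (𝓕 s) x • F x = ∫ x, 𝓕 (fun x => (g x : ℂ)) x * f x := by
        refine integral_congr_ae ?_
        filter_upwards [hf2.coeFn_toLp] with x hx
        rw [hF, hx, hs', smul_eq_mul]
      rw [h2, integral_fourier_mul_eq_mul_fourier
        (hφ.continuous.integrable_of_hasCompactSupport hφc) hf] at h1
      simp only [hs] at h1
      simpa [Complex.real_smul] using h1.symm
  have hn : ‖(𝓕 F : Lp ℂ 2 (volume : Measure Plane))‖ = ‖F‖ := Lp.norm_fourier_eq F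
  have e1 : eLpNorm (𝓕 f) 2 volume = eLpNorm f 2 volume := by
    rw [← eLpNorm_congr_ae hcoe, ← eLpNorm_congr_ae hf2.coeFn_toLp,
      ← ENNReal.toReal_eq_toReal_iff' (Lp.eLpNorm_ne_top _) (Lp.eLpNorm_ne_top _)]
    rw [Lp.norm_def, Lp.norm_def] at hn
    exact hn
  have e2 : ∀ h : Plane → ℂ, ∫⁻ x, ‖h x‖ₑ ^ 2 = eLpNorm h 2 volume ^ 2 := fun h => by
    rw [eLpNorm_eq_lintegral_rpow_enorm_toReal (by norm_num) (by norm_num),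
      ← ENNReal.rpow_natCast, ← ENNReal.rpow_mul]
    simp
  rw [e2, e2, e1]

/-- Fourier inversion almost everywhere. -/
theorem ae_eq_fourierInv_fourier {f : Plane → ℂ} (hf : Integrable f) (hf' : Integrable (𝓕 f)) :
    ∀ᵐ x, f x = 𝓕⁻ (𝓕 f) x := by
  have hcomp : ∀ x, 𝓕⁻ (𝓕 f) x = 𝓕 (𝓕 f) (-x) := fun x => Real.fourierInv_eq_fourier_neg _ _
  refine ae_eq_of_integral_contDiff_smul_eq hf.locallyIntegrable ?_ fun g hg hgc => ?_
  · refine locallyIntegrable_of_bound (K := ∫⁻ x, ‖𝓕 f x‖ₑ) ?_ hf'.2.ne fun x => ?_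
    · have : 𝓕⁻ (𝓕 f) = fun x => 𝓕 (𝓕 f) (-x) := funext hcomp
      rw [this]
      exact ((continuous_fourier hf').comp continuous_neg).aestronglyMeasurable
    · rw [hcomp]; exact enorm_fourier_le _ _
  -- The double transform of the reflected test function `φ` is `g`, so both transforms can be
  -- passed from `φ` to `f`.
  · set φ : Plane → ℂ := fun x => (g (-x) : ℂ) with hφdef
    have hφ : ContDiff ℝ ∞ φ := Complex.ofRealCLM.contDiff.comp (hg.comp contDiff_neg)
    have hφc : HasCompactSupport φ :=
      (hgc.comp_homeomorph (Homeomorph.neg Plane)).comp_left (g := fun r : ℝ => (r : ℂ)) (by simp)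
    have hφi : Integrable φ := hφ.continuous.integrable_of_hasCompactSupport hφc
    obtain ⟨s, hs, hs'⟩ := exists_schwartz_eq_fourier hφ hφc
    have hFφ : Integrable (𝓕 φ) := by
      have := (𝓕 s).integrable (μ := volume)
      refine this.congr (Filter.Eventually.of_forall fun x => hs' x)
    calc ∫ x, g x • f x = ∫ x, f x * 𝓕 (𝓕 φ) x := by
          refine integral_congr_ae (Filter.Eventually.of_forall fun x => ?_)
          have h1 := (hφ.continuous).fourierInv_fourier_eq hφi hFφ
          have h2 : 𝓕 (𝓕 φ) x = φ (-x) := by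
            have := congr_fun h1 (-x)
            rw [Real.fourierInv_eq_fourier_neg, neg_neg] at this
            exact this
          simp only [h2]
          simp only [hφdef, neg_neg, Complex.real_smul]
          ring
      _ = ∫ x, φ x * 𝓕 (𝓕 f) x := by
          rw [← integral_fourier_mul_eq_mul_fourier hf hFφ]
          simp only [mul_comm (𝓕 f _)]
          rw [integral_fourier_mul_eq_mul_fourier hφi hf']
      _ = ∫ x, φ (-x) * 𝓕 (𝓕 f) (-x) :=
          (integral_neg_eq_self (fun x => φ x * 𝓕 (𝓕 f) x) volume).symm
      _ = _ := by
          simp only [hφdef, neg_neg, hcomp, Complex.real_smul]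

lemma fourier_comp_add_right (f : Plane → ℂ) (h ξ : Plane) :
    𝓕 (fun x => f (x + h)) ξ = Complex.exp (Complex.I * ((2 * Real.pi * inner ℝ h ξ : ℝ) : ℂ)) *
      𝓕 f ξ := by
  have := congr_fun (VectorFourier.fourierIntegral_comp_add_right Real.fourierChar volume
    (innerₗ Plane) f h) ξ
  refine Eq.trans this ?_
  rw [Circle.smul_def, Real.fourierChar_apply, smul_eq_mul]
  congr 2
  rw [mul_comm]; rfl

/-- The Fourier transform of a product is the convolution of the Fourier transforms. -/
lemma fourier_mul_eq {f g : Plane → ℂ} (hf : Integrable f) (hg : Integrable g)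
    (hg' : Integrable (𝓕 g)) (ξ : Plane) :
    𝓕 (fun x => f x * g x) ξ = ∫ η, 𝓕 f (ξ - η) * 𝓕 g η := by
  have hinv := ae_eq_fourierInv_fourier hg hg'
  have he : ∀ x η : Plane, Complex.exp ((-2 * Real.pi * inner ℝ x ξ : ℝ) * Complex.I) *
      Complex.exp ((2 * Real.pi * inner ℝ η x : ℝ) * Complex.I) =
      Complex.exp ((-2 * Real.pi * inner ℝ x (ξ - η) : ℝ) * Complex.I) := by
    intro x η
    rw [← Complex.exp_add, inner_sub_right, real_inner_comm x η]
    congr 1; push_cast; ring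
  have hint : Integrable (Function.uncurry fun x η : Plane =>
      Complex.exp ((-2 * Real.pi * inner ℝ x (ξ - η) : ℝ) * Complex.I) * (f x * 𝓕 g η))
      (volume.prod volume) := by
    refine (hf.mul_prod hg').bdd_mul (c := 1) ?_ (Filter.Eventually.of_forall fun z => ?_)
    · refine Continuous.aestronglyMeasurable ?_
      fun_prop
    · rw [Complex.norm_exp_ofReal_mul_I]
  calc 𝓕 (fun x => f x * g x) ξ
      = ∫ x, ∫ η, Complex.exp ((-2 * Real.pi * inner ℝ x (ξ - η) : ℝ) * Complex.I) *
        (f x * 𝓕 g η) := by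
        rw [Real.fourier_eq']
        refine integral_congr_ae ?_
        filter_upwards [hinv] with x hx
        simp only [hx]
        rw [Real.fourierInv_eq', smul_eq_mul, ← integral_const_mul, ← integral_const_mul]
        refine integral_congr_ae (Filter.Eventually.of_forall fun η => ?_)
        simp only [← he, smul_eq_mul]
        ring
    _ = ∫ η, ∫ x, Complex.exp ((-2 * Real.pi * inner ℝ x (ξ - η) : ℝ) * Complex.I) *
        (f x * 𝓕 g η) := integral_integral_swap hint
    _ = _ := by
        refine integral_congr_ae (Filter.Eventually.of_forall fun η => ?_)
        simp only
        rw [Real.fourier_eq' f (ξ - η), ← integral_mul_const]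
        simp only [smul_eq_mul, mul_assoc]

lemma fourier_conj (f : Plane → ℂ) (ξ : Plane) :
    𝓕 (fun x => (starRingEnd ℂ) (f x)) ξ = (starRingEnd ℂ) (𝓕 f (-ξ)) := by
  rw [Real.fourier_eq', Real.fourier_eq', ← integral_conj]
  refine integral_congr_ae (Filter.Eventually.of_forall fun x => ?_)
  simp only [smul_eq_mul, map_mul, ← Complex.exp_conj, Complex.conj_ofReal, Complex.conj_I,
    inner_neg_right]
  congr 2
  push_cast; ring

/-! ### The cubic system and the boundedness of its solutions -/

/-- `(β₁|b|² + 2β₂|a|²) b̄`, the nonlinearity in the variables `(ψ₁, ψ̄₂)`. -/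
noncomputable def cubic (β₁ β₂ : ℝ) (a b : ℂ) : ℂ :=
  ((β₁ * ‖b‖ ^ 2 + 2 * β₂ * ‖a‖ ^ 2 : ℝ) : ℂ) * (starRingEnd ℂ) b

/-- Without norms the nonlinearity is a polynomial in `a`, `b` and their conjugates, so any class
closed under sums, products and conjugation is stable under it. -/
lemma cubic_eq (β₁ β₂ : ℝ) (a b : ℂ) : cubic β₁ β₂ a b =
    (β₁ : ℂ) * (b * (starRingEnd ℂ) b * (starRingEnd ℂ) b) +
      (2 * β₂ : ℂ) * (a * (starRingEnd ℂ) a * (starRingEnd ℂ) b) := by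
  have h : ∀ z : ℂ, ((‖z‖ ^ 2 : ℝ) : ℂ) = z * (starRingEnd ℂ) z := fun z => by
    rw [Complex.mul_conj, Complex.normSq_eq_norm_sq]
  simp only [cubic, Complex.ofReal_add, Complex.ofReal_mul, h]
  push_cast
  ring

lemma _root_.Measurable.cubic {β₁ β₂ : ℝ} {a b : Plane → ℂ} (ha : Measurable a)
    (hb : Measurable b) : Measurable fun x => CriticalDirac.cubic β₁ β₂ (a x) (b x) := by
  unfold CriticalDirac.cubic
  have hb' : Measurable fun x => (starRingEnd ℂ) (b x) :=
    Complex.continuous_conj.measurable.comp hb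
  exact (Complex.measurable_ofReal.comp (((hb.norm.pow_const 2).const_mul _).add
    ((ha.norm.pow_const 2).const_mul _))).mul hb'

lemma enorm_cubic_le (β₁ β₂ : ℝ) (a b : ℂ) :
    ‖cubic β₁ β₂ a b‖ₑ ≤ ENNReal.ofReal (|β₁| + 2 * |β₂|) * (‖a‖ₑ + ‖b‖ₑ) ^ 3 := by
  rw [← ofReal_norm, ← ofReal_norm, ← ofReal_norm, ← ENNReal.ofReal_add (by positivity)
    (by positivity), ← ENNReal.ofReal_pow (by positivity), ← ENNReal.ofReal_mul (by positivity)]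
  refine ENNReal.ofReal_le_ofReal ?_
  rw [cubic, norm_mul, RCLike.norm_conj, Complex.norm_real, Real.norm_eq_abs]
  have ha := norm_nonneg a
  have hb := norm_nonneg b
  have h1 : ‖b‖ ^ 2 ≤ (‖a‖ + ‖b‖) ^ 2 := by gcongr; linarith
  have h2 : ‖a‖ ^ 2 ≤ (‖a‖ + ‖b‖) ^ 2 := by gcongr; linarith
  calc |β₁ * ‖b‖ ^ 2 + 2 * β₂ * ‖a‖ ^ 2| * ‖b‖
      ≤ (|β₁| * ‖b‖ ^ 2 + 2 * |β₂| * ‖a‖ ^ 2) * ‖b‖ := by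
        gcongr
        refine (abs_add_le _ _).trans (le_of_eq ?_)
        simp [abs_mul]
    _ ≤ (|β₁| * (‖a‖ + ‖b‖) ^ 2 + 2 * |β₂| * (‖a‖ + ‖b‖) ^ 2) * (‖a‖ + ‖b‖) := by
        gcongr; linarith
    _ = _ := by ring

/-- The system for `(ψ₁, ψ̄₂)` in the sense of distributions. -/
def IsWeakSystem (β₁ β₂ : ℝ) (v₁ v₂ : Plane → ℂ) : Prop :=
  WeakDbar v₁ (fun x => -Complex.I * cubic β₁ β₂ (v₁ x) (v₂ x)) ∧
    WeakDbar v₂ (fun x => Complex.I * cubic β₁ β₂ (v₂ x) (v₁ x))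

lemma IsWeakSystem.congr_ae {β₁ β₂ : ℝ} {v₁ v₂ w₁ w₂ : Plane → ℂ}
    (h : IsWeakSystem β₁ β₂ v₁ v₂) (h₁ : w₁ =ᵐ[volume] v₁) (h₂ : w₂ =ᵐ[volume] v₂) :
    IsWeakSystem β₁ β₂ w₁ w₂ := by
  constructor
  · intro g hg hc
    refine Eq.trans (integral_congr_ae ?_) ((h.1 g hg hc).trans (integral_congr_ae ?_)) <;>
    · filter_upwards [h₁, h₂] with x h1 h2
      simp only [h1, h2]
  · intro g hg hc
    refine Eq.trans (integral_congr_ae ?_) ((h.2 g hg hc).trans (integral_congr_ae ?_)) <;>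
    · filter_upwards [h₁, h₂] with x h1 h2
      simp only [h1, h2]

lemma exists_setLIntegral_ball_cube_le {u : Plane → ℝ≥0∞} (hu : Measurable u)
    (h4 : ∫⁻ x, u x ^ 4 ≠ ⊤) : ∃ B : ℝ≥0∞, B ≠ ⊤ ∧ ∀ x, ∀ r > 0,
      ∫⁻ y in Metric.ball x r, u y ^ 3 ≤ B * ENNReal.ofReal (r ^ (1 / 2 : ℝ)) := by
  refine ⟨(∫⁻ x, u x ^ 4) ^ (3 / 4 : ℝ) * ENNReal.ofReal Real.pi ^ (1 / 4 : ℝ),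
    ENNReal.mul_ne_top (ENNReal.rpow_ne_top_of_nonneg (by norm_num) h4)
      (ENNReal.rpow_ne_top_of_nonneg (by norm_num) ENNReal.ofReal_ne_top), fun x r hr => ?_⟩
  have hpq : Real.HolderConjugate (4 / 3) 4 := by
    rw [Real.holderConjugate_iff]; norm_num
  have h := ENNReal.lintegral_mul_le_Lp_mul_Lq (volume.restrict (Metric.ball x r)) hpq
    (f := fun y => u y ^ 3) (g := fun _ => 1) (hu.pow_const 3).aemeasurable aemeasurable_const
  have e : ∀ z : ℝ≥0∞, (z ^ 3) ^ (4 / 3 : ℝ) = z ^ 4 := fun z => by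
    rw [← ENNReal.rpow_natCast, ← ENNReal.rpow_mul, ← ENNReal.rpow_natCast]; norm_num
  simp only [Pi.mul_apply, mul_one, e, ENNReal.one_rpow, setLIntegral_const, one_mul,
    volume_ball_plane] at h
  refine h.trans ?_
  rw [mul_assoc]
  refine mul_le_mul' ?_ (le_of_eq ?_)
  · norm_num
    gcongr
    exact Measure.restrict_le_self
  · rw [ENNReal.mul_rpow_of_nonneg _ _ (by norm_num), mul_comm, ← ENNReal.rpow_natCast,
      ← ENNReal.rpow_mul, ENNReal.ofReal_rpow_of_pos hr]
    norm_num

lemma ennreal_add_pow_le (a b : ℝ≥0∞) (n : ℕ) : (a + b) ^ n ≤ 2 ^ n * (a ^ n + b ^ n) := by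
  rcases le_total a b with h | h
  · calc (a + b) ^ n ≤ (b + b) ^ n := by gcongr
      _ = 2 ^ n * b ^ n := by rw [← two_mul, mul_pow]
      _ ≤ _ := by gcongr; exact le_add_self
  · calc (a + b) ^ n ≤ (a + a) ^ n := by gcongr
      _ = 2 ^ n * a ^ n := by rw [← two_mul, mul_pow]
      _ ≤ _ := by gcongr; exact le_self_add

/-- The Cauchy representation requires a locally integrable potential. The `L⁴` bound gives `u³`
growth `r^(1/2)`; the Morrey estimate makes its potential locally `L²`, hence locally `L¹`. -/
lemma WeakDbar.ae_enorm_le_of_cube {v F : Plane → ℂ} (hvF : WeakDbar v F) {u : Plane → ℝ≥0∞}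
    (hu : Measurable u) (h4 : ∫⁻ x, u x ^ 4 ≠ ⊤) {c : ℝ≥0∞} (hc : c ≠ ⊤) (hv : Measurable v)
    (hF : Measurable F) (hv4 : ∫⁻ x, ‖v x‖ₑ ^ 4 ≠ ⊤) (hle : ∀ x, ‖F x‖ₑ ≤ c * u x ^ 3) :
    ∀ᵐ x, ‖v x‖ₑ ≤ c * rieszPotential (fun y => u y ^ 3) x := by
  obtain ⟨B, hB, hgrowth⟩ := exists_setLIntegral_ball_cube_le hu h4
  obtain ⟨C₂, hC₂, hsq⟩ := exists_lintegral_rieszPotential_sq_le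
  have hmono : ∀ x, rieszPotential (fun y => ‖F y‖ₑ) x ≤
      c * rieszPotential (fun y => u y ^ 3) x := fun x => by
    rw [rieszPotential, rieszPotential, ← lintegral_const_mul' _ _ (by finiteness)]
    refine lintegral_mono fun y => ?_
    rw [mul_left_comm]
    gcongr
    exact hle y
  refine (hvF.ae_enorm_le hv hF hv4 fun r hr => ?_).mono fun x hx => hx.trans (hmono x)
  have hI := measurable_rieszPotential (hu.pow_const 3)
  refine ne_top_of_le_ne_top ?_ (lintegral_mono fun x => hmono x)
  rw [lintegral_const_mul _ hI]
  refine ENNReal.mul_ne_top (by finiteness) ?_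
  have h2 := hsq _ (hu.pow_const 3) 0 B (fun x r hr => by simpa using hgrowth x r hr) 0 r hr
  have h3 := lintegral_mul_le_sqrt_mul_sqrt (volume.restrict (Metric.ball (0 : Plane) r)) hI
    (measurable_const (a := (1 : ℝ≥0∞)))
  simp only [mul_one, one_pow, setLIntegral_const, one_mul, volume_ball_plane] at h3
  refine ne_top_of_le_ne_top ?_ h3
  refine ENNReal.mul_ne_top (ne_top_of_le_ne_top ?_ h2)
    (ENNReal.rpow_ne_top_of_nonneg (by norm_num) (by finiteness))
  finiteness

/-- Weak `L⁴` solutions of the system have bounded representatives. -/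
theorem IsWeakSystem.exists_bounded {β₁ β₂ : ℝ} {v₁ v₂ : Plane → ℂ}
    (h : IsWeakSystem β₁ β₂ v₁ v₂) (hv₁ : Measurable v₁) (hv₂ : Measurable v₂)
    (h₁ : ∫⁻ x, ‖v₁ x‖ₑ ^ 4 ≠ ⊤) (h₂ : ∫⁻ x, ‖v₂ x‖ₑ ^ 4 ≠ ⊤) :
    ∃ w₁ w₂ : Plane → ℂ, w₁ =ᵐ[volume] v₁ ∧ w₂ =ᵐ[volume] v₂ ∧ Measurable w₁ ∧ Measurable w₂ ∧
      ∃ K : ℝ, ∀ x, ‖w₁ x‖ ≤ K ∧ ‖w₂ x‖ ≤ K := by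
  obtain ⟨u, hudef⟩ : ∃ u : Plane → ℝ≥0∞, ∀ x, u x = ‖v₁ x‖ₑ + ‖v₂ x‖ₑ := ⟨_, fun x => rfl⟩
  have hu : Measurable u := by
    rw [funext hudef]
    exact hv₁.enorm.add hv₂.enorm
  have h4 : ∫⁻ x, u x ^ 4 ≠ ⊤ := by
    have hle : ∀ x, u x ^ 4 ≤ 2 ^ 4 * (‖v₁ x‖ₑ ^ 4 + ‖v₂ x‖ₑ ^ 4) := fun x => by
      rw [hudef]
      exact ennreal_add_pow_le _ _ 4
    refine ne_top_of_le_ne_top ?_ (lintegral_mono hle)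
    rw [lintegral_const_mul' _ _ (by finiteness), lintegral_add_left (hv₁.enorm.pow_const 4)]
    exact ENNReal.mul_ne_top (by finiteness) (ENNReal.add_ne_top.2 ⟨h₁, h₂⟩)
  obtain ⟨c, hc, hcle⟩ : ∃ c : ℝ≥0∞, c ≠ ⊤ ∧
      ∀ a b : ℂ, ‖cubic β₁ β₂ a b‖ₑ ≤ c * (‖a‖ₑ + ‖b‖ₑ) ^ 3 :=
    ⟨_, ENNReal.ofReal_ne_top, enorm_cubic_le β₁ β₂⟩
  have main := fun {v F : Plane → ℂ} (hvF : WeakDbar v F) => hvF.ae_enorm_le_of_cube (c := c) hu h4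
    hc
  have hI : ‖Complex.I‖ₑ = 1 := by rw [← ofReal_norm, Complex.norm_I, ENNReal.ofReal_one]
  have b₁ := main h.1 hv₁ ((hv₁.cubic hv₂).const_mul _) h₁ fun x => by
    rw [enorm_mul, enorm_neg, hI, one_mul]
    rw [hudef]
    exact hcle _ _
  have b₂ := main h.2 hv₂ ((hv₂.cubic hv₁).const_mul _) h₂ fun x => by
    rw [enorm_mul, hI, one_mul, hudef, add_comm ‖v₁ x‖ₑ]
    exact hcle _ _
  obtain ⟨K, hK, hbd⟩ := exists_ae_le_of_le_rieszPotential_cube hu h4 (C := 2 * c) (by finiteness)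
    (by
      filter_upwards [b₁, b₂] with x h1 h2
      rw [two_mul, add_mul]
      rw [hudef]
      exact add_le_add h1 h2)
  -- The bound holds only almost everywhere; setting `v` to zero on the exceptional null set gives a
  -- bound at every point.
  have trunc : ∀ {v : Plane → ℂ}, Measurable v → (∀ᵐ x, ‖v x‖ₑ ≤ K) →
      ∃ w : Plane → ℂ, w =ᵐ[volume] v ∧ Measurable w ∧ ∀ x, ‖w x‖ ≤ K.toReal := by
    intro v hv hle
    refine ⟨{x | ‖v x‖ₑ ≤ K}.indicator v, ?_, hv.indicator (measurableSet_le hv.enorm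
      measurable_const), fun x => ?_⟩
    · filter_upwards [hle] with x hx
      exact Set.indicator_of_mem (s := {x | ‖v x‖ₑ ≤ K}) hx v
    · by_cases hx : ‖v x‖ₑ ≤ K
      · rw [Set.indicator_of_mem (by exact hx), ← toReal_enorm]
        exact ENNReal.toReal_mono hK hx
      · rw [Set.indicator_of_notMem (by exact hx), norm_zero]
        exact ENNReal.toReal_nonneg
  obtain ⟨w₁, e₁, m₁, k₁⟩ := trunc hv₁ (hbd.mono fun x hx => le_self_add.trans (hudef x ▸ hx))
  obtain ⟨w₂, e₂, m₂, k₂⟩ := trunc hv₂ (hbd.mono fun x hx => le_add_self.trans (hudef x ▸ hx))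
  exact ⟨w₁, w₂, e₁, e₂, m₁, m₂, K.toReal, fun x => ⟨k₁ x, k₂ x⟩⟩

/-! ### Localization, and function classes stable under the nonlinearity -/

/-- Bounded measurable functions with compact support. -/
structure BddCompact (f : Plane → ℂ) : Prop where
  measurable : Measurable f
  compact : HasCompactSupport f
  bdd : ∃ K : ℝ, ∀ x, ‖f x‖ ≤ K

namespace BddCompact

variable {f g : Plane → ℂ}

lemma mul_bdd (hf : BddCompact f) (hg : Measurable g) {K : ℝ} (hK : ∀ x, ‖g x‖ ≤ K) :
    BddCompact fun x => f x * g x := by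
  obtain ⟨L, hL⟩ := hf.bdd
  refine ⟨hf.measurable.mul hg, hf.compact.mul_right, L * K, fun x => ?_⟩
  rw [norm_mul]
  exact mul_le_mul (hL x) (hK x) (norm_nonneg _) ((norm_nonneg _).trans (hL x))

lemma mul (hf : BddCompact f) (hg : BddCompact g) : BddCompact fun x => f x * g x :=
  hf.mul_bdd hg.measurable hg.bdd.choose_spec

lemma add (hf : BddCompact f) (hg : BddCompact g) : BddCompact fun x => f x + g x := by
  obtain ⟨L, hL⟩ := hf.bdd
  obtain ⟨K, hK⟩ := hg.bdd
  exact ⟨hf.measurable.add hg.measurable, hf.compact.add hg.compact, L + K,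
    fun x => (norm_add_le _ _).trans (add_le_add (hL x) (hK x))⟩

lemma const_mul (c : ℂ) (hf : BddCompact f) : BddCompact fun x => c * f x := by
  obtain ⟨L, hL⟩ := hf.bdd
  refine ⟨hf.measurable.const_mul c, hf.compact.mul_left, ‖c‖ * L, fun x => ?_⟩
  rw [norm_mul]
  gcongr
  exact hL x

lemma conj (hf : BddCompact f) : BddCompact fun x => (starRingEnd ℂ) (f x) := by
  obtain ⟨L, hL⟩ := hf.bdd
  refine ⟨Complex.continuous_conj.measurable.comp hf.measurable,
    hf.compact.comp_left (map_zero _), L, fun x => ?_⟩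
  rw [RCLike.norm_conj]
  exact hL x

lemma of_continuous (hf : Continuous f) (hc : HasCompactSupport f) : BddCompact f :=
  ⟨hf.measurable, hc, hc.exists_bound_of_continuous hf⟩

lemma memLp (hf : BddCompact f) (p : ℝ≥0∞) : MemLp f p := by
  obtain ⟨L, hL⟩ := hf.bdd
  have hi : Integrable ((tsupport f).indicator fun _ => L) :=
    (integrable_indicator_iff (isClosed_tsupport f).measurableSet).2
      (integrableOn_const hf.compact.measure_lt_top.ne)
  have hm : MemLp ((tsupport f).indicator fun _ => L) p :=
    memLp_indicator_const p (isClosed_tsupport f).measurableSet L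
      (Or.inr hf.compact.measure_lt_top.ne)
  refine hm.mono hf.measurable.aestronglyMeasurable (Filter.Eventually.of_forall fun x => ?_)
  by_cases hx : x ∈ tsupport f
  · rw [Set.indicator_of_mem hx]
    exact (hL x).trans (le_abs_self _)
  · rw [image_eq_zero_of_notMem_tsupport hx]
    simp

lemma integrable (hf : BddCompact f) : Integrable f := memLp_one_iff_integrable.1 (hf.memLp 1)

lemma lintegral_enorm_fourier_sq_ne_top (hf : BddCompact f) : ∫⁻ ξ, ‖𝓕 f ξ‖ₑ ^ 2 ≠ ⊤ := by
  rw [lintegral_enorm_fourier_sq hf.integrable (hf.memLp 2)]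
  have := (hf.memLp 2).eLpNorm_lt_top
  rw [eLpNorm_lt_top_iff_lintegral_rpow_enorm_lt_top (by norm_num) (by norm_num)] at this
  simpa using this.ne

end BddCompact

/-- Conditions on a property of bounded compactly supported functions under which it passes from
localized solutions of the system to the right hand side. -/
structure IsGoodClass (P : (Plane → ℂ) → Prop) : Prop where
  mul : ∀ {f g}, BddCompact f → BddCompact g → P f → P g → P fun x => f x * g x
  add : ∀ {f g}, BddCompact f → BddCompact g → P f → P g → P fun x => f x + g x
  const_mul : ∀ {f} (c : ℂ), BddCompact f → P f → P fun x => c * f x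
  conj : ∀ {f}, BddCompact f → P f → P fun x => (starRingEnd ℂ) (f x)

lemma exists_norm_le_of_hasCompactSupport {η : Plane → ℂ} (hc : HasCompactSupport η) :
    ∃ R > 0, ∀ x, R < ‖x‖ → η x = 0 := by
  obtain ⟨R, hR⟩ := hc.isBounded.exists_norm_le
  refine ⟨|R| + 1, by positivity, fun x hx => ?_⟩
  by_contra h
  have := hR x (subset_tsupport _ h)
  linarith [le_abs_self R]

/-- Membership is known only for localized functions, so every factor of each cubic monomial needs
its own cutoff. One factor carries `η` and the other two a cutoff equal to `1` on the support of
`η`, which leaves the product unchanged. -/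
lemma IsGoodClass.mul_cubic {P : (Plane → ℂ) → Prop} (hP : IsGoodClass P) (β₁ β₂ : ℝ)
    {a b : Plane → ℂ} (ma : Measurable a) (mb : Measurable b) {K : ℝ}
    (ka : ∀ x, ‖a x‖ ≤ K) (kb : ∀ x, ‖b x‖ ≤ K)
    (ha : ∀ η : Plane → ℂ, ContDiff ℝ ∞ η → HasCompactSupport η → P fun x => η x * a x)
    (hb : ∀ η : Plane → ℂ, ContDiff ℝ ∞ η → HasCompactSupport η → P fun x => η x * b x)
    {η : Plane → ℂ} (hη : ContDiff ℝ ∞ η) (hc : HasCompactSupport η) :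
    P fun x => η x * cubic β₁ β₂ (a x) (b x) := by
  obtain ⟨R, hR, hsupp⟩ := exists_norm_le_of_hasCompactSupport hc
  have bη := BddCompact.of_continuous hη.continuous hc
  have sχ : ContDiff ℝ ∞ (cutoff R) := contDiff_cutoff R
  have cχ : HasCompactSupport (cutoff R) := hasCompactSupport_cutoff hR
  have bχ := BddCompact.of_continuous sχ.continuous cχ
  have pηb := hb η hη hc
  have pηa := ha η hη hc
  have pχb := hP.conj (bχ.mul_bdd mb kb) (hb _ sχ cχ)
  have pχa := hP.conj (bχ.mul_bdd ma ka) (ha _ sχ cχ)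
  have bηb := bη.mul_bdd mb kb
  have bηa := bη.mul_bdd ma ka
  have bχb := (bχ.mul_bdd mb kb).conj
  have bχa := (bχ.mul_bdd ma ka).conj
  have h1 := hP.mul (bηb.mul bχb) bχb (hP.mul bηb bχb pηb pχb) pχb
  have h2 := hP.mul (bηa.mul bχa) bχb (hP.mul bηa bχa pηa pχa) pχb
  have h3 := hP.add (((bηb.mul bχb).mul bχb).const_mul (β₁ : ℂ))
    (((bηa.mul bχa).mul bχb).const_mul (2 * β₂ : ℂ))
    (hP.const_mul (β₁ : ℂ) ((bηb.mul bχb).mul bχb) h1)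
    (hP.const_mul (2 * β₂ : ℂ) ((bηa.mul bχa).mul bχb) h2)
  convert h3 using 2 with x
  rw [cubic_eq]
  rcases le_or_gt ‖x‖ R with hx | hx
  · rw [cutoff_eq_one hR hx]
    ring_nf
  · rw [hsupp x hx]
    ring

/-- The Fourier transform of a localized weak solution. -/
lemma WeakDbar.fourier_eq {v F : Plane → ℂ} (h : WeakDbar v F) (mv : Measurable v)
    (mF : Measurable F) {K L : ℝ} (kv : ∀ x, ‖v x‖ ≤ K) (kF : ∀ x, ‖F x‖ ≤ L) {η : Plane → ℂ}
    (hη : ContDiff ℝ ∞ η) (hc : HasCompactSupport η) (ξ : Plane) :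
    2 * Real.pi * ‖ξ‖ * ‖𝓕 (fun x => η x * v x) ξ‖ =
      ‖𝓕 (fun x => η x * F x + (-1) * (dbar η x * v x)) ξ‖ := by
  -- The test function is `η` times the Fourier character, an eigenfunction of `dbar` with
  -- eigenvalue `-2πi ζ`, where `ζ = toC ξ` has modulus `‖ξ‖`.
  set e : Plane → ℂ := fun x => Complex.exp ((-2 * Real.pi * inner ℝ x ξ : ℝ) * Complex.I) with he
  have se : ContDiff ℝ ∞ e := by
    refine Complex.contDiff_exp.comp ((Complex.ofRealCLM.contDiff.comp ?_).mul contDiff_const)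
    exact contDiff_const.mul (contDiff_id.inner ℝ contDiff_const)
  have de : ∀ x, dbar e x = -(2 * Real.pi * Complex.I * toC ξ) * e x := by
    intro x
    set ℓ : Plane →L[ℝ] ℂ :=
      Complex.ofRealCLM.comp ((-2 * Real.pi) • innerSL ℝ ξ) with hℓ
    have hee : e = fun x => Complex.exp (ℓ x * Complex.I) := by
      funext y
      simp [hℓ, he, real_inner_comm]
    have hd : HasFDerivAt e (Complex.exp (ℓ x * Complex.I) • (Complex.I • ℓ)) x := by
      have h1 : HasFDerivAt (fun x => ℓ x * Complex.I) (Complex.I • ℓ) x :=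
        ℓ.hasFDerivAt.mul_const Complex.I
      nth_rw 1 [hee]
      exact h1.cexp
    have hx : Complex.exp (ℓ x * Complex.I) = e x := (congr_fun hee x).symm
    rw [dbar, hd.fderiv, hx]
    simp [hℓ, toC_apply, EuclideanSpace.inner_single_right]
    ring
  have key := h (fun x => η x * e x) (hη.mul se) hc.mul_right
  have dη : ∀ x, dbar (fun x => η x * e x) x =
      dbar η x * e x + η x * (-(2 * Real.pi * Complex.I * toC ξ) * e x) := fun x => by
    rw [dbar_mul (hη.differentiable (by simp) x) (se.differentiable (by simp) x), de]
  have b1 : BddCompact fun x => η x * v x :=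
    (BddCompact.of_continuous hη.continuous hc).mul_bdd mv kv
  have b2 : BddCompact fun x => η x * F x :=
    (BddCompact.of_continuous hη.continuous hc).mul_bdd mF kF
  have b3 : BddCompact fun x => dbar η x * v x :=
    (BddCompact.of_continuous (continuous_dbar (hη.of_le (by simp)))
      (hasCompactSupport_dbar hc)).mul_bdd mv kv
  have me : Measurable e := se.continuous.measurable
  have ke : ∀ x, ‖e x‖ ≤ 1 := fun x => by rw [he, Complex.norm_exp_ofReal_mul_I]
  have i1 := (b1.mul_bdd me ke).integrable
  have i2 := (b2.mul_bdd me ke).integrable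
  have i3 := (b3.mul_bdd me ke).integrable
  have hF : 𝓕 (fun x => η x * F x + (-1) * (dbar η x * v x)) ξ =
      (∫ x, η x * F x * e x) - ∫ x, dbar η x * v x * e x := by
    rw [Real.fourier_eq', ← integral_sub i2 i3]
    refine integral_congr_ae (Filter.Eventually.of_forall fun x => ?_)
    simp only [smul_eq_mul, he]
    ring
  have hv : 𝓕 (fun x => η x * v x) ξ = ∫ x, η x * v x * e x := by
    rw [Real.fourier_eq']
    refine integral_congr_ae (Filter.Eventually.of_forall fun x => ?_)
    simp only [smul_eq_mul, he]
    ring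
  have hid : ∫ x, dbar (fun x => η x * e x) x * v x =
      (∫ x, dbar η x * v x * e x) -
        (2 * Real.pi * Complex.I * toC ξ) * ∫ x, η x * v x * e x := by
    rw [← integral_const_mul, ← integral_sub i3 (i1.const_mul _)]
    refine integral_congr_ae (Filter.Eventually.of_forall fun x => ?_)
    simp only [dη]
    ring
  have hid' : ∫ x, η x * e x * F x = ∫ x, η x * F x * e x :=
    integral_congr_ae (Filter.Eventually.of_forall fun x => by simp only; ring)
  rw [hid, hid', ← hv] at key
  have : 𝓕 (fun x => η x * F x + (-1) * (dbar η x * v x)) ξ =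
      -((2 * Real.pi * Complex.I * toC ξ) * 𝓕 (fun x => η x * v x) ξ) := by
    rw [hF, ← key]; ring
  rw [this, norm_neg, norm_mul, norm_mul, norm_mul, norm_mul, Complex.norm_I, toC.norm_map,
    Complex.norm_real, Real.norm_of_nonneg Real.pi_pos.le, Complex.norm_ofNat, mul_one]

/-! ### One derivative in `L²`, by translations and by the Fourier side -/

/-- Lipschitz modulus of continuity in `L²`. -/
def HasLipschitzModulus (f : Plane → ℂ) : Prop :=
  ∃ C : ℝ≥0∞, C ≠ ⊤ ∧ ∀ h : Plane, ∫⁻ x, ‖f (x + h) - f x‖ₑ ^ 2 ≤ C * ‖h‖ₑ ^ 2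

lemma lintegral_add_sq_le {a b : Plane → ℝ≥0∞} (ha : Measurable a) {A B : ℝ≥0∞}
    (hA : ∫⁻ x, a x ^ 2 ≤ A) (hB : ∫⁻ x, b x ^ 2 ≤ B) :
    ∫⁻ x, (a x + b x) ^ 2 ≤ 4 * (A + B) := by
  calc ∫⁻ x, (a x + b x) ^ 2 ≤ ∫⁻ x, 4 * (a x ^ 2 + b x ^ 2) :=
        lintegral_mono fun x => (ennreal_add_pow_le _ _ 2).trans_eq (by norm_num)
    _ = 4 * ((∫⁻ x, a x ^ 2) + ∫⁻ x, b x ^ 2) := by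
        rw [lintegral_const_mul' _ _ (by simp), lintegral_add_left (ha.pow_const 2)]
    _ ≤ _ := by gcongr

lemma enorm_le_ofReal_bound {f : Plane → ℂ} {K : ℝ} (hK : ∀ x, ‖f x‖ ≤ K) (x : Plane) :
    ‖f x‖ₑ ≤ ENNReal.ofReal K := by
  rw [← ofReal_norm]
  exact ENNReal.ofReal_le_ofReal (hK x)

/-- For products, use the Leibniz rule for differences and bound the undifferenced factor in the
supremum norm. Translations need neither derivatives nor continuity, so the argument applies to
merely bounded solutions. -/
lemma isGoodClass_hasLipschitzModulus : IsGoodClass HasLipschitzModulus where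
  mul := by
    rintro f g hf hg ⟨C, hC, hfC⟩ ⟨D, hD, hgD⟩
    obtain ⟨K, hK⟩ := hf.bdd
    obtain ⟨L, hL⟩ := hg.bdd
    refine ⟨4 * (C * ENNReal.ofReal L ^ 2 + ENNReal.ofReal K ^ 2 * D), by finiteness, fun h => ?_⟩
    have mfh : Measurable fun x => f (x + h) - f x :=
      (hf.measurable.comp (measurable_add_const h)).sub hf.measurable
    have mgh : Measurable fun x => g (x + h) - g x :=
      (hg.measurable.comp (measurable_add_const h)).sub hg.measurable
    calc ∫⁻ x, ‖f (x + h) * g (x + h) - f x * g x‖ₑ ^ 2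
        ≤ ∫⁻ x, (‖f (x + h) - f x‖ₑ * ENNReal.ofReal L +
            ENNReal.ofReal K * ‖g (x + h) - g x‖ₑ) ^ 2 := by
          refine lintegral_mono fun x => ?_
          have e : f (x + h) * g (x + h) - f x * g x =
            (f (x + h) - f x) * g (x + h) + f x * (g (x + h) - g x) := by ring
          simp only [e]
          gcongr
          refine (enorm_add_le _ _).trans ?_
          rw [enorm_mul, enorm_mul]
          gcongr
          · exact enorm_le_ofReal_bound hL _
          · exact enorm_le_ofReal_bound hK _
      _ ≤ 4 * (C * ‖h‖ₑ ^ 2 * ENNReal.ofReal L ^ 2 + ENNReal.ofReal K ^ 2 * (D * ‖h‖ₑ ^ 2)) := by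
          refine lintegral_add_sq_le (mfh.enorm.mul_const _) ?_ ?_
          · simp only [mul_pow]
            rw [lintegral_mul_const' _ _ (by finiteness)]
            gcongr
            exact hfC h
          · simp only [mul_pow]
            rw [lintegral_const_mul' _ _ (by finiteness)]
            gcongr
            exact hgD h
      _ = _ := by ring
  add := by
    rintro f g hf hg ⟨C, hC, hfC⟩ ⟨D, hD, hgD⟩
    refine ⟨4 * (C + D), by finiteness, fun h => ?_⟩
    have mfh : Measurable fun x => f (x + h) - f x :=
      (hf.measurable.comp (measurable_add_const h)).sub hf.measurable
    calc ∫⁻ x, ‖f (x + h) + g (x + h) - (f x + g x)‖ₑ ^ 2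
        ≤ ∫⁻ x, (‖f (x + h) - f x‖ₑ + ‖g (x + h) - g x‖ₑ) ^ 2 := by
          refine lintegral_mono fun x => ?_
          simp only [add_sub_add_comm]
          gcongr
          exact enorm_add_le _ _
      _ ≤ 4 * (C * ‖h‖ₑ ^ 2 + D * ‖h‖ₑ ^ 2) := lintegral_add_sq_le mfh.enorm (hfC h) (hgD h)
      _ = _ := by ring
  const_mul := by
    rintro f c hf ⟨C, hC, hfC⟩
    refine ⟨‖c‖ₑ ^ 2 * C, by finiteness, fun h => ?_⟩
    simp only [← mul_sub, enorm_mul, mul_pow]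
    rw [lintegral_const_mul' _ _ (by finiteness), mul_assoc]
    gcongr
    exact hfC h
  conj := by
    rintro f hf ⟨C, hC, hfC⟩
    refine ⟨C, hC, fun h => ?_⟩
    simp only [← map_sub, RCLike.enorm_conj]
    exact hfC h

lemma fourier_sub_translate {f : Plane → ℂ} (hf : BddCompact f) (h ξ : Plane) :
    𝓕 (fun x => f (x + h) - f x) ξ =
      (Complex.exp (Complex.I * ((2 * Real.pi * inner ℝ h ξ : ℝ) : ℂ)) - 1) * 𝓕 f ξ := by
  have h1 : Integrable fun x => f (x + h) := hf.integrable.comp_add_right h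
  have : 𝓕 (fun x => f (x + h) - f x) ξ = 𝓕 (fun x => f (x + h)) ξ - 𝓕 f ξ := by
    simp only [Real.fourier_eq]
    rw [← integral_sub]
    · simp only [smul_sub]
    · exact (Real.fourierIntegral_convergent_iff _).2 h1
    · exact (Real.fourierIntegral_convergent_iff _).2 hf.integrable
  rw [this, fourier_comp_add_right]
  ring

lemma lintegral_translate_sub_sq {f : Plane → ℂ} (hf : BddCompact f) (h : Plane) :
    ∫⁻ x, ‖f (x + h) - f x‖ₑ ^ 2 =
      ∫⁻ ξ, ‖Complex.exp (Complex.I * ((2 * Real.pi * inner ℝ h ξ : ℝ) : ℂ)) - 1‖ₑ ^ 2 *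
        ‖𝓕 f ξ‖ₑ ^ 2 := by
  have m2 : MemLp (fun x => f (x + h) - f x) 2 volume :=
    ((hf.memLp 2).comp_measurePreserving (measurePreserving_add_right volume h)).sub (hf.memLp 2)
  have i2 : Integrable fun x => f (x + h) - f x :=
    (hf.integrable.comp_add_right h).sub hf.integrable
  rw [← lintegral_enorm_fourier_sq i2 m2]
  simp only [fourier_sub_translate hf, enorm_mul, mul_pow]

/-- Plancherel turns the translation difference into the multiplier `e^{iθ} - 1`, and `|e^{iθ} - 1|
≤ |θ|`. -/
lemma hasLipschitzModulus_of_fourier {f : Plane → ℂ} (hf : BddCompact f)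
    (h : ∫⁻ ξ, ‖ξ‖ₑ ^ 2 * ‖𝓕 f ξ‖ₑ ^ 2 ≠ ⊤) : HasLipschitzModulus f := by
  refine ⟨ENNReal.ofReal (2 * Real.pi) ^ 2 * ∫⁻ ξ, ‖ξ‖ₑ ^ 2 * ‖𝓕 f ξ‖ₑ ^ 2, by finiteness,
    fun y => ?_⟩
  rw [lintegral_translate_sub_sq hf, mul_right_comm, ← lintegral_const_mul' _ _ (by finiteness)]
  refine lintegral_mono fun ξ => ?_
  rw [← mul_assoc, ← mul_pow (ENNReal.ofReal _), ← mul_pow (_ * _) ‖ξ‖ₑ]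
  gcongr ?_ ^ 2 * _
  refine (Real.enorm_exp_I_mul_ofReal_sub_one_le).trans ?_
  rw [← ofReal_norm, ← ofReal_norm, ← ofReal_norm, ← ENNReal.ofReal_mul (by positivity),
    ← ENNReal.ofReal_mul (by positivity)]
  refine ENNReal.ofReal_le_ofReal ?_
  rw [norm_mul, Real.norm_of_nonneg (by positivity), mul_assoc (2 * Real.pi)]
  gcongr
  exact norm_inner_le_norm (𝕜 := ℝ) y ξ

/-- The converse in the direction `e`: the difference quotients have multipliers `(e^{2πi c e·ξ} -
1)/c`, converging to `2πi e·ξ` as `c → 0`. Fatou's lemma transfers their uniform bound to the limit,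
and the factor `2π ≥ 1` is dropped. -/
lemma lintegral_inner_sq_mul_le {f : Plane → ℂ} (hf : BddCompact f) {C : ℝ≥0∞}
    (hC : ∀ h : Plane, ∫⁻ x, ‖f (x + h) - f x‖ₑ ^ 2 ≤ C * ‖h‖ₑ ^ 2) (e : Plane) :
    ∫⁻ ξ, ‖inner ℝ e ξ‖ₑ ^ 2 * ‖𝓕 f ξ‖ₑ ^ 2 ≤ C * ‖e‖ₑ ^ 2 := by
  set c : ℕ → ℝ := fun n => (n + 1 : ℝ)⁻¹ with hc
  have hc0 : ∀ n, c n ≠ 0 := fun n => by positivity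
  set q : ℕ → Plane → ℂ := fun n ξ => (c n)⁻¹ •
    (Complex.exp (Complex.I * ((2 * Real.pi * inner ℝ (c n • e) ξ : ℝ) : ℂ)) - 1) with hq
  have mF : Measurable (𝓕 f) := (continuous_fourier hf.integrable).measurable
  have mq : ∀ n, Measurable (q n) := fun n => by
    refine Continuous.measurable ?_
    fun_prop
  have hbd : ∀ n, ∫⁻ ξ, ‖q n ξ‖ₑ ^ 2 * ‖𝓕 f ξ‖ₑ ^ 2 ≤ C * ‖e‖ₑ ^ 2 := fun n => by
    have h := hC (c n • e)
    rw [lintegral_translate_sub_sq hf] at h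
    simp only [hq, enorm_smul, mul_pow, mul_assoc]
    rw [lintegral_const_mul' _ _ (by finiteness)]
    calc _ ≤ ‖(c n)⁻¹‖ₑ ^ 2 * (C * ‖c n • e‖ₑ ^ 2) := by
          gcongr
          simpa only [mul_assoc] using h
      _ = C * (‖(c n)⁻¹ * c n‖ₑ ^ 2 * ‖e‖ₑ ^ 2) := by
          rw [enorm_smul, enorm_mul]; ring
      _ = _ := by rw [inv_mul_cancel₀ (hc0 n)]; simp
  have hlim : ∀ ξ, Filter.Tendsto (fun n => q n ξ) Filter.atTop
      (nhds (Complex.I * ((2 * Real.pi * inner ℝ e ξ : ℝ) : ℂ))) := fun ξ => by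
    set θ : ℂ := Complex.I * ((2 * Real.pi * inner ℝ e ξ : ℝ) : ℂ) with hθ
    have hd : HasDerivAt (fun t : ℝ => Complex.exp ((t : ℂ) * θ)) θ 0 := by
      have h1 : HasDerivAt (fun t : ℝ => (t : ℂ) * θ) (1 * θ) 0 :=
        (Complex.ofRealCLM.hasDerivAt (x := (0 : ℝ))).mul_const θ
      simpa using h1.cexp
    have hct : Filter.Tendsto c Filter.atTop (nhdsWithin 0 {0}ᶜ) := by
      refine tendsto_nhdsWithin_iff.2 ⟨?_, Filter.Eventually.of_forall fun n => hc0 n⟩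
      simpa [hc] using tendsto_one_div_add_atTop_nhds_zero_nat (𝕜 := ℝ)
    refine (hd.tendsto_slope_zero.comp hct).congr fun n => ?_
    simp only [Function.comp_apply, hq, zero_add, Complex.ofReal_zero, zero_mul, Complex.exp_zero]
    congr 3
    rw [hθ, inner_smul_left]
    push_cast
    simp
    ring
  calc ∫⁻ ξ, ‖inner ℝ e ξ‖ₑ ^ 2 * ‖𝓕 f ξ‖ₑ ^ 2
      ≤ ∫⁻ ξ, Filter.liminf (fun n => ‖q n ξ‖ₑ ^ 2 * ‖𝓕 f ξ‖ₑ ^ 2) Filter.atTop := by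
        refine lintegral_mono fun ξ => ?_
        have ht := ENNReal.Tendsto.mul_const (b := ‖𝓕 f ξ‖ₑ ^ 2)
          (((ENNReal.continuous_pow 2).tendsto _).comp (hlim ξ).enorm) (Or.inr (by finiteness))
        refine le_trans ?_ (ht.liminf_eq).ge
        gcongr
        rw [← ofReal_norm, ← ofReal_norm]
        refine ENNReal.ofReal_le_ofReal ?_
        rw [norm_mul, Complex.norm_I, one_mul, Complex.norm_real, norm_mul,
          Real.norm_of_nonneg (by positivity : 0 ≤ 2 * Real.pi)]
        exact le_mul_of_one_le_left (norm_nonneg _) (by linarith [Real.pi_gt_three])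
    _ ≤ Filter.liminf (fun n => ∫⁻ ξ, ‖q n ξ‖ₑ ^ 2 * ‖𝓕 f ξ‖ₑ ^ 2) Filter.atTop :=
        lintegral_liminf_le fun n => ((mq n).enorm.pow_const 2).mul (mF.enorm.pow_const 2)
    _ ≤ _ := Filter.liminf_le_of_le ⟨0, by simp⟩ fun b hb => by
        obtain ⟨n, hn⟩ := hb.exists
        exact hn.trans (hbd n)

lemma lintegral_norm_sq_mul_fourier_ne_top {f : Plane → ℂ} (hf : BddCompact f)
    (h : HasLipschitzModulus f) : ∫⁻ ξ, ‖ξ‖ₑ ^ 2 * ‖𝓕 f ξ‖ₑ ^ 2 ≠ ⊤ := by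
  obtain ⟨C, hC, hle⟩ := h
  have h0 := lintegral_inner_sq_mul_le hf hle (EuclideanSpace.single 0 1)
  have h1 := lintegral_inner_sq_mul_le hf hle (EuclideanSpace.single 1 1)
  have e : ∀ ξ : Plane, ‖ξ‖ₑ ^ 2 * ‖𝓕 f ξ‖ₑ ^ 2 =
      ‖inner ℝ (EuclideanSpace.single (0 : Fin 2) (1 : ℝ)) ξ‖ₑ ^ 2 * ‖𝓕 f ξ‖ₑ ^ 2 +
      ‖inner ℝ (EuclideanSpace.single (1 : Fin 2) (1 : ℝ)) ξ‖ₑ ^ 2 * ‖𝓕 f ξ‖ₑ ^ 2 := fun ξ => by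
    rw [← add_mul, ← ofReal_norm, ← ofReal_norm (inner ℝ _ ξ), ← ofReal_norm (inner ℝ _ ξ),
      ← ENNReal.ofReal_pow (norm_nonneg _), ← ENNReal.ofReal_pow (norm_nonneg _),
      ← ENNReal.ofReal_pow (norm_nonneg _), ← ENNReal.ofReal_add (by positivity) (by positivity),
      EuclideanSpace.norm_sq_eq]
    simp [EuclideanSpace.inner_single_left]
  have mF : Measurable (𝓕 f) := (continuous_fourier hf.integrable).measurable
  have ms : Measurable fun ξ : Plane => inner ℝ (EuclideanSpace.single (0 : Fin 2) (1 : ℝ)) ξ :=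
    (continuous_const.inner continuous_id).measurable
  have mp : Measurable fun ξ : Plane =>
      ‖inner ℝ (EuclideanSpace.single (0 : Fin 2) (1 : ℝ)) ξ‖ₑ ^ 2 * ‖𝓕 f ξ‖ₑ ^ 2 :=
    (ms.enorm.pow_const 2).mul (mF.enorm.pow_const 2)
  rw [lintegral_congr e, lintegral_add_left mp]
  exact ENNReal.add_ne_top.2 ⟨ne_top_of_le_ne_top (by finiteness) h0,
    ne_top_of_le_ne_top (by finiteness) h1⟩

/-! ### Weighted integrability of the Fourier transform -/

/-- Integrability of the Fourier transform against `(1 + |ξ|)ᵏ`. -/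
def HasFourierMoment (k : ℕ) (f : Plane → ℂ) : Prop :=
  ∫⁻ ξ, (1 + ‖ξ‖ₑ) ^ k * ‖𝓕 f ξ‖ₑ ≠ ⊤

lemma fourier_add_eq {f g : Plane → ℂ} (hf : Integrable f) (hg : Integrable g) (ξ : Plane) :
    𝓕 (fun x => f x + g x) ξ = 𝓕 f ξ + 𝓕 g ξ := by
  simp only [Real.fourier_eq]
  rw [← integral_add]
  · simp only [smul_add]
  · exact (Real.fourierIntegral_convergent_iff _).2 hf
  · exact (Real.fourierIntegral_convergent_iff _).2 hg

lemma fourier_const_mul_eq (c : ℂ) (f : Plane → ℂ) (ξ : Plane) :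
    𝓕 (fun x => c * f x) ξ = c * 𝓕 f ξ := by
  simp only [Real.fourier_eq]
  rw [← integral_const_mul]
  refine integral_congr_ae (Filter.Eventually.of_forall fun x => ?_)
  simp only [Circle.smul_def, smul_eq_mul]
  ring

lemma BddCompact.measurable_fourier {f : Plane → ℂ} (hf : BddCompact f) : Measurable (𝓕 f) :=
  (continuous_fourier hf.integrable).measurable

lemma measurable_moment {f : Plane → ℂ} (hf : BddCompact f) (k : ℕ) :
    Measurable fun ξ : Plane => (1 + ‖ξ‖ₑ) ^ k * ‖𝓕 f ξ‖ₑ :=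
  ((measurable_const.add measurable_enorm).pow_const k).mul hf.measurable_fourier.enorm

lemma HasFourierMoment.integrable {k : ℕ} {f : Plane → ℂ} (h : HasFourierMoment k f)
    (hf : BddCompact f) : Integrable (𝓕 f) := by
  refine integrable_of_lintegral_enorm_ne_top hf.measurable_fourier.aestronglyMeasurable
    (ne_top_of_le_ne_top h (lintegral_mono fun ξ => ?_))
  exact le_mul_of_one_le_left' (one_le_pow₀ le_self_add)

/-- The weight is submultiplicative, `1 + |ξ| ≤ (1 + |ξ - η|)(1 + |η|)`, so the weighted `L¹` space
is an algebra under convolution, which is multiplication on the physical side. Conjugation only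
reflects the modulus of the transform. -/
lemma isGoodClass_hasFourierMoment (k : ℕ) : IsGoodClass (HasFourierMoment k) where
  mul := by
    intro f g hf hg pf pg
    have mf := measurable_moment hf k
    have mg := measurable_moment hg k
    refine ne_top_of_le_ne_top (ENNReal.mul_ne_top pf pg) ?_
    calc ∫⁻ ξ, (1 + ‖ξ‖ₑ) ^ k * ‖𝓕 (fun x => f x * g x) ξ‖ₑ
        ≤ ∫⁻ ξ, ∫⁻ η, ((1 + ‖ξ - η‖ₑ) ^ k * ‖𝓕 f (ξ - η)‖ₑ) * ((1 + ‖η‖ₑ) ^ k * ‖𝓕 g η‖ₑ) := by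
          refine lintegral_mono fun ξ => ?_
          simp only
          rw [fourier_mul_eq hf.integrable hg.integrable (pg.integrable hg)]
          refine (mul_le_mul' le_rfl (enorm_integral_le_lintegral_enorm _)).trans ?_
          rw [← lintegral_const_mul' _ _ (by finiteness)]
          refine lintegral_mono fun η => ?_
          rw [enorm_mul, mul_mul_mul_comm, ← mul_pow]
          gcongr
          calc 1 + ‖ξ‖ₑ ≤ 1 + (‖ξ - η‖ₑ + ‖η‖ₑ) := by
                gcongr
                simpa using enorm_add_le (ξ - η) η
            _ ≤ 1 + (‖ξ - η‖ₑ + ‖η‖ₑ) + ‖ξ - η‖ₑ * ‖η‖ₑ := le_self_add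
            _ = _ := by ring
      _ = ∫⁻ η, ∫⁻ ξ, ((1 + ‖ξ - η‖ₑ) ^ k * ‖𝓕 f (ξ - η)‖ₑ) * ((1 + ‖η‖ₑ) ^ k * ‖𝓕 g η‖ₑ) := by
          refine lintegral_lintegral_swap (Measurable.aemeasurable ?_)
          exact (mf.comp (measurable_fst.sub measurable_snd)).mul (mg.comp measurable_snd)
      _ = _ := by
          have : ∀ η : Plane, ∫⁻ ξ, ((1 + ‖ξ - η‖ₑ) ^ k * ‖𝓕 f (ξ - η)‖ₑ) *
              ((1 + ‖η‖ₑ) ^ k * ‖𝓕 g η‖ₑ) =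
              (∫⁻ ξ, (1 + ‖ξ‖ₑ) ^ k * ‖𝓕 f ξ‖ₑ) * ((1 + ‖η‖ₑ) ^ k * ‖𝓕 g η‖ₑ) := fun η => by
            rw [lintegral_mul_const' _ _ (by finiteness)]
            congr 1
            exact lintegral_sub_right_eq_self (fun ξ : Plane => (1 + ‖ξ‖ₑ) ^ k * ‖𝓕 f ξ‖ₑ) η
          simp only [this]
          rw [lintegral_const_mul _ mg]
  add := by
    intro f g hf hg pf pg
    refine ne_top_of_le_ne_top (ENNReal.add_ne_top.2 ⟨pf, pg⟩) ?_
    rw [← lintegral_add_left (measurable_moment hf k)]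
    refine lintegral_mono fun ξ => ?_
    simp only
    rw [fourier_add_eq hf.integrable hg.integrable, ← mul_add]
    gcongr
    exact enorm_add_le _ _
  const_mul := by
    intro f c hf pf
    unfold HasFourierMoment
    simp only [fourier_const_mul_eq, enorm_mul, mul_left_comm _ ‖c‖ₑ]
    rw [lintegral_const_mul' _ _ (by finiteness)]
    exact ENNReal.mul_ne_top (by finiteness) pf
  conj := by
    intro f hf pf
    unfold HasFourierMoment
    simp only [fourier_conj, RCLike.enorm_conj]
    refine ne_of_eq_of_ne ?_ pf
    rw [← (Measure.measurePreserving_neg (volume : Measure Plane)).lintegral_comp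
      (measurable_moment hf k)]
    simp only [enorm_neg]

lemma ennreal_mul_le_sq_add_sq (a b : ℝ≥0∞) : a * b ≤ a ^ 2 + b ^ 2 := by
  rcases le_total a b with h | h
  · calc a * b ≤ b * b := by gcongr
      _ ≤ _ := by rw [← sq]; exact le_add_self
  · calc a * b ≤ a * a := by gcongr
      _ ≤ _ := by rw [← sq]; exact le_self_add

/-- Factor out `(1 + |ξ|)^(-2)`, which is square integrable in dimension two. This is why two
derivatives in `L²` are needed before integrability of the transform is available. -/
lemma hasFourierMoment_zero {f : Plane → ℂ} (hf : BddCompact f)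
    (h : ∫⁻ ξ, ‖ξ‖ₑ ^ 4 * ‖𝓕 f ξ‖ₑ ^ 2 ≠ ⊤) : HasFourierMoment 0 f := by
  have hint : ∫⁻ ξ : Plane, (((1 + ‖ξ‖ₑ) ^ 2)⁻¹) ^ 2 ≠ ⊤ := by
    have hi : Integrable (fun ξ : Plane => (1 + ‖ξ‖) ^ (-4 : ℝ)) :=
      integrable_one_add_norm (by simp; norm_num)
    refine ne_of_eq_of_ne (lintegral_congr fun ξ => ?_) hi.2.ne
    rw [← ofReal_norm ξ, ← ENNReal.ofReal_one, ← ENNReal.ofReal_add zero_le_one (norm_nonneg _),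
      ← ENNReal.ofReal_pow (by positivity), ← ENNReal.ofReal_inv_of_pos (by positivity),
      ← ENNReal.ofReal_pow (by positivity), Real.enorm_of_nonneg (by positivity)]
    congr 1
    simp only
    rw [Real.rpow_neg (by positivity), inv_pow, ← pow_mul]
    norm_cast
  have h2 := hf.lintegral_enorm_fourier_sq_ne_top
  have mF := hf.measurable_fourier
  have hle : ∀ ξ : Plane, (1 + ‖ξ‖ₑ) ^ 0 * ‖𝓕 f ξ‖ₑ ≤
      2 ^ 4 * (‖𝓕 f ξ‖ₑ ^ 2 + ‖ξ‖ₑ ^ 4 * ‖𝓕 f ξ‖ₑ ^ 2) + (((1 + ‖ξ‖ₑ) ^ 2)⁻¹) ^ 2 := fun ξ => by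
    have e : ‖𝓕 f ξ‖ₑ = ((1 + ‖ξ‖ₑ) ^ 2 * ‖𝓕 f ξ‖ₑ) * ((1 + ‖ξ‖ₑ) ^ 2)⁻¹ := by
      rw [mul_right_comm, ENNReal.mul_inv_cancel (by positivity) (by finiteness), one_mul]
    rw [pow_zero, one_mul]
    nth_rw 1 [e]
    refine (ennreal_mul_le_sq_add_sq _ _).trans ?_
    gcongr
    calc ((1 + ‖ξ‖ₑ) ^ 2 * ‖𝓕 f ξ‖ₑ) ^ 2 = (1 + ‖ξ‖ₑ) ^ 4 * ‖𝓕 f ξ‖ₑ ^ 2 := by ring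
      _ ≤ (2 ^ 4 * (1 ^ 4 + ‖ξ‖ₑ ^ 4)) * ‖𝓕 f ξ‖ₑ ^ 2 := by
        gcongr
        exact ennreal_add_pow_le 1 ‖ξ‖ₑ 4
      _ = _ := by ring
  refine ne_top_of_le_ne_top ?_ (lintegral_mono hle)
  have m1 : Measurable fun ξ : Plane => ‖𝓕 f ξ‖ₑ ^ 2 := mF.enorm.pow_const 2
  have m2 : Measurable fun ξ : Plane => ‖ξ‖ₑ ^ 4 * ‖𝓕 f ξ‖ₑ ^ 2 :=
    (measurable_enorm.pow_const 4).mul m1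
  have m3 : Measurable fun ξ : Plane =>
      2 ^ 4 * (‖𝓕 f ξ‖ₑ ^ 2 + ‖ξ‖ₑ ^ 4 * ‖𝓕 f ξ‖ₑ ^ 2) := (m1.add m2).const_mul _
  rw [lintegral_add_left m3, lintegral_const_mul' _ _ (by finiteness), lintegral_add_left m1]
  finiteness

lemma enorm_mul_fourier_le {u G : Plane → ℂ} {ξ : Plane}
    (h : 2 * Real.pi * ‖ξ‖ * ‖𝓕 u ξ‖ = ‖𝓕 G ξ‖) : ‖ξ‖ₑ * ‖𝓕 u ξ‖ₑ ≤ ‖𝓕 G ξ‖ₑ := by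
  rw [← ofReal_norm, ← ofReal_norm, ← ofReal_norm, ← ENNReal.ofReal_mul (norm_nonneg _)]
  refine ENNReal.ofReal_le_ofReal ?_
  rw [← h, mul_assoc]
  exact le_mul_of_one_le_left (by positivity) (by linarith [Real.pi_gt_three])

/-! ### Bootstrap from bounded to smooth solutions -/

/-- The properties needed of a localized solution `u` and of the right hand side `G` of its
equation. -/
structure IsLocalized (u G : Plane → ℂ) : Prop where
  left : BddCompact u
  right : BddCompact G
  fourier : ∀ ξ, ‖ξ‖ₑ * ‖𝓕 u ξ‖ₑ ≤ ‖𝓕 G ξ‖ₑ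

lemma WeakDbar.isLocalized {v F : Plane → ℂ} (h : WeakDbar v F) (mv : Measurable v)
    (mF : Measurable F) {K L : ℝ} (kv : ∀ x, ‖v x‖ ≤ K) (kF : ∀ x, ‖F x‖ ≤ L) {η : Plane → ℂ}
    (hη : ContDiff ℝ ∞ η) (hc : HasCompactSupport η) :
    IsLocalized (fun x => η x * v x) (fun x => η x * F x + (-1) * (dbar η x * v x)) where
  left := (BddCompact.of_continuous hη.continuous hc).mul_bdd mv kv
  right := ((BddCompact.of_continuous hη.continuous hc).mul_bdd mF kF).add
    (((BddCompact.of_continuous (continuous_dbar (hη.of_le (by simp)))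
      (hasCompactSupport_dbar hc)).mul_bdd mv kv).const_mul (-1))
  fourier ξ := enorm_mul_fourier_le (h.fourier_eq mv mF kv kF hη hc ξ)

lemma IsLocalized.hasLipschitzModulus {u G : Plane → ℂ} (h : IsLocalized u G) :
    HasLipschitzModulus u := by
  refine hasLipschitzModulus_of_fourier h.left
    (ne_top_of_le_ne_top h.right.lintegral_enorm_fourier_sq_ne_top (lintegral_mono fun ξ => ?_))
  rw [← mul_pow]
  gcongr
  exact h.fourier ξ

lemma IsLocalized.hasFourierMoment_zero {u G : Plane → ℂ} (h : IsLocalized u G)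
    (hG : HasLipschitzModulus G) : HasFourierMoment 0 u := by
  refine CriticalDirac.hasFourierMoment_zero h.left (ne_top_of_le_ne_top
    (lintegral_norm_sq_mul_fourier_ne_top h.right hG) (lintegral_mono fun ξ => ?_))
  calc ‖ξ‖ₑ ^ 4 * ‖𝓕 u ξ‖ₑ ^ 2 = ‖ξ‖ₑ ^ 2 * (‖ξ‖ₑ * ‖𝓕 u ξ‖ₑ) ^ 2 := by ring
    _ ≤ _ := by gcongr; exact h.fourier ξ

lemma IsLocalized.hasFourierMoment_succ {u G : Plane → ℂ} (h : IsLocalized u G) {k : ℕ}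
    (hu : HasFourierMoment k u) (hG : HasFourierMoment k G) : HasFourierMoment (k + 1) u := by
  refine ne_top_of_le_ne_top (ENNReal.add_ne_top.2 ⟨hu, hG⟩) ?_
  rw [← lintegral_add_left (measurable_moment h.left k)]
  refine lintegral_mono fun ξ => ?_
  calc (1 + ‖ξ‖ₑ) ^ (k + 1) * ‖𝓕 u ξ‖ₑ =
      (1 + ‖ξ‖ₑ) ^ k * ‖𝓕 u ξ‖ₑ + (1 + ‖ξ‖ₑ) ^ k * (‖ξ‖ₑ * ‖𝓕 u ξ‖ₑ) := by ring
    _ ≤ _ := by gcongr; exact h.fourier ξ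

section System

variable {β₁ β₂ : ℝ} {v₁ v₂ : Plane → ℂ} {K : ℝ}

/-- A good class containing the localizations of a bounded solution contains the right
hand sides of the localized equations. -/
lemma IsGoodClass.rhs {P : (Plane → ℂ) → Prop} (hP : IsGoodClass P)
    (m₁ : Measurable v₁) (m₂ : Measurable v₂) (k₁ : ∀ x, ‖v₁ x‖ ≤ K) (k₂ : ∀ x, ‖v₂ x‖ ≤ K)
    (h₁ : ∀ η : Plane → ℂ, ContDiff ℝ ∞ η → HasCompactSupport η → P fun x => η x * v₁ x)
    (h₂ : ∀ η : Plane → ℂ, ContDiff ℝ ∞ η → HasCompactSupport η → P fun x => η x * v₂ x)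
    (c : ℂ) {η : Plane → ℂ} (hη : ContDiff ℝ ∞ η) (hc : HasCompactSupport η)
    {L : ℝ} (kF : ∀ x, ‖c * cubic β₁ β₂ (v₁ x) (v₂ x)‖ ≤ L) :
    P fun x => η x * (c * cubic β₁ β₂ (v₁ x) (v₂ x)) + (-1) * (dbar η x * v₁ x) := by
  have hdη : ContDiff ℝ ∞ (dbar η) := contDiff_dbar hη
  have e : (fun x => η x * (c * cubic β₁ β₂ (v₁ x) (v₂ x))) =
      fun x => (c * η x) * cubic β₁ β₂ (v₁ x) (v₂ x) := by
    funext x; ring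
  have b1 : BddCompact fun x => η x * (c * cubic β₁ β₂ (v₁ x) (v₂ x)) :=
    (BddCompact.of_continuous hη.continuous hc).mul_bdd ((m₁.cubic m₂).const_mul c) kF
  have b2 : BddCompact fun x => dbar η x * v₁ x :=
    (BddCompact.of_continuous hdη.continuous (hasCompactSupport_dbar hc)).mul_bdd m₁ k₁
  refine hP.add b1 (b2.const_mul (-1)) ?_ (hP.const_mul (-1) b2
    (h₁ _ hdη (hasCompactSupport_dbar hc)))
  rw [e]
  exact hP.mul_cubic β₁ β₂ m₁ m₂ k₁ k₂ h₁ h₂ (contDiff_const.mul hη) hc.mul_left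

/-- Each round enters the right hand side of the localized equation, which contains `dbar η` and
hence a new cutoff; the induction therefore runs over all cutoffs at once. The base case uses the
Lipschitz class twice over: solutions belong to it, therefore the right hand sides do, and the
equation gains the second derivative. -/
theorem IsWeakSystem.hasFourierMoment (h : IsWeakSystem β₁ β₂ v₁ v₂)
    (m₁ : Measurable v₁) (m₂ : Measurable v₂) (k₁ : ∀ x, ‖v₁ x‖ ≤ K) (k₂ : ∀ x, ‖v₂ x‖ ≤ K)
    (k : ℕ) (η : Plane → ℂ) (hη : ContDiff ℝ ∞ η) (hc : HasCompactSupport η) :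
    HasFourierMoment k (fun x => η x * v₁ x) ∧ HasFourierMoment k (fun x => η x * v₂ x) := by
  obtain ⟨L, hL⟩ : ∃ L : ℝ, ∀ a b : ℂ, ‖a‖ ≤ K → ‖b‖ ≤ K → ‖cubic β₁ β₂ a b‖ ≤ L := by
    refine ⟨(|β₁| * K ^ 2 + 2 * |β₂| * K ^ 2) * K, fun a b ha hb => ?_⟩
    rw [cubic, norm_mul, RCLike.norm_conj, Complex.norm_real, Real.norm_eq_abs]
    gcongr
    refine (abs_add_le _ _).trans ?_
    simp only [abs_mul, abs_pow, abs_norm, Nat.abs_ofNat]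
    gcongr
  have kF₁ : ∀ x, ‖-Complex.I * cubic β₁ β₂ (v₁ x) (v₂ x)‖ ≤ L := fun x => by
    simpa using hL _ _ (k₁ x) (k₂ x)
  have kF₂ : ∀ x, ‖Complex.I * cubic β₁ β₂ (v₂ x) (v₁ x)‖ ≤ L := fun x => by
    simpa using hL _ _ (k₂ x) (k₁ x)
  have loc₁ := fun (η : Plane → ℂ) (hη : ContDiff ℝ ∞ η) (hc : HasCompactSupport η) =>
    h.1.isLocalized m₁ ((m₁.cubic m₂).const_mul _) k₁ kF₁ hη hc
  have loc₂ := fun (η : Plane → ℂ) (hη : ContDiff ℝ ∞ η) (hc : HasCompactSupport η) =>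
    h.2.isLocalized m₂ ((m₂.cubic m₁).const_mul _) k₂ kF₂ hη hc
  induction k generalizing η with
  | zero =>
    have g := isGoodClass_hasLipschitzModulus
    have l₁ := fun η hη hc => (loc₁ η hη hc).hasLipschitzModulus
    have l₂ := fun η hη hc => (loc₂ η hη hc).hasLipschitzModulus
    exact ⟨(loc₁ η hη hc).hasFourierMoment_zero (g.rhs m₁ m₂ k₁ k₂ l₁ l₂ _ hη hc kF₁),
      (loc₂ η hη hc).hasFourierMoment_zero (g.rhs m₂ m₁ k₂ k₁ l₂ l₁ _ hη hc kF₂)⟩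
  | succ k ih =>
    have g := isGoodClass_hasFourierMoment k
    have l₁ := fun η hη hc => (ih η hη hc).1
    have l₂ := fun η hη hc => (ih η hη hc).2
    exact ⟨(loc₁ η hη hc).hasFourierMoment_succ (l₁ η hη hc)
        (g.rhs m₁ m₂ k₁ k₂ l₁ l₂ _ hη hc kF₁),
      (loc₂ η hη hc).hasFourierMoment_succ (l₂ η hη hc)
        (g.rhs m₂ m₁ k₂ k₁ l₂ l₁ _ hη hc kF₂)⟩

end System

lemma exists_contDiff_of_hasFourierMoment {f : Plane → ℂ} (hf : BddCompact f)
    (h : ∀ k, HasFourierMoment k f) : ∃ g : Plane → ℂ, ContDiff ℝ ∞ g ∧ ∀ᵐ x, f x = g x := by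
  refine ⟨fun x => 𝓕 (𝓕 f) (-x), ?_, ?_⟩
  · have : ContDiff ℝ ∞ (𝓕 (𝓕 f)) := Real.contDiff_fourier fun n _ => by
      have hm : Measurable fun ξ : Plane => ‖ξ‖ ^ n * ‖𝓕 f ξ‖ :=
        (measurable_norm.pow_const n).mul hf.measurable_fourier.norm
      refine ⟨hm.aestronglyMeasurable, lt_top_iff_ne_top.2 (ne_top_of_le_ne_top (h n) (lintegral_mono fun ξ => ?_))⟩
      rw [enorm_mul, enorm_pow, enorm_norm, enorm_norm]
      gcongr
      exact le_add_self
    exact this.comp contDiff_neg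
  · filter_upwards [ae_eq_fourierInv_fourier hf.integrable ((h 0).integrable hf)] with x hx
    rw [hx, Real.fourierInv_eq_fourier_neg]

/-- A function whose localizations have smooth representatives has a smooth representative. -/
lemma exists_contDiff_of_local {v : Plane → ℂ}
    (h : ∀ η : Plane → ℂ, ContDiff ℝ ∞ η → HasCompactSupport η →
      ∃ g : Plane → ℂ, ContDiff ℝ ∞ g ∧ ∀ᵐ x, η x * v x = g x) :
    ∃ g : Plane → ℂ, ContDiff ℝ ∞ g ∧ g =ᵐ[volume] v := by
  have hpos : ∀ n : ℕ, (0 : ℝ) < n + 1 := fun n => by positivity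
  choose g hg hgv using fun n : ℕ =>
    h (cutoff (n + 1)) (contDiff_cutoff _) (hasCompactSupport_cutoff (hpos n))
  have hae : ∀ n : ℕ, ∀ᵐ x, x ∈ Metric.ball (0 : Plane) (n + 1) → v x = g n x := fun n => by
    filter_upwards [hgv n] with x hx hxn
    rw [← hx, cutoff_eq_one (hpos n) (by simpa using (mem_ball_zero_iff.1 hxn).le), one_mul]
  have hcomp : ∀ m n : ℕ, m ≤ n → Set.EqOn (g m) (g n) (Metric.ball 0 (m + 1)) := by
    intro m n hmn
    refine Measure.eqOn_open_of_ae_eq (μ := volume) ?_ Metric.isOpen_ball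
      (hg m).continuous.continuousOn (hg n).continuous.continuousOn
    rw [Filter.EventuallyEq, ae_restrict_iff' measurableSet_ball]
    filter_upwards [hae m, hae n] with x h1 h2 hx
    rw [← h1 hx, ← h2 (Metric.ball_subset_ball (by simpa using hmn) hx)]
  -- The index `⌈‖x‖⌉₊` jumps with `x`, but the pieces agree on overlaps by continuity, so near each
  -- point a single fixed `g n` represents the glued function.
  have key : ∀ (n : ℕ) (x : Plane), x ∈ Metric.ball (0 : Plane) (n + 1) → g ⌈‖x‖⌉₊ x = g n x := by
    intro n x hx
    have h1 : x ∈ Metric.ball (0 : Plane) ((⌈‖x‖⌉₊ : ℝ) + 1) :=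
      mem_ball_zero_iff.2 ((Nat.le_ceil _).trans_lt (by linarith))
    rcases le_total ⌈‖x‖⌉₊ n with hn | hn
    · exact hcomp _ _ hn h1
    · exact (hcomp _ _ hn hx).symm
  refine ⟨fun x => g ⌈‖x‖⌉₊ x, contDiff_iff_contDiffAt.2 fun x => ?_, ?_⟩
  · have hx : x ∈ Metric.ball (0 : Plane) ((⌈‖x‖⌉₊ : ℝ) + 1) :=
      mem_ball_zero_iff.2 ((Nat.le_ceil _).trans_lt (by linarith))
    refine ((hg ⌈‖x‖⌉₊).contDiffAt).congr_of_eventuallyEq ?_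
    filter_upwards [Metric.isOpen_ball.mem_nhds hx] with y hy
    exact key _ y hy
  · have hall : ∀ᵐ x, ∀ n : ℕ, x ∈ Metric.ball (0 : Plane) (n + 1) → v x = g n x :=
      ae_all_iff.2 hae
    filter_upwards [hall] with x hx
    exact (hx _ (mem_ball_zero_iff.2 ((Nat.le_ceil _).trans_lt (by linarith)))).symm

/-- Weak `L⁴` solutions of the system are smooth. -/
theorem IsWeakSystem.exists_contDiff {β₁ β₂ : ℝ} {v₁ v₂ : Plane → ℂ}
    (h : IsWeakSystem β₁ β₂ v₁ v₂) (hv₁ : Measurable v₁) (hv₂ : Measurable v₂)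
    (h₁ : ∫⁻ x, ‖v₁ x‖ₑ ^ 4 ≠ ⊤) (h₂ : ∫⁻ x, ‖v₂ x‖ₑ ^ 4 ≠ ⊤) :
    ∃ w₁ w₂ : Plane → ℂ, ContDiff ℝ ∞ w₁ ∧ ContDiff ℝ ∞ w₂ ∧
      w₁ =ᵐ[volume] v₁ ∧ w₂ =ᵐ[volume] v₂ := by
  obtain ⟨u₁, u₂, e₁, e₂, m₁, m₂, K, hK⟩ := h.exists_bounded hv₁ hv₂ h₁ h₂
  have hs := (h.congr_ae e₁ e₂).hasFourierMoment m₁ m₂ (fun x => (hK x).1) (fun x => (hK x).2)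
  obtain ⟨w₁, s₁, f₁⟩ := exists_contDiff_of_local (v := u₁) fun η hη hc =>
    exists_contDiff_of_hasFourierMoment ((BddCompact.of_continuous hη.continuous hc).mul_bdd m₁
      fun x => (hK x).1) fun k => (hs k η hη hc).1
  obtain ⟨w₂, s₂, f₂⟩ := exists_contDiff_of_local (v := u₂) fun η hη hc =>
    exists_contDiff_of_hasFourierMoment ((BddCompact.of_continuous hη.continuous hc).mul_bdd m₂
      fun x => (hK x).2) fun k => (hs k η hη hc).2
  exact ⟨w₁, w₂, s₁, s₂, f₁.trans e₁, f₂.trans e₂⟩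

/-! ### Classical solutions and removable singularities -/

lemma integral_dbar_eq_zero {φ : Plane → ℂ} (hφ : ContDiff ℝ 1 φ) (hc : HasCompactSupport φ) :
    ∫ x, dbar φ x = 0 := by
  have hd : Differentiable ℝ φ := hφ.differentiable (by simp)
  have hi : ∀ e : Plane, Integrable fun x => fderiv ℝ φ x e := fun e =>
    ((hφ.continuous_fderiv (by simp)).clm_apply continuous_const).integrable_of_hasCompactSupport
      ((hc.fderiv ℝ).comp_left (g := fun L : Plane →L[ℝ] ℂ => L e) (by simp))
  have h0 : ∀ e : Plane, ∫ x, fderiv ℝ φ x e = 0 := fun e => by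
    have := integral_mul_fderiv_eq_neg_fderiv_mul_of_integrable (μ := (volume : Measure Plane))
      (f := fun _ => (1 : ℂ)) (g := φ) (v := e) (by simp) (by simpa using hi e)
      (by simpa using hφ.continuous.integrable_of_hasCompactSupport hc)
      (fun x _ => differentiableAt_const _) (fun x _ => hd x)
    simpa using this
  simp only [dbar]
  rw [integral_add (hi _) ((hi _).const_mul _), integral_const_mul, h0, h0]
  simp

/-- A smooth weak solution is a classical one. -/
lemma WeakDbar.dbar_eq {v F : Plane → ℂ} (h : WeakDbar v F) (hv : ContDiff ℝ ∞ v)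
    (hF : Continuous F) (x : Plane) : dbar v x = -F x := by
  have hv1 : ContDiff ℝ 1 v := hv.of_le (by simp)
  have hcont : Continuous fun x => dbar v x + F x := (continuous_dbar hv1).add hF
  have hae : ∀ᵐ x, dbar v x + F x = 0 := by
    refine ae_eq_zero_of_integral_contDiff_smul_eq_zero hcont.locallyIntegrable fun g hg hgc => ?_
    set φ : Plane → ℂ := fun x => (g x : ℂ) with hφdef
    have hφ : ContDiff ℝ ∞ φ := Complex.ofRealCLM.contDiff.comp hg
    have hφc : HasCompactSupport φ := hgc.comp_left (g := fun r : ℝ => (r : ℂ)) (by simp)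
    have hφ1 : ContDiff ℝ 1 φ := hφ.of_le (by simp)
    have i1 : Integrable fun x => dbar φ x * v x :=
      ((continuous_dbar hφ1).mul hv.continuous).integrable_of_hasCompactSupport
        (hasCompactSupport_dbar hφc).mul_right
    have i2 : Integrable fun x => φ x * dbar v x :=
      (hφ.continuous.mul (continuous_dbar hv1)).integrable_of_hasCompactSupport hφc.mul_right
    have i3 : Integrable fun x => φ x * F x :=
      (hφ.continuous.mul hF).integrable_of_hasCompactSupport hφc.mul_right
    have h0 := integral_dbar_eq_zero (φ := fun x => φ x * v x) (hφ1.mul hv1) hφc.mul_right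
    have e : ∀ x, dbar (fun x => φ x * v x) x = dbar φ x * v x + φ x * dbar v x := fun x =>
      dbar_mul (hφ1.differentiable (by simp) x) (hv1.differentiable (by simp) x)
    simp only [e] at h0
    rw [integral_add i1 i2, h φ hφ hφc, add_comm, ← integral_add i2 i3] at h0
    rw [← h0]
    refine integral_congr_ae (Filter.Eventually.of_forall fun x => ?_)
    simp only [hφdef, Complex.real_smul]
    ring
  have := Continuous.ae_eq_iff_eq (μ := volume) hcont (continuous_const (y := (0 : ℂ)))
  exact eq_neg_of_add_eq_zero_left (congr_fun (this.1 hae) x)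

/-- Point singularities of `L⁴` solutions are removable. -/
theorem weakDbar_of_punctured {v F : Plane → ℂ} (mv : Measurable v) (mF : Measurable F)
    (hv4 : ∫⁻ x, ‖v x‖ₑ ^ 4 ≠ ⊤) (hF : ∀ r > 0, ∫⁻ x in Metric.ball 0 r, ‖F x‖ₑ ≠ ⊤)
    (hs : ∀ x ≠ 0, ContDiffAt ℝ ∞ v x) (heq : ∀ x ≠ 0, dbar v x = -F x) : WeakDbar v F := by
  intro g hg hgc
  have hg1 : ContDiff ℝ 1 g := hg.of_le (by simp)
  set R : ℕ → ℝ := fun n => (n + 1 : ℝ)⁻¹ with hR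
  have hR0 : ∀ n, 0 < R n := fun n => by positivity
  set θ : ℕ → Plane → ℂ := fun n x => 1 - cutoff (R n) x with hθ
  have sθ : ∀ n, ContDiff ℝ ∞ (θ n) := fun n => contDiff_const.sub (contDiff_cutoff _)
  have kθ : ∀ n x, ‖θ n x‖ ≤ 2 := fun n x => by
    refine (norm_sub_le _ _).trans ?_
    have := norm_cutoff_le_one (R n) x
    rw [norm_one]; linarith
  have dθ : ∀ n x, dbar (θ n) x = -dbar (cutoff (R n)) x := fun n x => by
    simp only [dbar, hθ]
    rw [fderiv_const_sub]
    simp; ring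
  have i1 : Integrable fun x => dbar g x * v x := by
    refine integrable_of_lintegral_enorm_ne_top
      ((continuous_dbar hg1).measurable.mul mv).aestronglyMeasurable ?_
    simp only [enorm_mul]
    exact lintegral_enorm_mul_ne_top (continuous_dbar hg1) (hasCompactSupport_dbar hgc)
      fun r _ => setLIntegral_ball_ne_top_of_pow_four hv4 r
  have i2 : Integrable fun x => g x * F x := by
    refine integrable_of_lintegral_enorm_ne_top
      (hg.continuous.measurable.mul mF).aestronglyMeasurable ?_
    simp only [enorm_mul]
    exact lintegral_enorm_mul_ne_top hg.continuous hgc hF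
  obtain ⟨G, hG⟩ := hgc.exists_bound_of_continuous hg.continuous
  obtain ⟨K, hK, hKle⟩ := exists_lintegral_dbar_cutoff_mul_le mv.enorm hv4
  have mcut : ∀ n, Measurable (dbar (cutoff (R n))) := fun n =>
    (continuous_dbar ((contDiff_cutoff _).of_le (by simp))).measurable
  -- Excising a disc of radius of order `R n` costs only `O((R n)^(1/2))`, because `v` is in `L⁴`.
  -- This tends to zero with the disc, so no point mass at the origin survives.
  have hbd : ∀ n, ∫⁻ x, ‖g x * dbar (cutoff (R n)) x * v x‖ₑ ≤
      ENNReal.ofReal G * (K * ENNReal.ofReal (R n ^ (1 / 2 : ℝ))) := fun n => by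
    refine le_trans ?_ (mul_le_mul' le_rfl (hKle (R n) (hR0 n)))
    rw [← lintegral_const_mul' _ _ (by finiteness)]
    refine lintegral_mono fun x => ?_
    rw [mul_assoc, enorm_mul, enorm_mul]
    gcongr
    exact enorm_le_ofReal_bound hG x
  have i3 : ∀ n, Integrable fun x => g x * dbar (cutoff (R n)) x * v x := fun n =>
    integrable_of_lintegral_enorm_ne_top
      ((hg.continuous.measurable.mul (mcut n)).mul mv).aestronglyMeasurable
      (ne_top_of_le_ne_top (by finiteness) (hbd n))
  have hid : ∀ n, (∫ x, θ n x * (dbar g x * v x)) - (∫ x, g x * dbar (cutoff (R n)) x * v x) =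
      ∫ x, θ n x * (g x * F x) := fun n => by
    have mθ := (sθ n).continuous.aestronglyMeasurable (μ := (volume : Measure Plane))
    have j1 := i1.bdd_mul mθ (Filter.Eventually.of_forall (kθ n))
    have j2 := i2.bdd_mul mθ (Filter.Eventually.of_forall (kθ n))
    have hsm : ContDiff ℝ 1 fun x => θ n x * g x * v x := by
      refine contDiff_iff_contDiffAt.2 fun x => ?_
      rcases eq_or_ne x 0 with rfl | hx
      · refine (contDiffAt_const (c := (0 : ℂ))).congr_of_eventuallyEq ?_
        filter_upwards [Metric.ball_mem_nhds (0 : Plane) (hR0 n)] with y hy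
        simp only [hθ]
        rw [cutoff_eq_one (hR0 n) (mem_ball_zero_iff.1 hy).le]
        ring
      · exact (((sθ n).mul hg).contDiffAt.mul (hs x hx)).of_le (by simp)
    have h0 := integral_dbar_eq_zero hsm (hgc.mul_left.mul_right)
    have e : ∀ᵐ x, dbar (fun x => θ n x * g x * v x) x = θ n x * (dbar g x * v x) -
        g x * dbar (cutoff (R n)) x * v x - θ n x * (g x * F x) := by
      filter_upwards [compl_mem_ae_iff.2 (measure_singleton (0 : Plane))] with x hx
      have hx0 : x ≠ 0 := hx
      have d1 : DifferentiableAt ℝ (θ n) x := (sθ n).differentiable (by simp) x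
      have d2 : DifferentiableAt ℝ g x := hg.differentiable (by simp) x
      have d3 : DifferentiableAt ℝ (fun x => θ n x * g x) x := d1.mul d2
      rw [dbar_mul d3 ((hs x hx0).differentiableAt (by simp)), dbar_mul d1 d2, dθ,
        heq x hx0]
      ring
    have j3 : Integrable fun x => θ n x * (dbar g x * v x) -
        g x * dbar (cutoff (R n)) x * v x := j1.sub (i3 n)
    rw [integral_congr_ae e, integral_sub j3 j2, integral_sub j1 (i3 n)] at h0
    exact sub_eq_zero.1 h0
  have hR1 : Filter.Tendsto R Filter.atTop (nhds 0) := by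
    simpa [hR] using tendsto_one_div_add_atTop_nhds_zero_nat (𝕜 := ℝ)
  have hθlim : ∀ x ≠ 0, Filter.Tendsto (fun n => θ n x) Filter.atTop (nhds 1) := fun x hx => by
    refine tendsto_const_nhds.congr' ?_
    have hpos : 0 < ‖x‖ / 2 := by positivity
    filter_upwards [hR1.eventually (gt_mem_nhds hpos)] with n hn
    simp only [hθ]
    rw [cutoff_eq_zero (hR0 n) (by linarith), sub_zero]
  have hdct : ∀ {f : Plane → ℂ}, Integrable f →
      Filter.Tendsto (fun n => ∫ x, θ n x * f x) Filter.atTop (nhds (∫ x, f x)) := by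
    intro f hf
    refine tendsto_integral_of_dominated_convergence (fun x => 2 * ‖f x‖)
      (fun n => (sθ n).continuous.aestronglyMeasurable.mul hf.1) (hf.norm.const_mul 2)
      (fun n => Filter.Eventually.of_forall fun x => ?_) ?_
    · rw [norm_mul]
      gcongr
      exact kθ n x
    · filter_upwards [compl_mem_ae_iff.2 (measure_singleton (0 : Plane))] with x hx
      simpa using (hθlim x hx).mul_const (f x)
  have hsmall : Filter.Tendsto (fun n => ∫ x, g x * dbar (cutoff (R n)) x * v x) Filter.atTop
      (nhds 0) := by
    have h1 : Filter.Tendsto (fun n => R n ^ (1 / 2 : ℝ)) Filter.atTop (nhds 0) := by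
      have := hR1.rpow_const (p := (1 / 2 : ℝ)) (Or.inr (by norm_num))
      rwa [Real.zero_rpow (by norm_num)] at this
    have h2 : Filter.Tendsto (fun n => ENNReal.ofReal G * (K * ENNReal.ofReal (R n ^ (1 / 2 : ℝ))))
        Filter.atTop (nhds 0) := by
      have := ENNReal.Tendsto.const_mul (a := ENNReal.ofReal G)
        (ENNReal.Tendsto.const_mul (a := K) (ENNReal.tendsto_ofReal h1) (Or.inr hK))
        (Or.inr ENNReal.ofReal_ne_top)
      simpa using this
    refine tendsto_zero_iff_enorm_tendsto_zero.2
      (tendsto_of_tendsto_of_tendsto_of_le_of_le tendsto_const_nhds h2 (fun _ => zero_le)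
      fun n => (enorm_integral_le_lintegral_enorm _).trans (hbd n))
  have hl := (hdct i1).sub hsmall
  rw [sub_zero] at hl
  exact tendsto_nhds_unique (hl.congr hid) (hdct i2)

open scoped ComplexConjugate

/-! ### Inversion and the Kelvin transform -/

/-- Inversion at the unit circle. -/
noncomputable def inv (x : Plane) : Plane := (‖x‖ ^ 2)⁻¹ • x

lemma norm_inv_apply (x : Plane) : ‖inv x‖ = ‖x‖⁻¹ := by
  rcases eq_or_ne x 0 with rfl | hx
  · simp [inv]
  · rw [inv, norm_smul, norm_inv, norm_pow, norm_norm]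
    field_simp

lemma inv_inv_apply (x : Plane) : inv (inv x) = x := by
  rcases eq_or_ne x 0 with rfl | hx
  · simp [inv]
  · have : ‖x‖ ≠ 0 := norm_ne_zero_iff.2 hx
    nth_rw 1 [inv]
    rw [norm_inv_apply, inv, smul_smul]
    have e : (‖x‖⁻¹ ^ 2)⁻¹ * (‖x‖ ^ 2)⁻¹ = 1 := by field_simp
    rw [e, one_smul]

lemma inv_ne_zero_of_ne {x : Plane} (hx : x ≠ 0) : inv x ≠ 0 := by
  rw [← norm_ne_zero_iff, norm_inv_apply]
  exact _root_.inv_ne_zero (norm_ne_zero_iff.2 hx)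

lemma toC_inv (x : Plane) : toC (inv x) = (conj (toC x))⁻¹ := by
  rw [inv, map_smul, ← map_inv₀, Complex.inv_def, map_mul, Complex.conj_conj, Complex.conj_ofReal,
    Complex.normSq_eq_norm_sq, toC.norm_map, Complex.real_smul, mul_comm]

lemma contDiffAt_inv {x : Plane} (hx : x ≠ 0) : ContDiffAt ℝ ∞ inv x := by
  have h : ‖x‖ ^ 2 ≠ 0 := pow_ne_zero 2 (norm_ne_zero_iff.2 hx)
  exact (ContDiffAt.inv (contDiffAt_id.norm_sq ℝ) h).smul contDiffAt_id

lemma measurable_inv : Measurable inv := by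
  unfold inv
  fun_prop

lemma inv_eq_inversion (x : Plane) : inv x = EuclideanGeometry.inversion 0 1 x := by
  simp [inv, EuclideanGeometry.inversion]

/-- The derivative is `‖x‖⁻²` times a reflection. In dimension two the determinant has modulus
`(‖x‖⁻²)²`. -/
lemma exists_hasFDerivAt_inv {x : Plane} (hx : x ≠ 0) :
    ∃ L : Plane →L[ℝ] Plane, HasFDerivAt inv L x ∧ |L.det| = ‖x‖⁻¹ ^ 4 := by
  refine ⟨_, (EuclideanGeometry.hasFDerivAt_inversion (R := 1) hx).congr_of_eventuallyEq ?_, ?_⟩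
  · exact Filter.Eventually.of_forall inv_eq_inversion
  · rw [ContinuousLinearMap.det, ContinuousLinearMap.toLinearMap_smul, LinearMap.det_smul]
    have h1 := (ℝ ∙ (x - 0))ᗮ.det_reflection
    have h2 : LinearMap.det ((ℝ ∙ (x - 0))ᗮ.reflection : Plane →L[ℝ] Plane).toLinearMap =
      (-1) ^ Module.finrank ℝ (ℝ ∙ (x - 0))ᗮᗮ := h1
    rw [h2, abs_mul, abs_pow (-1), abs_neg, abs_one, one_pow, mul_one, dist_zero_right, ← pow_mul,
      finrank_euclideanSpace_fin, abs_of_nonneg (by positivity), one_div]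

lemma lintegral_inv (f : Plane → ℝ≥0∞) :
    ∫⁻ x, ENNReal.ofReal (‖x‖⁻¹ ^ 4) * f (inv x) = ∫⁻ x, f x := by
  have hL : ∀ x : Plane, ∃ L : Plane →L[ℝ] Plane, x ≠ 0 →
      HasFDerivAt inv L x ∧ |L.det| = ‖x‖⁻¹ ^ 4 := fun x => by
    rcases eq_or_ne x 0 with rfl | hx
    · exact ⟨0, fun h => absurd rfl h⟩
    · obtain ⟨L, h⟩ := exists_hasFDerivAt_inv hx
      exact ⟨L, fun _ => h⟩
  choose L hL using hL
  have himg : inv '' {0}ᶜ = {0}ᶜ := by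
    ext x
    constructor
    · rintro ⟨y, hy, rfl⟩
      exact inv_ne_zero_of_ne hy
    · intro hx
      exact ⟨inv x, inv_ne_zero_of_ne hx, inv_inv_apply x⟩
  have h0 : ∀ᵐ x : Plane, x ∈ ({0}ᶜ : Set Plane) :=
    compl_mem_ae_iff.2 (measure_singleton (0 : Plane))
  have hr : (volume : Measure Plane).restrict {0}ᶜ = volume := Measure.restrict_eq_self_of_ae_mem h0
  have hm : MeasurableSet ({0}ᶜ : Set Plane) := (measurableSet_singleton 0).compl
  have key := lintegral_image_eq_lintegral_abs_det_fderiv_mul (volume : Measure Plane) hm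
    (f := inv) (f' := L) (fun x hx => (hL x hx).1.hasFDerivWithinAt)
    (fun x _ y _ hxy => by rw [← inv_inv_apply x, hxy, inv_inv_apply]) f
  rw [himg, hr] at key
  rw [key]
  refine lintegral_congr_ae ?_
  filter_upwards [h0] with x hx
  rw [(hL x hx).2]

/-- The Kelvin transform of a component of a solution. -/
noncomputable def kelvin (v : Plane → ℂ) (x : Plane) : ℂ :=
  -Complex.I * (toC x)⁻¹ * conj (v (inv x))

lemma norm_kelvin (v : Plane → ℂ) (x : Plane) : ‖kelvin v x‖ = ‖x‖⁻¹ * ‖v (inv x)‖ := by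
  simp [kelvin]

lemma measurable_kelvin {v : Plane → ℂ} (hv : Measurable v) : Measurable (kelvin v) :=
  (measurable_inv_toC.const_mul _).mul
    (Complex.continuous_conj.measurable.comp (hv.comp measurable_inv))

/-- The fourth power of the factor `‖x‖⁻¹` is exactly the Jacobian of inversion, so `L⁴` is the
invariant space. -/
lemma lintegral_kelvin (v : Plane → ℂ) :
    ∫⁻ x, ‖kelvin v x‖ₑ ^ 4 = ∫⁻ x, ‖v x‖ₑ ^ 4 := by
  rw [← lintegral_inv fun x => ‖v x‖ₑ ^ 4]
  refine lintegral_congr fun x => ?_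
  rw [← ofReal_norm, norm_kelvin, ENNReal.ofReal_mul (by positivity), mul_pow,
    ← ENNReal.ofReal_pow (by positivity), ofReal_norm]

lemma contDiffAt_kelvin {v : Plane → ℂ} (hv : ContDiff ℝ ∞ v) {x : Plane} (hx : x ≠ 0) :
    ContDiffAt ℝ ∞ (kelvin v) x := by
  have h1 : ContDiffAt ℝ ∞ (fun x => (toC x)⁻¹) x :=
    ContDiffAt.inv toC.contDiff.contDiffAt (by simpa using hx)
  have h2 : ContDiffAt ℝ ∞ (fun x => conj (v (inv x))) x :=
    Complex.conjCLE.contDiff.contDiffAt.comp x (hv.contDiffAt.comp x (contDiffAt_inv hx))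
  exact (contDiffAt_const.mul h1).mul h2

/-- An `ℝ`-linear map of the plane has the form `h ↦ p h + q h̄`. The combination on the left
cancels the linear part and leaves `2 q c̄`. -/
lemma clm_apply_symm (L : Plane →L[ℝ] ℂ) (c : ℂ) :
    L (toC.symm c) + Complex.I * L (toC.symm (Complex.I * c)) =
      conj c * (L (EuclideanSpace.single 0 1) + Complex.I * L (EuclideanSpace.single 1 1)) := by
  have h : ∀ z : ℂ, toC.symm z = z.re • EuclideanSpace.single 0 1 +
      z.im • EuclideanSpace.single 1 1 := fun z => by
    rw [LinearIsometryEquiv.symm_apply_eq, map_add, map_smul, map_smul, toC_single_zero,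
      toC_single_one]
    simp
  rw [h, h]
  simp only [map_add, map_smul, Complex.real_smul, Complex.I_mul_re, Complex.I_mul_im]
  have hc : conj c = c.re - c.im * Complex.I := by
    rw [← Complex.re_add_im (conj c)]; simp; ring
  rw [hc]
  push_cast
  linear_combination (c.im * L (EuclideanSpace.single 1 1)) * Complex.I_sq

lemma dbar_inv_toC {x : Plane} (hx : x ≠ 0) : dbar (fun x => (toC x)⁻¹) x = 0 := by
  have h0 : toC x ≠ 0 := by simpa using hx
  have h1 := ((hasDerivAt_inv h0).hasFDerivAt.restrictScalars ℝ).comp x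
    toC.toContinuousLinearEquiv.hasFDerivAt
  have h2 : HasFDerivAt (fun x => (toC x)⁻¹) _ x := h1
  rw [dbar, h2.fderiv]
  simp [toC_single_zero, toC_single_one]
  linear_combination (-(toC x ^ 2)⁻¹) * Complex.I_sq

/-- In complex notation inversion is `z ↦ 1/z̄`. It is antiholomorphic, as is the outer conjugation,
so the two reversals send `dbar` to a conjugated `dbar`, with chain factor `-1/z̄²`. -/
lemma dbar_conj_comp_inv {v : Plane → ℂ} {x : Plane} (hx : x ≠ 0)
    (hv : DifferentiableAt ℝ v (inv x)) :
    dbar (fun x => conj (v (inv x))) x = -((conj (toC x)) ^ 2)⁻¹ * conj (dbar v (inv x)) := by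
  have h0 : conj (toC x) ≠ 0 := by simpa using hx
  obtain ⟨J, hinv, hJ⟩ : ∃ J : Plane →L[ℝ] Plane, HasFDerivAt inv J x ∧
      ∀ h, J h = toC.symm (-(conj (toC h) * ((conj (toC x)) ^ 2)⁻¹)) := by
    have h1 := toC.symm.toContinuousLinearEquiv.hasFDerivAt.comp x
      (((hasDerivAt_inv h0).hasFDerivAt.restrictScalars ℝ).comp x
        (Complex.conjCLE.hasFDerivAt.comp x toC.toContinuousLinearEquiv.hasFDerivAt))
    have e : inv = fun x => toC.symm ((conj (toC x))⁻¹) := by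
      funext y
      rw [← toC_inv, LinearIsometryEquiv.symm_apply_apply]
    refine ⟨_, by rw [e]; exact h1, fun h => ?_⟩
    simp
  have h2 := Complex.conjCLE.hasFDerivAt.comp x (hv.hasFDerivAt.comp x hinv)
  have h3 : HasFDerivAt (fun x => conj (v (inv x))) _ x := h2
  set c := ((conj (toC x)) ^ 2)⁻¹ with hc
  have key := clm_apply_symm (fderiv ℝ v (inv x)) c
  rw [dbar, h3.fderiv]
  have e0 : J (EuclideanSpace.single 0 1) = -toC.symm c := by
    rw [hJ, toC_single_zero, ← map_neg]; simp [hc]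
  have e1 : J (EuclideanSpace.single 1 1) = toC.symm (Complex.I * c) := by
    rw [hJ, toC_single_one]; simp [hc]
  have key' : conj (dbar v (inv x)) * c = conj (fderiv ℝ v (inv x) (toC.symm c)) -
      Complex.I * conj (fderiv ℝ v (inv x) (toC.symm (Complex.I * c))) := by
    have := congr_arg conj key
    simp only [map_add, map_mul, Complex.conj_I, Complex.conj_conj] at this
    rw [dbar, map_add, map_mul, Complex.conj_I]
    linear_combination -this
  have hJ0 : ∀ h, (Complex.conjCLE.toContinuousLinearMap.comp ((fderiv ℝ v (inv x)).comp J)) h =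
      conj (fderiv ℝ v (inv x) (J h)) := fun h => rfl
  rw [hJ0, hJ0, e0, e1, map_neg, map_neg]
  linear_combination key'

lemma dbar_kelvin {v : Plane → ℂ} (hv : Differentiable ℝ v) {x : Plane} (hx : x ≠ 0) :
    dbar (kelvin v) x =
      Complex.I * (toC x)⁻¹ * ((conj (toC x)) ^ 2)⁻¹ * conj (dbar v (inv x)) := by
  have d1 : DifferentiableAt ℝ (fun x => (toC x)⁻¹) x :=
    (ContDiffAt.inv (n := 1) toC.contDiff.contDiffAt (by simpa using hx)).differentiableAt (by simp)
  have d2 : DifferentiableAt ℝ (fun x => conj (v (inv x))) x :=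
    Complex.conjCLE.differentiableAt.comp x
      ((hv _).comp x ((contDiffAt_inv hx).differentiableAt (by simp)))
  have d3 : DifferentiableAt ℝ (fun x => -Complex.I * (toC x)⁻¹) x := d1.const_mul _
  have e : dbar (fun _ => -Complex.I) x = 0 := by simp [dbar]
  unfold kelvin
  rw [dbar_mul d3 d2, dbar_mul (differentiableAt_const _) d1, e, dbar_inv_toC hx,
    dbar_conj_comp_inv hx (hv _)]
  ring

lemma setLIntegral_ball_cubic_ne_top (β₁ β₂ : ℝ) {a b : Plane → ℂ} (ma : Measurable a)
    (mb : Measurable b) (ha : ∫⁻ x, ‖a x‖ₑ ^ 4 ≠ ⊤) (hb : ∫⁻ x, ‖b x‖ₑ ^ 4 ≠ ⊤) {c : ℂ}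
    (hc : ‖c‖ = 1) (r : ℝ) (hr : 0 < r) :
    ∫⁻ x in Metric.ball 0 r, ‖c * cubic β₁ β₂ (a x) (b x)‖ₑ ≠ ⊤ := by
  have mu : Measurable fun x => ‖a x‖ₑ + ‖b x‖ₑ := ma.enorm.add mb.enorm
  have h4 : ∫⁻ x, (‖a x‖ₑ + ‖b x‖ₑ) ^ 4 ≠ ⊤ := by
    refine ne_top_of_le_ne_top ?_ (lintegral_mono fun x => ennreal_add_pow_le _ _ 4)
    rw [lintegral_const_mul' _ _ (by finiteness), lintegral_add_left (ma.enorm.pow_const 4)]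
    exact ENNReal.mul_ne_top (by finiteness) (ENNReal.add_ne_top.2 ⟨ha, hb⟩)
  obtain ⟨B, hB, hle⟩ := exists_setLIntegral_ball_cube_le mu h4
  have hc1 : ‖c‖ₑ = 1 := by rw [← ofReal_norm, hc, ENNReal.ofReal_one]
  refine ne_top_of_le_ne_top (ENNReal.mul_ne_top (ENNReal.ofReal_ne_top (r := |β₁| + 2 * |β₂|))
    (ne_top_of_le_ne_top (by finiteness) (hle 0 r hr))) ?_
  rw [← lintegral_const_mul' _ _ ENNReal.ofReal_ne_top]
  refine lintegral_mono fun x => ?_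
  rw [enorm_mul, hc1, one_mul]
  exact enorm_cubic_le _ _ _ _

/-- By homogeneity of degree three the nonlinearity acquires the same factor `i z⁻¹ z̄⁻²` that
`dbar` acquires in `dbar_kelvin`. This coincidence makes the system covariant. -/
lemma cubic_kelvin (β₁ β₂ : ℝ) (v₁ v₂ : Plane → ℂ) (x : Plane) :
    cubic β₁ β₂ (kelvin v₁ x) (kelvin v₂ x) =
      Complex.I * (toC x)⁻¹ * ((conj (toC x)) ^ 2)⁻¹ *
        conj (cubic β₁ β₂ (v₁ (inv x)) (v₂ (inv x))) := by
  simp only [cubic_eq, kelvin, map_mul, map_neg, map_add, map_inv₀, Complex.conj_I,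
    Complex.conj_conj, Complex.conj_ofReal, map_ofNat]
  rw [← inv_pow]
  linear_combination (-(Complex.I * (toC x)⁻¹ * ((conj (toC x))⁻¹ ^ 2) *
    (β₁ * (conj (v₂ (inv x)) * v₂ (inv x) * v₂ (inv x)) +
      2 * β₂ * (conj (v₁ (inv x)) * v₁ (inv x) * v₂ (inv x))))) * Complex.I_sq

/-- Invariance of the system under the Kelvin transform. -/
theorem isWeakSystem_kelvin {β₁ β₂ : ℝ} {v₁ v₂ : Plane → ℂ} (h : IsWeakSystem β₁ β₂ v₁ v₂)
    (s₁ : ContDiff ℝ ∞ v₁) (s₂ : ContDiff ℝ ∞ v₂)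
    (h₁ : ∫⁻ x, ‖v₁ x‖ₑ ^ 4 ≠ ⊤) (h₂ : ∫⁻ x, ‖v₂ x‖ₑ ^ 4 ≠ ⊤) :
    IsWeakSystem β₁ β₂ (kelvin v₂) (kelvin v₁) := by
  have m₁ := measurable_kelvin s₁.continuous.measurable
  have m₂ := measurable_kelvin s₂.continuous.measurable
  have k₁ : ∫⁻ x, ‖kelvin v₁ x‖ₑ ^ 4 ≠ ⊤ := by rwa [lintegral_kelvin]
  have k₂ : ∫⁻ x, ‖kelvin v₂ x‖ₑ ^ 4 ≠ ⊤ := by rwa [lintegral_kelvin]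
  have c₁ : Continuous fun x => -Complex.I * cubic β₁ β₂ (v₁ x) (v₂ x) := by
    simp only [cubic]
    have := s₁.continuous
    have := s₂.continuous
    fun_prop
  have c₂ : Continuous fun x => Complex.I * cubic β₁ β₂ (v₂ x) (v₁ x) := by
    simp only [cubic]
    have := s₁.continuous
    have := s₂.continuous
    fun_prop
  -- The conjugation in the Kelvin transform turns `i` into `-i`. The two equations carry opposite
  -- signs, so the transform of `v₂` satisfies the first and that of `v₁` the second.
  constructor
  · refine weakDbar_of_punctured m₂ ((m₂.cubic m₁).const_mul _) k₂
      (setLIntegral_ball_cubic_ne_top β₁ β₂ m₂ m₁ k₂ k₁ (by simp))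
      (fun x hx => contDiffAt_kelvin s₂ hx) fun x hx => ?_
    rw [dbar_kelvin (s₂.differentiable (by simp)) hx, h.2.dbar_eq s₂ c₂, cubic_kelvin,
      map_neg, map_mul, Complex.conj_I]
    ring
  · refine weakDbar_of_punctured m₁ ((m₁.cubic m₂).const_mul _) k₁
      (setLIntegral_ball_cubic_ne_top β₁ β₂ m₁ m₂ k₁ k₂ (by simp))
      (fun x hx => contDiffAt_kelvin s₁ hx) fun x hx => ?_
    rw [dbar_kelvin (s₁.differentiable (by simp)) hx, h.1.dbar_eq s₁ c₁, cubic_kelvin,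
      map_neg, map_mul, map_neg, Complex.conj_I]
    ring

/-- The Kelvin transform of a solution extends smoothly across the origin. -/
theorem exists_contDiff_eq_kelvin {β₁ β₂ : ℝ} {v₁ v₂ : Plane → ℂ}
    (h : IsWeakSystem β₁ β₂ v₁ v₂) (s₁ : ContDiff ℝ ∞ v₁) (s₂ : ContDiff ℝ ∞ v₂)
    (h₁ : ∫⁻ x, ‖v₁ x‖ₑ ^ 4 ≠ ⊤) (h₂ : ∫⁻ x, ‖v₂ x‖ₑ ^ 4 ≠ ⊤) :
    ∃ w₁ w₂ : Plane → ℂ, ContDiff ℝ ∞ w₁ ∧ ContDiff ℝ ∞ w₂ ∧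
      ∀ x ≠ 0, w₁ x = kelvin v₁ x ∧ w₂ x = kelvin v₂ x := by
  have m₁ := measurable_kelvin s₁.continuous.measurable
  have m₂ := measurable_kelvin s₂.continuous.measurable
  obtain ⟨w₂, w₁, t₂, t₁, e₂, e₁⟩ := (isWeakSystem_kelvin h s₁ s₂ h₁ h₂).exists_contDiff m₂ m₁
    (by rwa [lintegral_kelvin]) (by rwa [lintegral_kelvin])
  -- Away from the origin both functions are continuous, so equality almost everywhere becomes
  -- equality at every point.
  have ext : ∀ {v w : Plane → ℂ}, ContDiff ℝ ∞ v → ContDiff ℝ ∞ w → w =ᵐ[volume] kelvin v →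
      Set.EqOn w (kelvin v) {0}ᶜ := fun hv hw e =>
    Measure.eqOn_open_of_ae_eq (ae_restrict_of_ae e) isOpen_compl_singleton
      hw.continuous.continuousOn
      fun x hx => (contDiffAt_kelvin hv hx).continuousAt.continuousWithinAt
  exact ⟨w₁, w₂, t₁, t₂, fun x hx => ⟨ext s₁ t₁ e₁ hx, ext s₂ t₂ e₂ hx⟩⟩

/-! ### Taylor expansion in multi-index form -/

section Taylor

variable {E : Type*} [NormedAddCommGroup E] [NormedSpace ℝ E]

/-- A symmetric evaluation of a multilinear map on the plane is a homogeneous polynomial. -/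
lemma exists_multilinear_apply_eq (k : ℕ) (f : Plane [×k]→L[ℝ] E) :
    ∃ c : ℕ → E, ∀ y : Plane, f (fun _ => y) =
      ∑ α ∈ Finset.HasAntidiagonal.antidiagonal k, (y 0 ^ α.1 * y 1 ^ α.2) • c α.1 := by
  set e₀ : Plane := EuclideanSpace.single 0 1
  set e₁ : Plane := EuclideanSpace.single 1 1
  -- Expand `y = y 0 • e₀ + y 1 • e₁` in every slot; the coefficient indexed by `a` collects the
  -- choices with `e₀` in exactly `a` slots.
  refine ⟨fun a => ∑ s ∈ Finset.powersetCard a (Finset.univ : Finset (Fin k)),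
    f (s.piecewise (fun _ => e₀) fun _ => e₁), fun y => ?_⟩
  have hy : (fun _ : Fin k => y) = (fun _ => y 0 • e₀) + fun _ => y 1 • e₁ := by
    funext i
    ext j
    fin_cases j <;> simp [e₀, e₁]
  rw [hy, f.map_add_univ, ← Finset.powerset_univ, Finset.sum_powerset,
    Finset.Nat.sum_antidiagonal_eq_sum_range_succ_mk, Finset.card_univ, Fintype.card_fin]
  refine Finset.sum_congr rfl fun a ha => ?_
  rw [Finset.smul_sum]
  refine Finset.sum_congr rfl fun s hs => ?_
  have hcard : s.card = a := (Finset.mem_powersetCard.1 hs).2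
  have e : s.piecewise (fun _ => y 0 • e₀) (fun _ => y 1 • e₁) =
      fun i => (s.piecewise (fun _ => y 0) (fun _ => y 1) : Fin k → ℝ) i •
        (s.piecewise (fun _ => e₀) (fun _ => e₁) : Fin k → Plane) i := by
    funext i
    by_cases hi : i ∈ s <;> simp [hi]
  rw [e, f.map_smul_univ, Finset.prod_piecewise]
  simp only [Finset.univ_inter, Finset.prod_const, hcard, ← Finset.compl_eq_univ_sdiff,
    Finset.card_compl, Fintype.card_fin]

/-- Taylor expansion at the origin of the plane. -/
theorem exists_taylor [CompleteSpace E] {Ψ : Plane → E} (hΨ : ContDiff ℝ ∞ Ψ) :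
    ∃ ζ : ℕ × ℕ → E, ∀ M : ℕ, ∃ C : ℝ, ∀ y : Plane, ‖y‖ ≤ 1 →
      ‖Ψ y - ∑ k ∈ Finset.range (M + 1), ∑ α ∈ Finset.HasAntidiagonal.antidiagonal k,
        (y 0 ^ α.1 * y 1 ^ α.2) • ζ α‖ ≤ C * ‖y‖ ^ (M + 1) := by
  choose c hc using fun k => exists_multilinear_apply_eq k (iteratedFDeriv ℝ k Ψ 0)
  refine ⟨fun α => ((α.1 + α.2).factorial : ℝ)⁻¹ • c (α.1 + α.2) α.1, fun M => ?_⟩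
  have hcont : Continuous (iteratedFDeriv ℝ (M + 1) Ψ) :=
    hΨ.continuous_iteratedFDeriv (by exact_mod_cast le_top)
  obtain ⟨C, hC⟩ := (isCompact_closedBall (0 : Plane) 1).exists_bound_of_continuousOn
    hcont.continuousOn
  refine ⟨C, fun y hy => ?_⟩
  have ht := map_add_eq_sum_add_integral_iteratedFDeriv (f := Ψ) (x := 0) (y := y) (n := M)
    fun t _ => (hΨ.of_le (by exact_mod_cast le_top)).contDiffAt
  have hsum : ∑ k ∈ Finset.range (M + 1), (k.factorial : ℝ)⁻¹ •
      iteratedFDeriv ℝ k Ψ 0 (fun _ => y) =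
      ∑ k ∈ Finset.range (M + 1), ∑ α ∈ Finset.HasAntidiagonal.antidiagonal k,
        (y 0 ^ α.1 * y 1 ^ α.2) • ((α.1 + α.2).factorial : ℝ)⁻¹ • c (α.1 + α.2) α.1 := by
    refine Finset.sum_congr rfl fun k _ => ?_
    rw [hc, Finset.smul_sum]
    refine Finset.sum_congr rfl fun α hα => ?_
    rw [Finset.HasAntidiagonal.mem_antidiagonal.1 hα, smul_comm]
  simp only [zero_add] at ht
  rw [hsum] at ht
  rw [ht, add_sub_cancel_left, norm_smul]
  have hC0 : 0 ≤ C := (norm_nonneg _).trans (hC 0 (by simp))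
  have hint : ‖∫ t in (0 : ℝ)..1, (1 - t) ^ M •
      iteratedFDeriv ℝ (M + 1) Ψ (t • y) (fun _ => y)‖ ≤ C * ‖y‖ ^ (M + 1) * |1 - 0| := by
    refine intervalIntegral.norm_integral_le_of_norm_le_const fun t ht => ?_
    rw [Set.uIoc_of_le zero_le_one] at ht
    have hmem : t • y ∈ Metric.closedBall (0 : Plane) 1 := by
      rw [mem_closedBall_zero_iff, norm_smul, Real.norm_of_nonneg ht.1.le]
      exact mul_le_one₀ ht.2 (norm_nonneg _) hy
    have h1 : ‖(1 - t) ^ M‖ ≤ 1 := by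
      rw [norm_pow, Real.norm_of_nonneg (by linarith [ht.2])]
      exact pow_le_one₀ (by linarith [ht.2]) (by linarith [ht.1])
    rw [norm_smul]
    calc _ ≤ 1 * (‖iteratedFDeriv ℝ (M + 1) Ψ (t • y)‖ * ‖y‖ ^ (M + 1)) := by
          gcongr
          simpa using (iteratedFDeriv ℝ (M + 1) Ψ (t • y)).le_opNorm fun _ => y
      _ ≤ _ := by
          rw [one_mul]
          gcongr
          exact hC _ hmem
  rw [sub_zero, abs_one, mul_one] at hint
  have hfac : ‖((M.factorial : ℝ))⁻¹‖ ≤ 1 := by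
    rw [norm_inv, Real.norm_natCast]
    exact inv_le_one_of_one_le₀ (by exact_mod_cast Nat.one_le_iff_ne_zero.2 M.factorial_ne_zero)
  calc _ ≤ 1 * (C * ‖y‖ ^ (M + 1)) := by gcongr
    _ = _ := one_mul _

end Taylor

/-! ### Return to spinors -/

lemma norm_act_unitaryMatrix {x : Plane} (hx : x ≠ 0) (z : Spinor) :
    ‖act (unitaryMatrix x) z‖ = ‖z‖ := by
  have hn : ‖x‖ ≠ 0 := norm_ne_zero_iff.2 hx
  have h1 : ‖(x 0 : ℂ) + Complex.I * (x 1 : ℂ)‖ = ‖x‖ := by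
    rw [← toC.norm_map x, toC_apply, mul_comm Complex.I]
  have h2 : ‖(x 0 : ℂ) - Complex.I * (x 1 : ℂ)‖ = ‖x‖ := by
    rw [← h1, ← RCLike.norm_conj]
    simp
  rw [EuclideanSpace.norm_eq, EuclideanSpace.norm_eq]
  congr 1
  simp only [Fin.sum_univ_two, act, unitaryMatrix, Matrix.mulVec, dotProduct]
  simp [h1, h2, hn, add_comm]

/-- Since `inv x` has coordinates `x_j / ‖x‖²`, the prescribed sum is an ordinary polynomial in the
inverted variable, ready to be matched with a Taylor polynomial at the origin. -/
lemma expansionSum_eq (ζ : ℕ × ℕ → Spinor) (M : ℕ) (x : Plane) : expansionSum ζ M x =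
    ∑ k ∈ Finset.range (M + 1), ∑ α ∈ Finset.HasAntidiagonal.antidiagonal k,
      (inv x 0 ^ α.1 * inv x 1 ^ α.2) • ζ α := by
  refine Finset.sum_congr rfl fun k _ => Finset.sum_congr rfl fun α _ => ?_
  congr 1
  simp only [inv, PiLp.smul_apply, smul_eq_mul, mul_pow, inv_pow, ← pow_mul]
  rw [mul_add, pow_add, div_eq_mul_inv, mul_inv]
  ring

lemma fderiv_toLp_apply {a b : Plane → ℂ} {x : Plane} (ha : DifferentiableAt ℝ a x)
    (hb : DifferentiableAt ℝ b x) (e : Plane) :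
    fderiv ℝ (fun y => (WithLp.toLp 2 ![a y, b y] : Spinor)) x e =
      WithLp.toLp 2 ![fderiv ℝ a x e, fderiv ℝ b x e] := by
  have h : HasFDerivAt (fun y => (WithLp.toLp 2 ![a y, b y] : Spinor))
      ((PiLp.continuousLinearEquiv 2 ℝ fun _ : Fin 2 => ℂ).symm.toContinuousLinearMap.comp
        (ContinuousLinearMap.pi ![fderiv ℝ a x, fderiv ℝ b x])) x := by
    have h1 : HasFDerivAt (fun y => (![a y, b y] : Fin 2 → ℂ))
        (ContinuousLinearMap.pi ![fderiv ℝ a x, fderiv ℝ b x]) x := by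
      refine hasFDerivAt_pi'' fun i => ?_
      fin_cases i
      · exact ha.hasFDerivAt
      · exact hb.hasFDerivAt
    exact ((PiLp.continuousLinearEquiv 2 ℝ fun _ : Fin 2 => ℂ).symm.hasFDerivAt).comp x h1
  rw [h.fderiv]
  ext i
  fin_cases i <;> simp

lemma contDiff_toLp {a b : Plane → ℂ} (ha : ContDiff ℝ ∞ a) (hb : ContDiff ℝ ∞ b) :
    ContDiff ℝ ∞ fun y => (WithLp.toLp 2 ![a y, b y] : Spinor) := by
  refine (PiLp.continuousLinearEquiv 2 ℝ fun _ : Fin 2 => ℂ).symm.contDiff.comp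
    (contDiff_pi.2 fun i => ?_)
  fin_cases i
  · exact ha
  · exact hb

lemma contDiff_conj {a : Plane → ℂ} (ha : ContDiff ℝ ∞ a) : ContDiff ℝ ∞ fun x => conj (a x) :=
  Complex.conjCLE.contDiff.comp ha

/-- The prefactor `‖z‖²` undoes the normalization of the argument of `angular`, leaving a polynomial
in the components. The origin, where the normalization degenerates, is checked separately. -/
lemma act_nonlinearity (β₁ β₂ : ℝ) (z : Spinor) : act (nonlinearity β₁ β₂ z) z =
    WithLp.toLp 2 ![cubic β₁ β₂ (conj (z 1)) (conj (z 0)),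
      cubic β₁ β₂ (z 0) (conj (z 1))] := by
  rcases eq_or_ne z 0 with rfl | hz
  · ext i
    fin_cases i <;> simp [act, cubic]
  have hn : (‖z‖ : ℂ) ≠ 0 := by simpa using hz
  ext i
  fin_cases i <;>
  · simp [act, nonlinearity, angular, cubic, Matrix.vecHead, Matrix.vecTail]
    field_simp
    simp

lemma dirac_toLp {a b : Plane → ℂ} {x : Plane} (ha : DifferentiableAt ℝ a x)
    (hb : DifferentiableAt ℝ b x) :
    dirac (fun y => (WithLp.toLp 2 ![a y, b y] : Spinor)) x =
      WithLp.toLp 2 ![-Complex.I * conj (dbar (fun y => conj (b y)) x), -Complex.I * dbar a x] := by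
  have hc : ∀ e, fderiv ℝ (fun y => conj (b y)) x e = conj (fderiv ℝ b x e) := fun e => by
    have : HasFDerivAt (fun y => conj (b y)) _ x :=
      Complex.conjCLE.hasFDerivAt.comp x hb.hasFDerivAt
    rw [this.fderiv]
    rfl
  simp only [dirac, Fin.sum_univ_two, fderiv_toLp_apply ha hb, dbar, hc]
  ext i
  fin_cases i
  · simp [act, alpha]
    ring
  · simp [act, alpha]
    ring

/-- The components of a weak solution of the Dirac equation solve the system. -/
lemma IsWeakSolution.isWeakSystem {β₁ β₂ : ℝ} {ψ : Plane → Spinor}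
    (h : IsWeakSolution (nonlinearity β₁ β₂) ψ) :
    IsWeakSystem β₁ β₂ (fun x => ψ x 0) (fun x => conj (ψ x 1)) := by
  constructor
  · intro g hg hc
    -- A test spinor supported in the second component isolates the equation for `ψ₁`. It carries
    -- `conj g` because the inner product is conjugate linear in its first argument.
    have hgc := contDiff_conj hg
    have hs : HasCompactSupport fun x => (WithLp.toLp 2 ![0, conj (g x)] : Spinor) :=
      hc.comp_left (g := fun z : ℂ => (WithLp.toLp 2 ![0, conj z] : Spinor)) (by
        ext i; fin_cases i <;> simp)
    have key := h (fun x => WithLp.toLp 2 ![0, conj (g x)]) (contDiff_toLp contDiff_const hgc) hs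
    have e1 : ∀ x, inner ℂ (dirac (fun x => WithLp.toLp 2 ![0, conj (g x)]) x) (ψ x) =
        Complex.I * (dbar g x * ψ x 0) := fun x => by
      rw [dirac_toLp (differentiableAt_const _) (hgc.differentiable (by simp) x)]
      simp [PiLp.inner_apply, dbar]
      ring
    have e2 : ∀ x, inner ℂ (WithLp.toLp 2 ![0, conj (g x)] : Spinor)
        (act (nonlinearity β₁ β₂ (ψ x)) (ψ x)) =
        g x * cubic β₁ β₂ (ψ x 0) (conj (ψ x 1)) := fun x => by
      rw [act_nonlinearity]
      simp [PiLp.inner_apply]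
      ring
    simp only [e1, e2] at key
    rw [integral_const_mul] at key
    have : (fun x => g x * (-Complex.I * cubic β₁ β₂ (ψ x 0) (conj (ψ x 1)))) =
      fun x => -Complex.I * (g x * cubic β₁ β₂ (ψ x 0) (conj (ψ x 1))) := by funext x; ring
    rw [this, integral_const_mul, ← key, ← mul_assoc]
    simp
  · intro g hg hc
    -- Here the second unknown is `ψ̄₂`: `g` is used unconjugated, and the whole tested identity is
    -- conjugated at the end.
    have hs : HasCompactSupport fun x => (WithLp.toLp 2 ![g x, 0] : Spinor) :=
      hc.comp_left (g := fun z : ℂ => (WithLp.toLp 2 ![z, 0] : Spinor)) (by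
        ext i; fin_cases i <;> simp)
    have key := h (fun x => WithLp.toLp 2 ![g x, 0]) (contDiff_toLp hg contDiff_const) hs
    have e1 : ∀ x, inner ℂ (dirac (fun x => WithLp.toLp 2 ![g x, 0]) x) (ψ x) =
        conj (-Complex.I * (dbar g x * conj (ψ x 1))) := fun x => by
      rw [dirac_toLp (hg.differentiable (by simp) x) (differentiableAt_const _)]
      simp [PiLp.inner_apply, dbar]
      ring
    have e2 : ∀ x, inner ℂ (WithLp.toLp 2 ![g x, 0] : Spinor)
        (act (nonlinearity β₁ β₂ (ψ x)) (ψ x)) =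
        conj (g x * cubic β₁ β₂ (conj (ψ x 1)) (ψ x 0)) := fun x => by
      rw [act_nonlinearity]
      simp [PiLp.inner_apply, cubic]
      rw [show conj (2 : ℂ) = 2 from map_ofNat _ 2]
      ring
    simp only [e1, e2] at key
    rw [integral_conj, integral_conj] at key
    have key' := (starRingEnd ℂ).injective key
    rw [integral_const_mul] at key'
    have : (fun x => g x * (Complex.I * cubic β₁ β₂ (conj (ψ x 1)) (ψ x 0))) =
      fun x => Complex.I * (g x * cubic β₁ β₂ (conj (ψ x 1)) (ψ x 0)) := by funext x; ring
    rw [this, integral_const_mul, ← key', ← mul_assoc]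
    simp

/-- A solution recovered from the Kelvin transforms of its components. -/
lemma toLp_eq_act_unitaryMatrix {v₁ v₂ : Plane → ℂ} {x : Plane} (hx : x ≠ 0) :
    (WithLp.toLp 2 ![v₁ x, conj (v₂ x)] : Spinor) = ‖x‖⁻¹ • act (unitaryMatrix x)
      (WithLp.toLp 2 ![kelvin v₂ (inv x), conj (kelvin v₁ (inv x))]) := by
  have hz : (‖x‖ : ℂ) ≠ 0 := by simpa using hx
  have h1 : (x 0 : ℂ) + Complex.I * (x 1 : ℂ) = toC x := by rw [toC_apply, mul_comm Complex.I]
  have h2 : (x 0 : ℂ) - Complex.I * (x 1 : ℂ) = conj (toC x) := by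
    rw [← h1]; simp; ring
  have h3 : conj (toC x) * toC x = (‖x‖ : ℂ) ^ 2 := by
    rw [mul_comm, Complex.mul_conj, Complex.normSq_eq_norm_sq, toC.norm_map]; push_cast; rfl
  ext i
  fin_cases i
  · simp [act, unitaryMatrix, kelvin, toC_inv, inv_inv_apply, h1, h2]
    field_simp
    linear_combination (v₁ x * Complex.I ^ 2) * h3 + v₁ x * (‖x‖ : ℂ) ^ 2 * Complex.I_sq
  · simp [act, unitaryMatrix, kelvin, toC_inv, inv_inv_apply, h1, h2]
    field_simp
    linear_combination (conj (v₂ x) * Complex.I ^ 2) * h3 + conj (v₂ x) * (‖x‖ : ℂ) ^ 2 * Complex.I_sq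

end CriticalDirac

open CriticalDirac in
theorem corollary5p4 (β₁ β₂ : ℝ) (hβ₁ : 0 ≤ β₁) (hβ₂ : 0 ≤ β₂)
    (ψ : CriticalDirac.Plane → CriticalDirac.Spinor) (hψ : MemLp ψ 4 volume)
    (hsol : CriticalDirac.IsWeakSolution (CriticalDirac.nonlinearity β₁ β₂) ψ) :
    ∃ ψ' : CriticalDirac.Plane → CriticalDirac.Spinor,
      ContDiff ℝ ∞ ψ' ∧ ψ' =ᵐ[volume] ψ ∧
      ∃ ζ : ℕ × ℕ → CriticalDirac.Spinor, ∀ M : ℕ, ∃ C : ℝ,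
        ∀ x : CriticalDirac.Plane, 1 ≤ ‖x‖ →
          ‖ψ' x - ‖x‖⁻¹ • CriticalDirac.act (CriticalDirac.unitaryMatrix x)
              (CriticalDirac.expansionSum ζ M x)‖ ≤ C / ‖x‖ ^ (M + 2) := by
  have hsm := hψ.1
  set φ := hsm.mk ψ with hφ
  have mφ : Measurable φ := hsm.stronglyMeasurable_mk.measurable
  have hae : ψ =ᵐ[volume] φ := hsm.ae_eq_mk
  have m₁ : Measurable fun x => φ x 0 := (measurable_pi_apply 0).comp
    ((WithLp.measurable_ofLp 2 _).comp mφ)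
  have mφ1 : Measurable fun x => φ x 1 := (measurable_pi_apply 1).comp
    ((WithLp.measurable_ofLp 2 _).comp mφ)
  have m₂ : Measurable fun x => (starRingEnd ℂ) (φ x 1) :=
    Complex.continuous_conj.measurable.comp mφ1
  have hsys : IsWeakSystem β₁ β₂ (fun x => φ x 0) (fun x => (starRingEnd ℂ) (φ x 1)) := by
    refine hsol.isWeakSystem.congr_ae ?_ ?_ <;>
    · filter_upwards [hae] with x hx
      rw [hx]
  have h4 : ∀ {v : Plane → ℂ}, (∀ x, ‖v x‖ ≤ ‖φ x‖) → ∫⁻ x, ‖v x‖ₑ ^ 4 ≠ ⊤ := by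
    intro v hv
    have h1 := (hψ.ae_eq hae).eLpNorm_lt_top
    rw [eLpNorm_lt_top_iff_lintegral_rpow_enorm_lt_top (by norm_num) (by norm_num)] at h1
    refine ne_top_of_le_ne_top h1.ne (lintegral_mono fun x => ?_)
    rw [show ((4 : ℝ≥0∞).toReal) = ((4 : ℕ) : ℝ) by norm_num, ENNReal.rpow_natCast]
    gcongr
    exact enorm_le_iff_norm_le.2 (hv x)
  have a₁ := h4 (v := fun x => φ x 0) fun x => PiLp.norm_apply_le _ 0
  have a₂ := h4 (v := fun x => (starRingEnd ℂ) (φ x 1)) fun x => by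
    rw [RCLike.norm_conj]
    exact PiLp.norm_apply_le _ 1
  obtain ⟨v₁, v₂, s₁, s₂, e₁, e₂⟩ := hsys.exists_contDiff m₁ m₂ a₁ a₂
  have b₁ : ∫⁻ x, ‖v₁ x‖ₑ ^ 4 ≠ ⊤ := by
    rwa [lintegral_congr_ae (g := fun x => ‖φ x 0‖ₑ ^ 4)]
    filter_upwards [e₁] with x hx
    rw [hx]
  have b₂ : ∫⁻ x, ‖v₂ x‖ₑ ^ 4 ≠ ⊤ := by
    rwa [lintegral_congr_ae (g := fun x => ‖(starRingEnd ℂ) (φ x 1)‖ₑ ^ 4)]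
    filter_upwards [e₂] with x hx
    rw [hx]
  obtain ⟨w₁, w₂, t₁, t₂, hw⟩ := exists_contDiff_eq_kelvin (hsys.congr_ae e₁ e₂) s₁ s₂ b₁ b₂
  -- The smooth spinor expanded at the origin is `(w₂, conj w₁)`; the components appear swapped
  -- because `𝒰` is off-diagonal.
  obtain ⟨ζ, hζ⟩ := exists_taylor (contDiff_toLp t₂ (contDiff_conj t₁))
  refine ⟨fun x => WithLp.toLp 2 ![v₁ x, (starRingEnd ℂ) (v₂ x)],
    contDiff_toLp s₁ (contDiff_conj s₂), ?_, ζ, fun M => ?_⟩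
  · filter_upwards [hae, e₁, e₂] with x hx h1 h2
    rw [hx, h1, h2]
    ext i
    fin_cases i <;> simp
  · obtain ⟨C, hC⟩ := hζ M
    refine ⟨C, fun x hx => ?_⟩
    have hn : 0 < ‖x‖ := by linarith
    have hx0 : x ≠ 0 := norm_pos_iff.1 hn
    have hle := hC (inv x) (by rw [norm_inv_apply]; exact inv_le_one_of_one_le₀ hx)
    rw [(hw _ (inv_ne_zero_of_ne hx0)).1, (hw _ (inv_ne_zero_of_ne hx0)).2, ← expansionSum_eq,
      norm_inv_apply] at hle
    have hsub : ∀ z w : Spinor, act (unitaryMatrix x) z - act (unitaryMatrix x) w =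
        act (unitaryMatrix x) (z - w) := fun z w => by
      simp only [act, WithLp.ofLp_sub, Matrix.mulVec_sub, WithLp.toLp_sub]
    simp only
    rw [toLp_eq_act_unitaryMatrix hx0, ← smul_sub, hsub, norm_smul, norm_act_unitaryMatrix hx0,
      norm_inv, norm_norm]
    -- `𝒰(x)` is an isometry, so the remainder is the prefactor `‖x‖⁻¹` times the Taylor remainder
    -- at `inv x`, of order `‖x‖⁻¹ ^ (M + 1)`.
    calc _ ≤ ‖x‖⁻¹ * (C * ‖x‖⁻¹ ^ (M + 1)) := by gcongr
      _ = _ := by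
        rw [div_eq_mul_inv, ← inv_pow]
        ring
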